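/- **Setting.** Let $n,k\ge 1$, let $\bar c,c>0$, $L\ge 1$, $0<C_1\le C_2$, and fix a finite collection of reference patches; a reference patch is a finite conforming triangulation by $n$-simplices of a convex subset of $\mathbb R^n$, one of whose simplices is the unit simplex $\widehat T$. Consider any compact embedded $C^2$ hypersurface $\gamma\subset\mathbb R^{n+1}$ without boundary, any polyhedral surface $\overline\Gamma\subset\mathbb R^{n+1}$ (the union of a finite conforming collection $\overline{\mathcal T}$ of closed $n$-simplices) and any globally bi-Lipschitz bijection $\mathbf P:\overline\Gamma\to\gamma$ that fixes the vertices of $\overline\Gamma$. For $\overline T\in\overline{\mathcal T}$ let $h_T=|\overline T|^{1/n}$, let $\overline\omega_T$ be the union of all elements meeting $\overline T$, and put $\widetilde T=\mathbf P(\overline T)$, $\widetilde\omega_T=\mathbf P(\overline\omega_T)$. To every $\overline T$ belong a reference patch $\widehat\omega_T$ from the fixed collection and a continuous piecewise affine (affine on each simplex of $\widehat\omega_T$) bijection $\overline{\mathbf X}_T:\widehat\omega_T\to\overline\omega_T$ with $\overline{\mathbf X}_T(\widehat T)=\overline T$. Let $\chi_T=\mathbf P\circ\overline{\mathbf X}_T$,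 let $\mathbf X_T=I_k\chi_T$ be its Lagrange interpolant of degree $k$ on $\widehat T$, and let $$\Gamma=\bigcup_{\overline T}\mathbf X_T(\widehat T),\qquad \beta_T=\max_{\hat x\in\widehat T}|\chi_T(\hat x)-\mathbf X_T(\hat x)|.$$ Let $\mathbf P_d$ be the closest point projection onto $\gamma$, and on $\widetilde T$ let $\mathbf P^{-1}:=\mathbf X_T\circ(\chi_T|_{\widehat T})^{-1}$, so that $\mathbf P_d\circ\mathbf P^{-1}$ maps $\chi_T(\hat x)$ to $\mathbf P_d(\mathbf X_T(\hat x))$ for $\hat x\in\widehat T$. Let $\|K\|_{L_\infty(\gamma)}$ be the maximum over $\gamma$ of the absolute values of the principal curvatures, and let $q,q_\Gamma,q_d$ be the area elements $\sqrt{\det(DF^{\top}DF)}$ of $F=\chi_T,\ \mathbf X_T,\ \mathbf P_d\circ\mathbf X_T$ on $\widehat T$. **Assumptions.** For all $\overline T\in\overline{\mathcal T}$: 1. $\bar c^{-1}\,\mathrm{diam}(\overline T)|v|\le|D\overline{\mathbf X}_T v|\le\bar c\,\mathrm{diam}(\overline T)|v|$ on the interior of $\widehat T$ and $c^{-1}\,\mathrm{diam}(\overline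 T)|v|\le|D\mathbf X_T v|\le c\,\mathrm{diam}(\overline T)|v|$ on $\widehat T$, for all $v\in\mathbb R^n$; 2. $L^{-1}h_T|\hat x-\hat y|\le|\chi_T(\hat x)-\chi_T(\hat y)|\le L\,h_T|\hat x-\hat y|$ for all $\hat x,\hat y\in\widehat\omega_T$; 3. every $x\in\Gamma$ has a unique closest point $\mathbf P_d(x)$ on $\gamma$, and $\mathrm{dist}(x,\gamma)\le\frac12\|K\|_{L_\infty(\gamma)}^{-1}$; 4. $\mathbf P_d\circ\mathbf P^{-1}(\widetilde T)\subset\widetilde\omega_T$; 5. $C_1\le q/q_\Gamma\le C_2$ and $C_1\le q_d/q_\Gamma\le C_2$ almost everywhere on $\widehat T$. **Lemma (Geometric Error in Function Evaluation).** There is a constant $D>0$ depending only on $n$, $k$, $\bar c$, $c$, $L$, $C_1$, $C_2$ and the finite collection of reference patches such that, in every such situation, for every $w\in H^1(\gamma)$ and every $\overline T\in\overline{\mathcal T}$, the function $w-w\circ\mathbf P_d\circ\mathbf P^{-1}$ is in $L_2(\widetilde T)$ and $$\|w-w\circ\mathbf P_d\circ\mathbf P^{-1}\|_{L_2(\widetilde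 T)}\le D\,\beta_T\,\|w\|_{H^1(\widetilde\omega_T)},\qquad \|w\|_{H^1(\widetilde\omega_T)}^2=\|w\|_{L_2(\widetilde\omega_T)}^2+\|\nabla_\gamma w\|_{L_2(\widetilde\omega_T)}^2 .$$ -/

import Mathlib

open MeasureTheory Set Filter Topology
open scoped ENNReal ContDiff

noncomputable section

namespace SurfaceFEM

/-- Euclidean space of dimension `n`. -/
abbrev Euc (n : ℕ) : Type := EuclideanSpace ℝ (Fin n)

/-! ### Closed `C²` hypersurfaces, curvature, closest points -/

/-- `φ` is a regular `C²` level set function for `γ` near `y`: it is `C²` near `y`, its gradient at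
`y` does not vanish, and near `y` the set `γ` is the zero level set of `φ`. -/
structure IsLocalDefiningFunction {n : ℕ} (γ : Set (Euc (n + 1))) (y : Euc (n + 1))
    (φ : Euc (n + 1) → ℝ) : Prop where
  contDiffAt : ContDiffAt ℝ 2 φ y
  gradient_ne_zero : gradient φ y ≠ 0
  mem_iff : ∀ᶠ x in 𝓝 y, x ∈ γ ↔ φ x = 0

/-- Embedded `C²` hypersurface without boundary in `ℝⁿ⁺¹`. -/
def IsC2Hypersurface {n : ℕ} (γ : Set (Euc (n + 1))) : Prop :=
  ∀ y ∈ γ, ∃ φ : Euc (n + 1) → ℝ, IsLocalDefiningFunction γ y φ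

/-- `κ` is a principal curvature of `γ` at `y` (for one of the two choices of the unit normal):
an eigenvalue, with a tangent eigenvector, of the Weingarten map, the derivative of the unit normal
field `∇φ / |∇φ|`. -/
def IsPrincipalCurvature {n : ℕ} (γ : Set (Euc (n + 1))) (y : Euc (n + 1)) (κ : ℝ) : Prop :=
  ∃ φ : Euc (n + 1) → ℝ, IsLocalDefiningFunction γ y φ ∧
    ∃ v : Euc (n + 1), v ≠ 0 ∧ inner ℝ (gradient φ y) v = 0 ∧
      fderiv ℝ (fun x => ‖gradient φ x‖⁻¹ • gradient φ x) y v = κ • v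

/-- `‖K‖_{L_∞(γ)}`, where `K(y)` is the largest absolute value of a principal curvature at `y`. -/
def maxCurvature {n : ℕ} (γ : Set (Euc (n + 1))) : ℝ≥0∞ :=
  ⨆ y ∈ γ, ⨆ κ : ℝ, ⨆ _ : IsPrincipalCurvature γ y κ, ‖κ‖ₑ

/-- `y` is a closest point of `γ` to `x`. -/
def IsClosestPoint {n : ℕ} (γ : Set (Euc (n + 1))) (x y : Euc (n + 1)) : Prop :=
  y ∈ γ ∧ ∀ z ∈ γ, dist x y ≤ dist x z

/-- The closest point projection `P_d` onto `γ` (meaningful where the closest point is unique). -/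
def closestPoint {n : ℕ} (γ : Set (Euc (n + 1))) (x : Euc (n + 1)) : Euc (n + 1) :=
  Classical.epsilon (IsClosestPoint γ x)

/-! ### Surface measure and Sobolev functions on a hypersurface -/

/-- The `n`-dimensional area measure on `γ`: the `n`-dimensional Hausdorff measure, normalized so
that it agrees with Lebesgue measure on `ℝⁿ`. -/
def surfaceMeasure {n : ℕ} (γ : Set (Euc (n + 1))) : Measure (Euc (n + 1)) :=
  (Measure.euclideanHausdorffMeasure n).restrict γ

/-- `F : U → γ` is a local `C²` parametrization of `γ`, with `U ⊆ ℝⁿ` open. -/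
structure IsLocalParametrization {n : ℕ} (γ : Set (Euc (n + 1))) (U : Set (Euc n))
    (F : Euc n → Euc (n + 1)) : Prop where
  isOpen : IsOpen U
  contDiffOn : ContDiffOn ℝ 2 F U
  immersion : ∀ x ∈ U, Function.Injective (fderiv ℝ F x)
  injOn : InjOn F U
  mapsTo : MapsTo F U γ

/-- `G` is the weak tangential gradient `∇_γ w` of `w : γ → ℝ`: it is tangential, and in every local
parametrization `F` the weak partial derivatives of `w ∘ F` are `(G ∘ F) · ∂_j F`. -/
structure IsWeakTangentialGradient {n : ℕ} (γ : Set (Euc (n + 1))) (w : Euc (n + 1) → ℝ)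
    (G : Euc (n + 1) → Euc (n + 1)) : Prop where
  tangential : ∀ᵐ y ∂(surfaceMeasure γ), ∀ φ : Euc (n + 1) → ℝ,
    IsLocalDefiningFunction γ y φ → inner ℝ (gradient φ y) (G y) = 0
  weak_deriv : ∀ (U : Set (Euc n)) (F : Euc n → Euc (n + 1)), IsLocalParametrization γ U F →
    ∀ η : Euc n → ℝ, ContDiff ℝ ∞ η → HasCompactSupport η → tsupport η ⊆ U → ∀ j : Fin n,
      ∫ x in U, w (F x) * fderiv ℝ η x (EuclideanSpace.single j 1) =
        -∫ x in U, inner ℝ (G (F x)) (fderiv ℝ F x (EuclideanSpace.single j 1)) * η x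

/-- `w ∈ H¹(γ)`, with weak tangential gradient `G = ∇_γ w`. -/
structure MemH1 {n : ℕ} (γ : Set (Euc (n + 1))) (w : Euc (n + 1) → ℝ)
    (G : Euc (n + 1) → Euc (n + 1)) : Prop where
  memLp : MemLp w 2 (surfaceMeasure γ)
  memLp_gradient : MemLp G 2 (surfaceMeasure γ)
  weakGradient : IsWeakTangentialGradient γ w G

/-- The norm `‖w‖_{H¹(A)} = (‖w‖²_{L₂(A)} + ‖∇_γ w‖²_{L₂(A)})^{1/2}`, for `A ⊆ γ` and
`G = ∇_γ w`. -/
def h1Norm {n : ℕ} (γ A : Set (Euc (n + 1))) (w : Euc (n + 1) → ℝ)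
    (G : Euc (n + 1) → Euc (n + 1)) : ℝ≥0∞ :=
  (eLpNorm w 2 ((surfaceMeasure γ).restrict A) ^ 2 +
    eLpNorm G 2 ((surfaceMeasure γ).restrict A) ^ 2) ^ (1 / 2 : ℝ)

/-! ### The reference simplex, Lagrange interpolation, area elements -/

/-- The vertices `0, e₁, …, eₙ` of the unit reference simplex. -/
def refVertices (n : ℕ) : Finset (Euc n) :=
  open Classical in insert 0 (Finset.univ.image fun i : Fin n => EuclideanSpace.single i (1 : ℝ))

/-- The unit reference simplex in `ℝⁿ`. -/
def refSimplex (n : ℕ) : Set (Euc n) := convexHull ℝ (refVertices n : Set (Euc n))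

/-- Barycentric coordinates on the reference simplex. -/
def baryCoord {n : ℕ} (x : Euc n) : Fin (n + 1) → ℝ :=
  Fin.cons (1 - ∑ i, x i) fun i => x i

/-- The Lagrange node with barycentric coordinates `α / k`. -/
def lagrangeNode {n : ℕ} (k : ℕ) (α : Fin (n + 1) → ℕ) : Euc n :=
  WithLp.toLp 2 fun i => (α i.succ : ℝ) / k

/-- The Lagrange basis polynomial of degree `k` on the reference simplex that equals `1` at the
node `α / k` and vanishes at all other nodes. -/
def lagrangeBasis {n : ℕ} (k : ℕ) (α : Fin (n + 1) → ℕ) (x : Euc n) : ℝ :=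
  ∏ i, ∏ j ∈ Finset.range (α i), (k * baryCoord x i - j) / (j + 1)

/-- The Lagrange interpolant `I_k f` of degree `k ≥ 1` on the reference simplex. -/
def lagrangeInterp {n N : ℕ} (k : ℕ) (f : Euc n → Euc N) (x : Euc n) : Euc N :=
  ∑ α ∈ Finset.Nat.antidiagonalTuple (n + 1) k, lagrangeBasis k α x • f (lagrangeNode k α)

/-- The area element `√det(∂_i F · ∂_j F)` of a map `F : ℝⁿ → ℝᴺ`. -/
def areaElement {n N : ℕ} (F : Euc n → Euc N) (x : Euc n) : ℝ :=
  Real.sqrt (Matrix.det (Matrix.of fun i j : Fin n =>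
    inner ℝ (fderiv ℝ F x (EuclideanSpace.single i 1)) (fderiv ℝ F x (EuclideanSpace.single j 1))))

/-! ### Parametric surfaces -/

/-- A finite simplicial complex all of whose maximal simplices have dimension `n`. -/
structure IsFinitePure {N : ℕ} (n : ℕ) (K : Geometry.SimplicialComplex ℝ (Euc N)) : Prop where
  finite : K.faces.Finite
  card_facets : ∀ s ∈ K.facets, s.card = n + 1
  exists_facet : ∀ s ∈ K.faces, ∃ t ∈ K.facets, s ⊆ t

/-- A reference patch: a convex union of finitely many `n`-simplices of `ℝⁿ` (forming a conforming
triangulation), one of which is the unit reference simplex. -/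
structure RefPatch (n : ℕ) where
  complex : Geometry.SimplicialComplex ℝ (Euc n)
  finitePure : IsFinitePure n complex
  refVertices_mem : refVertices n ∈ complex.facets
  convex_space : Convex ℝ complex.space

/-- The macro patch of the element `T`: the union of all elements meeting `T`. -/
def macroPatch {n : ℕ} (K : Geometry.SimplicialComplex ℝ (Euc (n + 1))) (T : K.facets) :
    Set (Euc (n + 1)) :=
  ⋃ T' ∈ {T' ∈ K.facets | (convexHull ℝ (T' : Set (Euc (n + 1))) ∩
    convexHull ℝ (T.1 : Set (Euc (n + 1)))).Nonempty}, convexHull ℝ (T' : Set (Euc (n + 1)))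

/-- A closed `C²` hypersurface `γ` that is the bi-Lipschitz image under `P` of a polyhedral surface
(with simplicial elements `T`, the facets of `mesh`), interpolated by it at the vertices, together
with piecewise affine parametrizations `Xbar T` of the macro patches of the elements over reference
patches from the given finite collection. -/
structure ParametricSurface {n m : ℕ} (patch : Fin m → RefPatch n) where
  γ : Set (Euc (n + 1))
  isCompact : IsCompact γ
  isC2Hypersurface : IsC2Hypersurface γ
  mesh : Geometry.SimplicialComplex ℝ (Euc (n + 1))
  finitePure : IsFinitePure n mesh
  P : Euc (n + 1) → Euc (n + 1)
  bijOn_P : BijOn P mesh.space γ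
  biLipschitz_P : ∃ Lbar > 0, ∀ x ∈ mesh.space, ∀ y ∈ mesh.space,
    Lbar⁻¹ * ‖x - y‖ ≤ ‖P x - P y‖ ∧ ‖P x - P y‖ ≤ Lbar * ‖x - y‖
  P_vertex : ∀ v ∈ mesh.vertices, P v = v
  patchIndex : mesh.facets → Fin m
  Xbar : mesh.facets → Euc n → Euc (n + 1)
  continuousOn_Xbar : ∀ T, ContinuousOn (Xbar T) (patch (patchIndex T)).complex.space
  affine_Xbar : ∀ T, ∀ s ∈ (patch (patchIndex T)).complex.facets,
    ∃ A : Euc n →ᵃ[ℝ] Euc (n + 1), EqOn (Xbar T) A (convexHull ℝ (s : Set (Euc n)))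
  image_refSimplex : ∀ T, Xbar T '' refSimplex n = convexHull ℝ (T.1 : Set (Euc (n + 1)))
  bijOn_Xbar : ∀ T, BijOn (Xbar T) (patch (patchIndex T)).complex.space (macroPatch mesh T)

namespace ParametricSurface

variable {n m : ℕ} {patch : Fin m → RefPatch n} (S : ParametricSurface patch)

/-- The (closed) elements, i.e. the facets of the polyhedral surface. -/
abbrev Elem : Type := S.mesh.facets

/-- The flat element as a set. -/
def flatElem (T : S.Elem) : Set (Euc (n + 1)) := convexHull ℝ (T.1 : Set (Euc (n + 1)))

/-- The reference patch of `T`. -/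
def refPatch (T : S.Elem) : Set (Euc n) := (patch (S.patchIndex T)).complex.space

/-- `h_T = |T|^{1/n}`, with `|T|` the area of the flat element. -/
def h (T : S.Elem) : ℝ :=
  (Measure.euclideanHausdorffMeasure n (S.flatElem T)).toReal ^ (1 / n : ℝ)

/-- The local parametrization `χ_T = P ∘ Xbar_T` of `γ` over the reference patch. -/
def χ (T : S.Elem) : Euc n → Euc (n + 1) := S.P ∘ S.Xbar T

/-- The curved element `P(T) ⊆ γ`. -/
def curvedElem (T : S.Elem) : Set (Euc (n + 1)) := S.P '' S.flatElem T

/-- The curved macro patch of `T`, the image under `P` of the flat macro patch. -/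
def curvedPatch (T : S.Elem) : Set (Euc (n + 1)) := S.P '' macroPatch S.mesh T

/-- `X_T = I_k χ_T`. -/
def X (k : ℕ) (T : S.Elem) : Euc n → Euc (n + 1) := lagrangeInterp k (S.χ T)

/-- The piecewise polynomial approximation `Γ` of `γ`. -/
def Γ (k : ℕ) : Set (Euc (n + 1)) := ⋃ T : S.Elem, S.X k T '' refSimplex n

/-- `β_T = ‖P - I_k P‖_{L_∞(T)}`, computed on the reference simplex. -/
def β (k : ℕ) (T : S.Elem) : ℝ := sSup ((fun x => ‖S.χ T x - S.X k T x‖) '' refSimplex n)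

/-- The inverse lift from the curved element of `T` to `Γ`, i.e. the restriction to the curved
element of the inverse of `P ∘ (I_k P)⁻¹ : Γ → γ`; it maps `χ_T(x)` to `X_T(x)`. -/
def invLift (k : ℕ) (T : S.Elem) (y : Euc (n + 1)) : Euc (n + 1) :=
  S.X k T (Function.invFunOn (S.χ T) (refSimplex n) y)

/-- The map `P_d ∘ P⁻¹` on the curved element of `T`. -/
def ψ (k : ℕ) (T : S.Elem) (y : Euc (n + 1)) : Euc (n + 1) :=
  closestPoint S.γ (S.invLift k T y)

/-- The standing assumptions on the parametrization and on the resolution of `γ` by `Γ`. -/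
structure StandingAssumptions (k : ℕ) (cbar c L C₁ C₂ : ℝ) : Prop where
  /-- Shape regularity of the flat elements. -/
  shapeRegular_flat : ∀ T : S.Elem, ∀ x ∈ interior (refSimplex n), ∀ v : Euc n,
    cbar⁻¹ * Metric.diam (S.flatElem T) * ‖v‖ ≤ ‖fderiv ℝ (S.Xbar T) x v‖ ∧
      ‖fderiv ℝ (S.Xbar T) x v‖ ≤ cbar * Metric.diam (S.flatElem T) * ‖v‖
  /-- The parametrizations `χ_T` are bi-Lipschitz with element scaling. -/
  biLipschitz : ∀ T : S.Elem, ∀ x ∈ S.refPatch T, ∀ y ∈ S.refPatch T,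
    S.h T * L⁻¹ * ‖x - y‖ ≤ ‖S.χ T x - S.χ T y‖ ∧
      ‖S.χ T x - S.χ T y‖ ≤ L * S.h T * ‖x - y‖
  /-- Shape regularity of the elements of `Γ`. -/
  shapeRegular : ∀ T : S.Elem, ∀ x ∈ refSimplex n, ∀ v : Euc n,
    c⁻¹ * Metric.diam (S.flatElem T) * ‖v‖ ≤ ‖fderiv ℝ (S.X k T) x v‖ ∧
      ‖fderiv ℝ (S.X k T) x v‖ ≤ c * Metric.diam (S.flatElem T) * ‖v‖
  /-- `Γ ⊆ 𝒩_{1/2}`: the distance to `γ` is at most half of `‖K‖_{L_∞(γ)}⁻¹`. -/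
  near : ∀ x ∈ S.Γ k, Metric.infEDist x S.γ ≤ (1 / 2) * (maxCurvature S.γ)⁻¹
  /-- The closest point projection is well defined on `Γ`. -/
  unique_closest : ∀ x ∈ S.Γ k, ∃! y, IsClosestPoint S.γ x y
  /-- Restriction on the mismatch between the lift `P` and the closest point projection. -/
  mismatch : ∀ T : S.Elem, MapsTo (S.ψ k T) (S.curvedElem T) (S.curvedPatch T)
  /-- Nondegeneracy of the area elements `q`, `q_Γ`, `q_d` of `χ_T`, `X_T`, `P_d ∘ X_T`. -/
  nondegenerate : ∀ T : S.Elem, ∀ᵐ x ∂(volume.restrict (refSimplex n)),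
    areaElement (S.χ T) x / areaElement (S.X k T) x ∈ Icc C₁ C₂ ∧
      areaElement (closestPoint S.γ ∘ S.X k T) x / areaElement (S.X k T) x ∈ Icc C₁ C₂

end ParametricSurface

end SurfaceFEM

end

noncomputable section

namespace SurfaceFEM

/-! ### Gram determinants -/

section Gram

variable {n N : ℕ} (B : Euc n →L[ℝ] Euc N)

/-- The images of the coordinate vectors under a linear map. -/
def colVec (i : Fin n) : Euc N := B (EuclideanSpace.single i 1)

theorem sum_smul_colVec (v : Euc n) : ∑ i, v i • colVec B i = B v := by
  have h : v = ∑ i, v i • EuclideanSpace.single i (1 : ℝ) := by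
    ext j
    simp [Finset.sum_apply, Pi.single_apply]
  conv_rhs => rw [h]
  simp [colVec]

theorem dotProduct_gram_mulVec (v u : Euc n) :
    (v : Fin n → ℝ) ⬝ᵥ (Matrix.gram ℝ (colVec B)).mulVec u = inner ℝ (B v) (B u) := by
  have := Matrix.star_dotProduct_gram_mulVec (𝕜 := ℝ) (colVec B) v u
  rw [star_trivial] at this
  rw [this, sum_smul_colVec, sum_smul_colVec]

/-- The eigenvalues of the Gram matrix of a linear map. -/
def gramEig (i : Fin n) : ℝ :=
  (Matrix.isHermitian_gram (𝕜 := ℝ) (colVec B)).eigenvalues i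

/-- An orthonormal basis of eigenvectors of the Gram matrix of a linear map. -/
def gramBasis : OrthonormalBasis (Fin n) ℝ (Euc n) :=
  (Matrix.isHermitian_gram (𝕜 := ℝ) (colVec B)).eigenvectorBasis

theorem inner_apply_gramBasis (i : Fin n) (v : Euc n) :
    inner ℝ (B v) (B (gramBasis B i)) = gramEig B i * inner ℝ v (gramBasis B i) := by
  rw [← dotProduct_gram_mulVec]
  have := (Matrix.isHermitian_gram (𝕜 := ℝ) (colVec B)).mulVec_eigenvectorBasis i
  rw [gramBasis, this, dotProduct_smul, gramEig, EuclideanSpace.inner_eq_star_dotProduct]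
  simp [dotProduct_comm]

theorem norm_sq_apply_gramBasis (i : Fin n) : ‖B (gramBasis B i)‖ ^ 2 = gramEig B i := by
  rw [← real_inner_self_eq_norm_sq, inner_apply_gramBasis, real_inner_self_eq_norm_sq,
    (gramBasis B).norm_eq_one]
  simp

theorem norm_sq_apply_eq_sum (v : Euc n) :
    ‖B v‖ ^ 2 = ∑ i, gramEig B i * (inner ℝ v (gramBasis B i)) ^ 2 := by
  rw [← real_inner_self_eq_norm_sq]
  have h : B v = ∑ i, (inner ℝ (gramBasis B i) v : ℝ) • B (gramBasis B i) := by
    conv_lhs => rw [← (gramBasis B).sum_repr' v]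
    simp
  conv_lhs => arg 3; rw [h]
  rw [inner_sum]
  refine Finset.sum_congr rfl fun i _ => ?_
  rw [inner_smul_right, inner_apply_gramBasis, real_inner_comm v]
  ring

theorem det_gram_eq_prod : (Matrix.gram ℝ (colVec B)).det = ∏ i, gramEig B i := by
  have := (Matrix.isHermitian_gram (𝕜 := ℝ) (colVec B)).det_eq_prod_eigenvalues
  simpa [gramEig] using this

theorem pow_le_sqrt_det_gram {a : ℝ} (ha : 0 ≤ a) (h : ∀ v, a * ‖v‖ ≤ ‖B v‖) :
    a ^ n ≤ √(Matrix.gram ℝ (colVec B)).det := by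
  apply Real.le_sqrt_of_sq_le
  rw [det_gram_eq_prod, ← pow_mul, mul_comm, pow_mul]
  calc (a ^ 2) ^ n = ∏ _i : Fin n, a ^ 2 := by simp
    _ ≤ _ := by
      refine Finset.prod_le_prod (fun _ _ => by positivity) fun i _ => ?_
      rw [← norm_sq_apply_gramBasis]
      have := h (gramBasis B i)
      rw [(gramBasis B).norm_eq_one, mul_one] at this
      gcongr

theorem le_norm_apply_of_le_sqrt_det_gram {a M : ℝ} (ha : 0 ≤ a) (hM : 0 < M)
    (hB : ∀ v, ‖B v‖ ≤ M * ‖v‖) (hdet : a ≤ √(Matrix.gram ℝ (colVec B)).det) (v : Euc n) :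
    a / M ^ (n - 1) * ‖v‖ ≤ ‖B v‖ := by
  have heig : ∀ i, (a / M ^ (n - 1)) ^ 2 ≤ gramEig B i := by
    intro i
    have h0 : ∀ j, 0 ≤ gramEig B j := fun j => by rw [← norm_sq_apply_gramBasis]; positivity
    have h1 : a ^ 2 ≤ ∏ j, gramEig B j := by
      rw [← det_gram_eq_prod]
      refine (Real.le_sqrt ha ?_).1 hdet
      rw [det_gram_eq_prod]
      exact Finset.prod_nonneg fun j _ => h0 j
    rw [← Finset.mul_prod_erase _ _ (Finset.mem_univ i)] at h1
    have h2 : ∏ j ∈ Finset.univ.erase i, gramEig B j ≤ (M ^ (n - 1)) ^ 2 := by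
      calc ∏ j ∈ Finset.univ.erase i, gramEig B j ≤ ∏ j ∈ Finset.univ.erase i, M ^ 2 := by
            refine Finset.prod_le_prod (fun j _ => h0 j) fun j _ => ?_
            rw [← norm_sq_apply_gramBasis]
            have := hB (gramBasis B j)
            rw [(gramBasis B).norm_eq_one, mul_one] at this
            gcongr
        _ = _ := by
            rw [Finset.prod_const, Finset.card_erase_of_mem (Finset.mem_univ i),
              Finset.card_univ, Fintype.card_fin, ← pow_mul, ← pow_mul, mul_comm]
    rw [div_pow, div_le_iff₀ (by positivity)]
    exact h1.trans (mul_le_mul_of_nonneg_left h2 (h0 i))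
  have hsq : (a / M ^ (n - 1) * ‖v‖) ^ 2 ≤ ‖B v‖ ^ 2 := by
    rw [norm_sq_apply_eq_sum, mul_pow, ← (gramBasis B).sum_sq_norm_inner_left v, Finset.mul_sum]
    refine Finset.sum_le_sum fun i _ => ?_
    rw [Real.norm_eq_abs, sq_abs]
    exact mul_le_mul_of_nonneg_right (heig i) (by positivity)
  exact (pow_le_pow_iff_left₀ (by positivity) (by positivity) two_ne_zero).1 hsq

theorem areaElement_eq (F : Euc n → Euc N) (x : Euc n) :
    areaElement F x = √(Matrix.gram ℝ (colVec (fderiv ℝ F x))).det := rfl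

end Gram

/-! ### Lagrange interpolation -/

section Lagrange

theorem contDiff_lagrangeBasis {n : ℕ} (k : ℕ) (α : Fin (n + 1) → ℕ) :
    ContDiff ℝ ∞ (lagrangeBasis (n := n) k α) := by
  unfold lagrangeBasis
  refine contDiff_prod fun i _ => contDiff_prod fun j _ => ?_
  have : ContDiff ℝ ∞ fun x : Euc n => baryCoord x i := by
    unfold baryCoord
    refine Fin.cases ?_ (fun i => ?_) i
    · simp only [Fin.cons_zero]
      fun_prop
    · simp only [Fin.cons_succ]
      fun_prop
  exact (((contDiff_const.mul this).sub contDiff_const).div_const _)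

/-- The polynomial binomial coefficient `x (x - 1) ⋯ (x - m + 1) / m!`. -/
def polyChoose (x : ℝ) (m : ℕ) : ℝ := ∏ j ∈ Finset.range m, (x - j) / (j + 1)

theorem polyChoose_eq (x : ℝ) (m : ℕ) : polyChoose x m = Ring.choose x m := by
  have h : ∀ m : ℕ, (descPochhammer ℤ m).smeval x = ∏ j ∈ Finset.range m, (x - j) := by
    intro m
    induction m with
    | zero => simp
    | succ m ih =>
      rw [descPochhammer_succ_right, Polynomial.smeval_mul, ih, Finset.prod_range_succ,
        Polynomial.smeval_sub, Polynomial.smeval_X, Polynomial.smeval_natCast]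
      simp
  have h' : ∏ j ∈ Finset.range m, ((j : ℝ) + 1) = (m.factorial : ℝ) := by
    rw [← Finset.prod_range_add_one_eq_factorial]
    push_cast
    rfl
  rw [Ring.choose_eq_smul, polyChoose, Finset.prod_div_distrib, h, h', smul_eq_mul]
  ring

theorem polyChoose_add (x y : ℝ) (k : ℕ) :
    polyChoose (x + y) k =
      ∑ p ∈ Finset.HasAntidiagonal.antidiagonal k, polyChoose x p.1 * polyChoose y p.2 := by
  simp only [polyChoose_eq]
  exact Ring.add_choose_eq k (Commute.all x y)

theorem sum_antidiagonalTuple_succ {M : Type*} [AddCommMonoid M] (r k : ℕ)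
    (f : (Fin (r + 1) → ℕ) → M) :
    ∑ α ∈ Finset.Nat.antidiagonalTuple (r + 1) k, f α =
      ∑ p ∈ Finset.HasAntidiagonal.antidiagonal k, ∑ β ∈ Finset.Nat.antidiagonalTuple r p.2, f (Fin.cons p.1 β) := by
  rw [Finset.sum_sigma']
  refine Finset.sum_nbij' (fun α => ⟨(α 0, ∑ i, α (Fin.succ i)), fun i => α i.succ⟩)
    (fun q => Fin.cons q.1.1 q.2) ?_ ?_ ?_ ?_ ?_
  · intro α hα
    rw [Finset.Nat.mem_antidiagonalTuple, Fin.sum_univ_succ] at hα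
    simp [Finset.Nat.mem_antidiagonalTuple, hα]
  · rintro ⟨⟨a, b⟩, β⟩ hq
    simp only [Finset.mem_sigma, Finset.HasAntidiagonal.mem_antidiagonal, Finset.Nat.mem_antidiagonalTuple] at hq
    simp [Finset.Nat.mem_antidiagonalTuple, Fin.sum_univ_succ, hq.2, hq.1]
  · intro α _
    exact Fin.cons_self_tail α
  · rintro ⟨⟨a, b⟩, β⟩ hq
    simp only [Finset.mem_sigma, Finset.HasAntidiagonal.mem_antidiagonal, Finset.Nat.mem_antidiagonalTuple] at hq
    simp [hq.2]
  · intro α _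
    exact congrArg f (Fin.cons_self_tail α).symm

theorem sum_prod_polyChoose (r k : ℕ) (x : Fin r → ℝ) :
    ∑ α ∈ Finset.Nat.antidiagonalTuple r k, ∏ i, polyChoose (x i) (α i) =
      polyChoose (∑ i, x i) k := by
  induction r generalizing k with
  | zero =>
    cases k with
    | zero => simp [polyChoose]
    | succ k => simp [polyChoose, Finset.prod_range_succ']
  | succ r ih =>
    rw [sum_antidiagonalTuple_succ, Fin.sum_univ_succ, polyChoose_add]
    refine Finset.sum_congr rfl fun p _ => ?_
    simp only [Fin.prod_univ_succ, Fin.cons_zero, Fin.cons_succ]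
    rw [← Finset.mul_sum, ih]

theorem sum_baryCoord {n : ℕ} (x : Euc n) : ∑ i, baryCoord x i = 1 := by
  simp [baryCoord, Fin.sum_univ_succ]

theorem sum_lagrangeBasis {n : ℕ} (k : ℕ) (x : Euc n) :
    ∑ α ∈ Finset.Nat.antidiagonalTuple (n + 1) k, lagrangeBasis k α x = 1 := by
  have := sum_prod_polyChoose (n + 1) k fun i => k * baryCoord x i
  rw [← Finset.mul_sum, sum_baryCoord, mul_one] at this
  refine this.trans ?_
  rw [polyChoose_eq, Ring.choose_natCast, Nat.choose_self, Nat.cast_one]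

/-! ### The reference simplex -/

theorem convex_refSimplex (n : ℕ) : Convex ℝ (refSimplex n) := convex_convexHull _ _

theorem isCompact_refSimplex (n : ℕ) : IsCompact (refSimplex n) :=
  (refVertices n).finite_toSet.isCompact_convexHull (𝕜 := ℝ)

theorem zero_mem_refSimplex (n : ℕ) : (0 : Euc n) ∈ refSimplex n :=
  subset_convexHull _ _ (by simp [refVertices])

theorem single_mem_refSimplex {n : ℕ} (i : Fin n) :
    EuclideanSpace.single i (1 : ℝ) ∈ refSimplex n :=
  subset_convexHull _ _ (by simp [refVertices])

theorem mem_refSimplex_of_nonneg {n : ℕ} {x : Euc n} (h0 : ∀ i, 0 ≤ x i) (h1 : ∑ i, x i ≤ 1) :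
    x ∈ refSimplex n := by
  have hx : x = ∑ i : Fin (n + 1), baryCoord x i •
      (Fin.cons 0 (fun j => EuclideanSpace.single j 1) : Fin (n + 1) → Euc n) i := by
    ext j
    simp [baryCoord, Fin.sum_univ_succ, Finset.sum_apply, Pi.single_apply]
  rw [hx]
  refine (convex_refSimplex n).sum_mem (fun i _ => ?_) (sum_baryCoord x) (fun i _ => ?_)
  · refine Fin.cases ?_ (fun i => ?_) i
    · simpa [baryCoord] using h1
    · simpa [baryCoord] using h0 i
  · refine Fin.cases ?_ (fun i => ?_) i
    · exact zero_mem_refSimplex n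
    · exact single_mem_refSimplex i

theorem lagrangeNode_mem_refSimplex {n k : ℕ} (hk : 1 ≤ k) {α : Fin (n + 1) → ℕ}
    (hα : α ∈ Finset.Nat.antidiagonalTuple (n + 1) k) : lagrangeNode k α ∈ refSimplex n := by
  have hk' : (0 : ℝ) < k := by exact_mod_cast hk
  refine mem_refSimplex_of_nonneg (fun i => ?_) ?_
  · simp only [lagrangeNode]
    positivity
  · simp only [lagrangeNode]
    rw [← Finset.sum_div, div_le_one hk']
    rw [Finset.Nat.mem_antidiagonalTuple, Fin.sum_univ_succ] at hα
    have : ∑ i, α (Fin.succ i) ≤ k := by omega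
    exact_mod_cast this

theorem nonempty_interior_refSimplex (n : ℕ) : (interior (refSimplex n)).Nonempty := by
  let U : Set (Euc n) := {x | (∀ i, 0 < x i) ∧ ∑ i, x i < 1}
  have hU : IsOpen U := by
    have h1 : IsOpen {x : Euc n | ∀ i, 0 < x i} := by
      simp only [ofPred_forall]
      exact isOpen_iInter_of_finite fun i => isOpen_lt continuous_const
        (show Continuous fun x : Euc n => x i by fun_prop)
    exact h1.inter (isOpen_lt (show Continuous fun x : Euc n => ∑ i, x i by fun_prop)
      continuous_const)
  have hsub : U ⊆ refSimplex n := fun x hx => mem_refSimplex_of_nonneg (fun i => (hx.1 i).le) hx.2.le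
  refine ⟨WithLp.toLp 2 fun _ => 1 / ((n : ℝ) + 1), interior_maximal hsub hU ⟨fun i => ?_, ?_⟩⟩
  · simp only
    positivity
  · simp only [Finset.sum_const, Finset.card_univ, Fintype.card_fin, nsmul_eq_mul]
    rw [mul_one_div, div_lt_one (by positivity)]
    linarith

/-! ### Second order remainders -/

theorem exists_remainder_bound {E : Type*} [NormedAddCommGroup E] [NormedSpace ℝ E] {s : Set E}
    (hs : Convex ℝ s) (hc : IsCompact s) {f : E → ℝ} (hf : ContDiff ℝ 2 f) :
    ∃ C : ℝ, 0 ≤ C ∧ ∀ x ∈ s, ∀ y ∈ s, ‖f y - f x - fderiv ℝ f x (y - x)‖ ≤ C * ‖y - x‖ ^ 2 := by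
  have hf1 : ContDiff ℝ 1 (fderiv ℝ f) := hf.fderiv_right (by norm_num)
  have hf2 : Continuous (fderiv ℝ (fderiv ℝ f)) := hf1.continuous_fderiv (by norm_num)
  obtain ⟨C, hC⟩ := hc.exists_bound_of_continuousOn (f := fderiv ℝ (fderiv ℝ f)) hf2.continuousOn
  refine ⟨max C 0, le_max_right _ _, fun x hx y hy => ?_⟩
  have hlip : ∀ z ∈ segment ℝ x y, ‖fderiv ℝ f z - fderiv ℝ f x‖ ≤ max C 0 * ‖y - x‖ := by
    intro z hz
    have hzs : z ∈ s := hs.segment_subset hx hy hz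
    refine (Convex.norm_image_sub_le_of_norm_fderiv_le (𝕜 := ℝ) (C := max C 0)
      (fun w _ => (hf1.differentiable (by norm_num)) w)
      (fun w hw => (hC w hw).trans (le_max_left _ _)) hs hx hzs).trans ?_
    gcongr
    exact norm_sub_le_of_mem_segment hz
  have := Convex.norm_image_sub_le_of_norm_fderiv_le' (𝕜 := ℝ) (φ := fderiv ℝ f x)
    (fun w _ => (hf.differentiable (by norm_num)) w) hlip (convex_segment x y)
    (left_mem_segment ℝ x y) (right_mem_segment ℝ x y)
  rwa [mul_assoc, ← pow_two] at this

theorem hasFDerivAt_lagrangeInterp {n N k : ℕ} (f : Euc n → Euc N) (x : Euc n) :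
    HasFDerivAt (lagrangeInterp k f) (∑ α ∈ Finset.Nat.antidiagonalTuple (n + 1) k,
      (fderiv ℝ (lagrangeBasis k α) x).smulRight (f (lagrangeNode k α))) x := by
  unfold lagrangeInterp
  refine HasFDerivAt.fun_sum fun α _ => ?_
  exact (((contDiff_lagrangeBasis k α).differentiable (by simp)) x).hasFDerivAt.smul_const _

theorem continuous_lagrangeInterp {n N k : ℕ} (f : Euc n → Euc N) :
    Continuous (lagrangeInterp k f) :=
  continuous_iff_continuousAt.2 fun x => (hasFDerivAt_lagrangeInterp f x).continuousAt

theorem exists_lagrangeInterp_remainder (n k : ℕ) (hk : 1 ≤ k) :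
    ∃ C : ℝ, 0 ≤ C ∧ ∀ (N : ℕ) (f : Euc n → Euc N) (A : ℝ),
      (∀ x ∈ refSimplex n, ∀ y ∈ refSimplex n, ‖f x - f y‖ ≤ A) →
      ∀ x ∈ refSimplex n, ∀ y ∈ refSimplex n,
        ‖lagrangeInterp k f y - lagrangeInterp k f x - fderiv ℝ (lagrangeInterp k f) x (y - x)‖ ≤
          C * A * ‖y - x‖ ^ 2 := by
  choose K hK0 hK using fun α : Fin (n + 1) → ℕ => exists_remainder_bound (convex_refSimplex n)
    (isCompact_refSimplex n) ((contDiff_lagrangeBasis k α).of_le (by norm_cast))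
  refine ⟨∑ α ∈ Finset.Nat.antidiagonalTuple (n + 1) k, K α, Finset.sum_nonneg fun α _ => hK0 α,
    fun N f A hA x hx y hy => ?_⟩
  set I := Finset.Nat.antidiagonalTuple (n + 1) k
  have hsum1 : ∀ z : Euc n, ∑ α ∈ I, lagrangeBasis k α z = 1 := sum_lagrangeBasis k
  have hsum0 : ∑ α ∈ I, fderiv ℝ (lagrangeBasis k α) x (y - x) = 0 := by
    have h1 : HasFDerivAt (fun z : Euc n => ∑ α ∈ I, lagrangeBasis k α z)
        (∑ α ∈ I, fderiv ℝ (lagrangeBasis k α) x) x :=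
      HasFDerivAt.fun_sum fun α _ =>
        (((contDiff_lagrangeBasis k α).differentiable (by simp)) x).hasFDerivAt
    have h2 := h1.unique (by simp only [hsum1]; exact hasFDerivAt_const 1 x)
    simpa using congrArg (fun B : Euc n →L[ℝ] ℝ => B (y - x)) h2
  have key : lagrangeInterp k f y - lagrangeInterp k f x -
      fderiv ℝ (lagrangeInterp k f) x (y - x) =
      ∑ α ∈ I, (lagrangeBasis k α y - lagrangeBasis k α x -
        fderiv ℝ (lagrangeBasis k α) x (y - x)) • (f (lagrangeNode k α) - f 0) := by
    rw [(hasFDerivAt_lagrangeInterp f x).fderiv]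
    simp only [lagrangeInterp, sum_apply,
      ContinuousLinearMap.smulRight_apply, smul_sub, sub_smul, Finset.sum_sub_distrib]
    simp only [← Finset.sum_smul]
    rw [hsum1, hsum1, hsum0]
    simp
    rfl
  rw [key, Finset.sum_mul, Finset.sum_mul]
  refine (norm_sum_le _ _).trans (Finset.sum_le_sum fun α hα => ?_)
  rw [norm_smul]
  calc _ ≤ (K α * ‖y - x‖ ^ 2) * A := by
        refine mul_le_mul (hK α x hx y hy)
          (hA _ (lagrangeNode_mem_refSimplex hk hα) _ (zero_mem_refSimplex n)) (norm_nonneg _) ?_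
        have := hK0 α
        positivity
    _ = _ := by ring

end Lagrange

/-! ### Closest points -/

section ClosestPoint

variable {n : ℕ} {γ : Set (Euc (n + 1))}

theorem isClosestPoint_closestPoint {x : Euc (n + 1)} (h : ∃! y, IsClosestPoint γ x y) :
    IsClosestPoint γ x (closestPoint γ x) :=
  Classical.epsilon_spec h.exists

theorem continuousOn_closestPoint (hγ : IsCompact γ) {s : Set (Euc (n + 1))}
    (hs : ∀ x ∈ s, ∃! y, IsClosestPoint γ x y) : ContinuousOn (closestPoint γ) s := by
  intro x₀ hx₀
  refine hγ.tendsto_nhds_of_unique_mapClusterPt ?_ fun y hy hcl => ?_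
  · filter_upwards [self_mem_nhdsWithin] with x hx
    exact (isClosestPoint_closestPoint (hs x hx)).1
  · refine (hs x₀ hx₀).unique ⟨hy, fun z hz => ?_⟩ (isClosestPoint_closestPoint (hs x₀ hx₀))
    refine le_of_forall_pos_le_add fun ε hε => ?_
    have h1 : ∃ᶠ x in 𝓝[s] x₀, dist (closestPoint γ x) y < ε / 3 :=
      (mapClusterPt_iff_frequently.1 hcl) _ (Metric.ball_mem_nhds y (by positivity))
    have h2 : ∀ᶠ x in 𝓝[s] x₀, x ∈ s ∧ dist x x₀ < ε / 3 :=
      (eventually_mem_nhdsWithin).and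
        (nhdsWithin_le_nhds (Metric.ball_mem_nhds x₀ (by positivity)))
    obtain ⟨x, hx1, hxs, hx2⟩ := (h1.and_eventually h2).exists
    have h3 := (isClosestPoint_closestPoint (hs x hxs)).2 z hz
    have h4 := dist_triangle4 x₀ x (closestPoint γ x) y
    have h5 := dist_triangle x x₀ z
    rw [dist_comm x₀ x] at h4
    linarith

theorem IsClosestPoint.edist_eq_infEDist {x y : Euc (n + 1)} (h : IsClosestPoint γ x y) :
    edist x y = Metric.infEDist x γ := by
  refine le_antisymm (Metric.le_infEDist.2 fun z hz => ?_) (Metric.infEDist_le_edist_of_mem h.1)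
  rw [edist_dist, edist_dist]
  exact ENNReal.ofReal_le_ofReal (h.2 z hz)

variable {φ : Euc (n + 1) → ℝ} {p : Euc (n + 1)}

theorem inner_gradient (φ : Euc (n + 1) → ℝ) (p v : Euc (n + 1)) :
    inner ℝ (gradient φ p) v = fderiv ℝ φ p v := by
  simp [gradient]

theorem IsLocalDefiningFunction.contDiffAt_gradient (h : IsLocalDefiningFunction γ p φ) :
    ContDiffAt ℝ 1 (gradient φ) p := by
  have h1 : ContDiffAt ℝ 1 (fderiv ℝ φ) p := h.contDiffAt.fderiv_right (by norm_num)
  exact ((InnerProductSpace.toDual ℝ (Euc (n + 1))).symm.toContinuousLinearEquiv.contDiff.contDiffAt).comp p h1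

theorem IsLocalDefiningFunction.eventually (h : IsLocalDefiningFunction γ p φ) :
    ∀ᶠ y in 𝓝 p, IsLocalDefiningFunction γ y φ := by
  filter_upwards [h.contDiffAt.eventually (by simp), eventually_eventually_nhds.2 h.mem_iff,
    h.contDiffAt_gradient.continuousAt.eventually_ne h.gradient_ne_zero] with y h1 h2 h3
  exact ⟨h1, h3, h2⟩

theorem IsClosestPoint.exists_sub_eq_smul_gradient {x y : Euc (n + 1)} (hy : IsClosestPoint γ x y)
    (h : IsLocalDefiningFunction γ y φ) : ∃ s : ℝ, x - y = s • gradient φ y := by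
  have hφ : HasStrictFDerivAt φ (fderiv ℝ φ y) y := h.contDiffAt.hasStrictFDerivAt (by norm_num)
  have hd : HasStrictFDerivAt (fun z => ‖z - x‖ ^ 2)
      (2 • (innerSL ℝ (y - x)).comp (ContinuousLinearMap.id ℝ (Euc (n + 1)))) y := by
    have := (hasStrictFDerivAt_norm_sq (y - x)).comp y ((hasStrictFDerivAt_id y).sub_const x)
    exact this
  have hy0 : φ y = 0 := h.mem_iff.self_of_nhds.1 hy.1
  have hext : IsLocalExtrOn (fun z => ‖z - x‖ ^ 2) {z | φ z = φ y} y := by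
    left
    have := h.mem_iff
    filter_upwards [nhdsWithin_le_nhds this, self_mem_nhdsWithin] with z hz hz2
    have h1 := hy.2 z (hz.2 (by rw [← hy0]; exact hz2))
    rw [dist_comm, dist_comm x, dist_eq_norm, dist_eq_norm] at h1
    gcongr
  obtain ⟨a, b, hab, hsum⟩ := hext.exists_multipliers_of_hasStrictFDerivAt_1d hφ hd
  have hv : ∀ v, a * inner ℝ (gradient φ y) v + b * (2 * inner ℝ (y - x) v) = 0 := by
    intro v
    have := congrArg (fun B : Euc (n + 1) →L[ℝ] ℝ => B v) hsum
    simpa [inner_gradient, inner_sub_left] using this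
  have hvec : a • gradient φ y + (2 * b) • (y - x) = 0 := by
    refine ext_inner_right ℝ fun v => ?_
    rw [inner_add_left, inner_smul_left, inner_smul_left, inner_zero_left]
    have := hv v
    simp only [conj_trivial]
    linarith
  have hb : b ≠ 0 := by
    rintro rfl
    simp only [mul_zero, zero_smul, add_zero, smul_eq_zero, h.gradient_ne_zero, or_false] at hvec
    exact hab (by rw [hvec]; rfl)
  refine ⟨a / (2 * b), ?_⟩
  have h2b : (2 * b) ≠ 0 := by positivity
  have : (2 * b) • (x - y) = a • gradient φ y := by
    rw [← neg_sub y x, smul_neg, neg_eq_iff_add_eq_zero,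
      add_comm ((2 * b) • (y - x)), hvec]
  rw [div_eq_inv_mul, mul_smul, ← this, smul_smul, inv_mul_cancel₀ h2b, one_smul]

/-- The unit normal field defined by a level set function. -/
def unitNormal (φ : Euc (n + 1) → ℝ) (x : Euc (n + 1)) : Euc (n + 1) :=
  ‖gradient φ x‖⁻¹ • gradient φ x

theorem IsLocalDefiningFunction.differentiableAt_unitNormal (h : IsLocalDefiningFunction γ p φ) :
    DifferentiableAt ℝ (unitNormal φ) p := by
  have h1 := h.contDiffAt_gradient.differentiableAt (by norm_num)
  exact ((h1.norm ℝ h.gradient_ne_zero).inv (norm_ne_zero_iff.2 h.gradient_ne_zero)).smul h1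

theorem IsLocalDefiningFunction.norm_unitNormal (h : IsLocalDefiningFunction γ p φ) :
    ‖unitNormal φ p‖ = 1 := by
  rw [unitNormal, norm_smul, norm_inv, norm_norm,
    inv_mul_cancel₀ (norm_ne_zero_iff.2 h.gradient_ne_zero)]

theorem IsLocalDefiningFunction.inner_unitNormal_fderiv (h : IsLocalDefiningFunction γ p φ)
    (v : Euc (n + 1)) : inner ℝ (unitNormal φ p) (fderiv ℝ (unitNormal φ) p v) = 0 := by
  have h1 := h.differentiableAt_unitNormal.hasFDerivAt.norm_sq
  have h2 : (fun x => ‖unitNormal φ x‖ ^ 2) =ᶠ[𝓝 p] fun _ => (1 : ℝ) := by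
    filter_upwards [h.eventually] with y hy
    rw [hy.norm_unitNormal, one_pow]
  have h3 := (h1.congr_of_eventuallyEq h2.symm).unique (hasFDerivAt_const (1 : ℝ) p)
  have := congrArg (fun B : Euc (n + 1) →L[ℝ] ℝ => B v) h3
  simpa using this

theorem IsLocalDefiningFunction.inner_fderiv_unitNormal (h : IsLocalDefiningFunction γ p φ)
    (v : Euc (n + 1)) {t : Euc (n + 1)} (ht : inner ℝ (gradient φ p) t = 0) :
    inner ℝ (fderiv ℝ (unitNormal φ) p v) t =
      ‖gradient φ p‖⁻¹ * fderiv ℝ (fderiv ℝ φ) p v t := by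
  have h1 := (h.contDiffAt_gradient.differentiableAt (by norm_num))
  have h2 : DifferentiableAt ℝ (fun x => ‖gradient φ x‖⁻¹) p :=
    (h1.norm ℝ h.gradient_ne_zero).inv (norm_ne_zero_iff.2 h.gradient_ne_zero)
  have h3 : fderiv ℝ (unitNormal φ) p v = ‖gradient φ p‖⁻¹ • fderiv ℝ (gradient φ) p v +
      (fderiv ℝ (fun x => ‖gradient φ x‖⁻¹) p v) • gradient φ p := by
    rw [show unitNormal φ = fun x => ‖gradient φ x‖⁻¹ • gradient φ x from rfl, fderiv_fun_smul h2 h1]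
    simp
  have h4 : inner ℝ (fderiv ℝ (gradient φ) p v) t = fderiv ℝ (fderiv ℝ φ) p v t := by
    have hd : DifferentiableAt ℝ (fderiv ℝ φ) p :=
      (h.contDiffAt.fderiv_right (m := 1) (by norm_num)).differentiableAt (by norm_num)
    have h5 : HasFDerivAt (gradient φ) _ p :=
      ((InnerProductSpace.toDual ℝ (Euc (n + 1))).symm.toContinuousLinearEquiv.hasFDerivAt).comp p
        hd.hasFDerivAt
    rw [h5.fderiv]
    simp
  rw [h3, inner_add_left, inner_smul_left, inner_smul_left, ht, h4]
  simp

theorem IsLocalDefiningFunction.inner_fderiv_unitNormal_comm (h : IsLocalDefiningFunction γ p φ)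
    {v t : Euc (n + 1)} (hv : inner ℝ (gradient φ p) v = 0) (ht : inner ℝ (gradient φ p) t = 0) :
    inner ℝ (fderiv ℝ (unitNormal φ) p v) t = inner ℝ v (fderiv ℝ (unitNormal φ) p t) := by
  rw [h.inner_fderiv_unitNormal v ht, real_inner_comm, h.inner_fderiv_unitNormal t hv]
  congr 1
  exact (h.contDiffAt.isSymmSndFDerivAt (by simp)) v t

theorem IsLocalDefiningFunction.abs_mul_inner_fderiv_unitNormal_le
    (h : IsLocalDefiningFunction γ p φ) (hp : p ∈ γ) {s : ℝ}
    (hs : ENNReal.ofReal |s| ≤ (1 / 2) * (maxCurvature γ)⁻¹)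
    {τ : Euc (n + 1)} (hτ : inner ℝ (gradient φ p) τ = 0) :
    |s * inner ℝ (fderiv ℝ (unitNormal φ) p τ) τ| ≤ 1 / 2 * ‖τ‖ ^ 2 := by
  let V : Submodule ℝ (Euc (n + 1)) := (ℝ ∙ gradient φ p)ᗮ
  have hV : ∀ v, v ∈ V ↔ inner ℝ (gradient φ p) v = 0 := fun v =>
    Submodule.mem_orthogonal_singleton_iff_inner_right
  have hmap : ∀ v ∈ V, fderiv ℝ (unitNormal φ) p v ∈ V := by
    intro v _
    have := h.inner_unitNormal_fderiv v
    rw [unitNormal, inner_smul_left] at this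
    rw [hV]
    simpa [h.gradient_ne_zero] using this
  let W : V →ₗ[ℝ] V := (fderiv ℝ (unitNormal φ) p : Euc (n + 1) →ₗ[ℝ] Euc (n + 1)).restrict hmap
  have hW : W.IsSymmetric := fun v t =>
    h.inner_fderiv_unitNormal_comm ((hV _).1 v.2) ((hV _).1 t.2)
  have hcurv : ∀ i, |s * hW.eigenvalues rfl i| ≤ 1 / 2 := by
    intro i
    set κ := hW.eigenvalues rfl i
    have hκ : IsPrincipalCurvature γ p κ := by
      refine ⟨φ, h, (hW.eigenvectorBasis rfl i : V), ?_, (hV _).1 (hW.eigenvectorBasis rfl i).2, ?_⟩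
      · rw [Ne, Submodule.coe_eq_zero]
        exact (hW.eigenvectorBasis rfl).orthonormal.ne_zero i
      · have := congrArg (Subtype.val) (hW.apply_eigenvectorBasis rfl i)
        rw [LinearMap.coe_restrict_apply] at this
        exact this
    have hle : ‖κ‖ₑ ≤ maxCurvature γ := by
      refine le_trans ?_ (le_iSup₂ (f := fun y (_ : y ∈ γ) =>
        ⨆ κ : ℝ, ⨆ _ : IsPrincipalCurvature γ y κ, ‖κ‖ₑ) p hp)
      exact le_iSup₂ (f := fun κ (_ : IsPrincipalCurvature γ p κ) => ‖κ‖ₑ) κ hκ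
    have h1 : ENNReal.ofReal |s| * ‖κ‖ₑ ≤ 1 / 2 := by
      calc ENNReal.ofReal |s| * ‖κ‖ₑ ≤ (1 / 2) * (maxCurvature γ)⁻¹ * maxCurvature γ := by gcongr
        _ = (1 / 2) * ((maxCurvature γ)⁻¹ * maxCurvature γ) := mul_assoc _ _ _
        _ ≤ (1 / 2) * 1 := by gcongr; exact ENNReal.inv_mul_le_one _
        _ = 1 / 2 := mul_one _
    rw [← ofReal_norm, ← ENNReal.ofReal_mul (abs_nonneg _), Real.norm_eq_abs, ← abs_mul]
      at h1
    have h2 : (1 / 2 : ℝ≥0∞) = ENNReal.ofReal (1 / 2) := by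
      rw [ENNReal.ofReal_div_of_pos (by norm_num)]
      simp
    rw [h2] at h1
    exact (ENNReal.ofReal_le_ofReal_iff (by norm_num)).1 h1
  let τ' : V := ⟨τ, (hV τ).2 hτ⟩
  let b := hW.eigenvectorBasis rfl
  have h1 : inner ℝ (fderiv ℝ (unitNormal φ) p τ) τ =
      ∑ i, hW.eigenvalues rfl i * (b.repr τ' i) ^ 2 := by
    change inner ℝ (W τ') τ' = _
    rw [← b.sum_inner_mul_inner]
    refine Finset.sum_congr rfl fun i _ => ?_
    have h2 := hW.eigenvectorBasis_apply_self_apply rfl τ' i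
    rw [real_inner_comm, ← b.repr_apply_apply, ← b.repr_apply_apply, h2]
    simp [b]
    ring
  have h2 : ‖τ‖ ^ 2 = ∑ i, (b.repr τ' i) ^ 2 := by
    change ‖τ'‖ ^ 2 = _
    rw [← b.repr.norm_map τ', EuclideanSpace.norm_sq_eq]
    simp
  rw [h1, h2, Finset.mul_sum, Finset.mul_sum]
  refine (Finset.abs_sum_le_sum_abs _ _).trans (Finset.sum_le_sum fun i _ => ?_)
  rw [← mul_assoc, abs_mul, abs_of_nonneg (sq_nonneg (b.repr τ' i))]
  exact mul_le_mul_of_nonneg_right (hcurv i) (sq_nonneg _)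

/-- Bound for the derivative of the closest point projection along a map. -/
theorem norm_fderiv_closest_le {m : ℕ} {F Y : Euc m → Euc (n + 1)} {x₀ : Euc m}
    (hF : DifferentiableAt ℝ F x₀) (hY : DifferentiableAt ℝ Y x₀)
    (hFY : ∀ᶠ x in 𝓝 x₀, IsClosestPoint γ (F x) (Y x))
    (hφ : IsLocalDefiningFunction γ (Y x₀) φ)
    (hnear : Metric.infEDist (F x₀) γ ≤ (1 / 2) * (maxCurvature γ)⁻¹) (v : Euc m) (a : ℝ) :
    ‖fderiv ℝ Y x₀ v‖ ≤ 2 * ‖fderiv ℝ F x₀ v - a • gradient φ (Y x₀)‖ := by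
  have hcl := hFY.self_of_nhds
  set τ := fderiv ℝ Y x₀ v with hτdef
  have hYc := hY.continuousAt
  have hloc : ∀ᶠ x in 𝓝 x₀, IsLocalDefiningFunction γ (Y x) φ := hYc.eventually hφ.eventually
  have hτ : inner ℝ (gradient φ (Y x₀)) τ = 0 := by
    rw [inner_gradient]
    have h1 : (fun x => φ (Y x)) =ᶠ[𝓝 x₀] fun _ => (0 : ℝ) := by
      filter_upwards [hloc, hFY] with x h1 h2
      exact h1.mem_iff.self_of_nhds.1 h2.1
    have h2 : HasFDerivAt (fun x => φ (Y x)) ((fderiv ℝ φ (Y x₀)).comp (fderiv ℝ Y x₀)) x₀ :=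
      (hφ.contDiffAt.differentiableAt (by norm_num)).hasFDerivAt.comp x₀ hY.hasFDerivAt
    have h3 := (h2.congr_of_eventuallyEq h1.symm).unique (hasFDerivAt_const (0 : ℝ) x₀)
    exact congrArg (fun B : Euc m →L[ℝ] ℝ => B v) h3
  let s : Euc m → ℝ := fun x => inner ℝ (F x - Y x) (unitNormal φ (Y x))
  have hform : ∀ x, IsLocalDefiningFunction γ (Y x) φ → IsClosestPoint γ (F x) (Y x) →
      F x - Y x = s x • unitNormal φ (Y x) := by
    intro x h1 h2
    obtain ⟨r, hr⟩ := h2.exists_sub_eq_smul_gradient h1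
    have h3 : gradient φ (Y x) = ‖gradient φ (Y x)‖ • unitNormal φ (Y x) := by
      rw [unitNormal, smul_smul, mul_inv_cancel₀ (norm_ne_zero_iff.2 h1.gradient_ne_zero), one_smul]
    simp only [s]
    rw [hr, h3, smul_smul, inner_smul_left, real_inner_self_eq_norm_sq, h1.norm_unitNormal]
    simp
  have hν : DifferentiableAt ℝ (fun x => unitNormal φ (Y x)) x₀ :=
    hφ.differentiableAt_unitNormal.comp x₀ hY
  have hs : DifferentiableAt ℝ s x₀ := (hF.sub hY).inner ℝ hν
  have hderiv : fderiv ℝ F x₀ v - τ = s x₀ • fderiv ℝ (unitNormal φ) (Y x₀) τ +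
      (fderiv ℝ s x₀ v) • unitNormal φ (Y x₀) := by
    have h1 : (fun x => F x - Y x) =ᶠ[𝓝 x₀] fun x => s x • unitNormal φ (Y x) := by
      filter_upwards [hloc, hFY] with x h1 h2 using hform x h1 h2
    have h2 : HasFDerivAt (fun x => unitNormal φ (Y x))
        ((fderiv ℝ (unitNormal φ) (Y x₀)).comp (fderiv ℝ Y x₀)) x₀ :=
      hφ.differentiableAt_unitNormal.hasFDerivAt.comp x₀ hY.hasFDerivAt
    have h3 := ((hF.hasFDerivAt.sub hY.hasFDerivAt).congr_of_eventuallyEq h1.symm).unique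
      (hs.hasFDerivAt.smul h2)
    have := congrArg (fun B : Euc m →L[ℝ] Euc (n + 1) => B v) h3
    simpa using this
  have hsnorm : ENNReal.ofReal |s x₀| ≤ (1 / 2) * (maxCurvature γ)⁻¹ := by
    rw [← hcl.edist_eq_infEDist, edist_dist, dist_eq_norm, hform x₀ hφ hcl, norm_smul,
      hφ.norm_unitNormal, mul_one, Real.norm_eq_abs] at hnear
    exact hnear
  have hcurv := hφ.abs_mul_inner_fderiv_unitNormal_le hcl.1 hsnorm hτ
  have hντ : inner ℝ (unitNormal φ (Y x₀)) τ = 0 := by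
    rw [unitNormal, inner_smul_left, hτ, mul_zero]
  have hmain : inner ℝ (fderiv ℝ F x₀ v - a • gradient φ (Y x₀)) τ =
      ‖τ‖ ^ 2 + s x₀ * inner ℝ (fderiv ℝ (unitNormal φ) (Y x₀) τ) τ := by
    have h1 : fderiv ℝ F x₀ v = τ + (s x₀ • fderiv ℝ (unitNormal φ) (Y x₀) τ +
      (fderiv ℝ s x₀ v) • unitNormal φ (Y x₀)) := by rw [← hderiv]; abel
    rw [h1, inner_sub_left, inner_add_left, inner_add_left, inner_smul_left, inner_smul_left,
      inner_smul_left, hτ, hντ, real_inner_self_eq_norm_sq]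
    simp
  have hcs := real_inner_le_norm (fderiv ℝ F x₀ v - a • gradient φ (Y x₀)) τ
  rw [hmain] at hcs
  have h1 := neg_le_of_abs_le hcurv
  rcases (norm_nonneg τ).eq_or_lt with h0 | h0
  · rw [← h0]
    positivity
  · have h2 : ‖τ‖ * ‖τ‖ ≤ 2 * ‖fderiv ℝ F x₀ v - a • gradient φ (Y x₀)‖ * ‖τ‖ := by nlinarith
    exact le_of_mul_le_mul_right h2 h0

end ClosestPoint

/-! ### Measures and bi-Lipschitz maps -/

section Hausdorff

variable {a b n : ℕ}

theorem euclideanHausdorffMeasure_image_le {f : Euc a → Euc b} {s : Set (Euc a)} {K : ℝ}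
    (hK : 0 ≤ K) (hf : ∀ x ∈ s, ∀ y ∈ s, dist (f x) (f y) ≤ K * dist x y) :
    (Measure.euclideanHausdorffMeasure n) (f '' s) ≤
      ENNReal.ofReal (K ^ n) * (Measure.euclideanHausdorffMeasure n) s := by
  have hL : LipschitzOnWith K.toNNReal f s := LipschitzOnWith.of_dist_le_mul fun x hx y hy => by
    rw [Real.coe_toNNReal _ hK]
    exact hf x hx y hy
  have h := hL.hausdorffMeasure_image_le (d := n) (by positivity)
  rw [Measure.euclideanHausdorffMeasure_def, Measure.euclideanHausdorffMeasure_def,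
    Measure.smul_apply, Measure.smul_apply, mul_smul_comm]
  gcongr
  rw [ENNReal.rpow_natCast] at h
  rwa [ENNReal.ofReal_pow hK]

theorem euclideanHausdorffMeasure_le_image {f : Euc a → Euc b} {s : Set (Euc a)} {K : ℝ}
    (hK : 0 ≤ K) (hf : ∀ x ∈ s, ∀ y ∈ s, dist x y ≤ K * dist (f x) (f y)) :
    (Measure.euclideanHausdorffMeasure n) s ≤
      ENNReal.ofReal (K ^ n) * (Measure.euclideanHausdorffMeasure n) (f '' s) := by
  have hinj : InjOn f s := fun x hx y hy hxy => by
    have := hf x hx y hy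
    rw [hxy, dist_self, mul_zero] at this
    exact dist_le_zero.1 this
  rcases s.eq_empty_or_nonempty with rfl | ⟨x₀, _⟩
  · simp
  have : Nonempty (Euc a) := ⟨x₀⟩
  have himg : Function.invFunOn f s '' (f '' s) = s := by
    ext x
    constructor
    · rintro ⟨_, ⟨y, hy, rfl⟩, rfl⟩
      rwa [hinj.leftInvOn_invFunOn hy]
    · intro hx
      exact ⟨f x, ⟨x, hx, rfl⟩, hinj.leftInvOn_invFunOn hx⟩
  conv_lhs => rw [← himg]
  refine euclideanHausdorffMeasure_image_le hK ?_
  rintro _ ⟨x, hx, rfl⟩ _ ⟨y, hy, rfl⟩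
  rw [hinj.leftInvOn_invFunOn hx, hinj.leftInvOn_invFunOn hy]
  exact hf x hx y hy

theorem volume_le_image {f : Euc n → Euc n} {s : Set (Euc n)} {K : ℝ}
    (hK : 0 ≤ K) (hf : ∀ x ∈ s, ∀ y ∈ s, dist x y ≤ K * dist (f x) (f y)) :
    volume s ≤ ENNReal.ofReal (K ^ n) * volume (f '' s) := by
  have := euclideanHausdorffMeasure_le_image (n := n) hK hf
  rwa [EuclideanSpace.euclideanHausdorffMeasure_eq_volume] at this

theorem measurableSet_inter_preimage {X Y : Type*} [TopologicalSpace X] [MeasurableSpace X]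
    [BorelSpace X] [TopologicalSpace Y] [MeasurableSpace Y] [BorelSpace Y] {S : Set X}
    (hS : MeasurableSet S) {f : X → Y} (hf : ContinuousOn f S) {N : Set Y} (hN : MeasurableSet N) :
    MeasurableSet (S ∩ f ⁻¹' N) := by
  have h : Measurable (S.domRestrict f) := (continuousOn_iff_continuous_domRestrict.1 hf).measurable
  have h2 := hS.subtype_image (h hN)
  convert h2 using 1
  ext x
  simp only [mem_inter_iff, mem_preimage, mem_image, Subtype.exists, exists_and_right,
    exists_eq_right, Set.domRestrict_apply, exists_prop]

variable {S : Set (Euc n)} {φ : Euc n → Euc n} {c : ℝ}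

/-- The points at which `φ` expands distances by the factor `c`, at scale `δ`. -/
def expandingSet (S : Set (Euc n)) (φ : Euc n → Euc n) (c δ : ℝ) : Set (Euc n) :=
  {x ∈ S | ∀ y ∈ S, dist y x < δ → c * dist x y ≤ dist (φ x) (φ y)}

theorem isClosed_expandingSet (hS : IsClosed S) (hφ : ContinuousOn φ S) (δ : ℝ) :
    IsClosed (expandingSet S φ c δ) := by
  refine isClosed_of_closure_subset fun x hx => ?_
  have hxS : x ∈ S := hS.closure_subset_iff.2 (fun y hy => hy.1) hx
  refine ⟨hxS, fun y hy hyx => ?_⟩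
  have hne : (𝓝[expandingSet S φ c δ] x).NeBot := mem_closure_iff_nhdsWithin_neBot.1 hx
  have h1 : Tendsto (fun z => c * dist z y) (𝓝[expandingSet S φ c δ] x) (𝓝 (c * dist x y)) :=
    (tendsto_id.mono_left nhdsWithin_le_nhds |>.dist tendsto_const_nhds).const_mul c
  have h2 : Tendsto (fun z => dist (φ z) (φ y)) (𝓝[expandingSet S φ c δ] x)
      (𝓝 (dist (φ x) (φ y))) :=
    ((hφ x hxS).mono_left (nhdsWithin_mono x fun z hz => hz.1)).dist tendsto_const_nhds
  refine le_of_tendsto_of_tendsto h1 h2 ?_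
  have h3 : ∀ᶠ z in 𝓝 x, dist y z < δ :=
    (continuous_const.dist continuous_id).continuousAt.eventually_lt continuousAt_const hyx
  filter_upwards [self_mem_nhdsWithin, nhdsWithin_le_nhds h3] with z hz hz2
  exact hz.2 y hy hz2

theorem volume_le_of_expanding_of_injOn (hc : 0 < c) (hφ : ContinuousOn φ S) {s N : Set (Euc n)}
    {δ : ℝ} (hδ : 0 < δ) (hs : MeasurableSet s) (hsub : s ⊆ expandingSet S φ c δ)
    (hinj : InjOn φ s) (hmaps : MapsTo φ s N) :
    volume s ≤ ENNReal.ofReal (c⁻¹ ^ n) * volume N := by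
  let b : ℕ → Set (Euc n) := fun i => Metric.ball (TopologicalSpace.denseSeq (Euc n) i) (δ / 2)
  have hb : ⋃ i, b i = univ := by
    refine eq_univ_of_forall fun x => ?_
    obtain ⟨_, hy, i, rfl⟩ :=
      Metric.dense_iff.1 (TopologicalSpace.denseRange_denseSeq (Euc n)) x (δ / 2) (by positivity)
    exact mem_iUnion.2 ⟨i, by rwa [Metric.mem_ball, dist_comm]⟩
  let P : ℕ → Set (Euc n) := fun i => s ∩ disjointed b i
  have hPm : ∀ i, MeasurableSet (P i) := fun i =>
    hs.inter (MeasurableSet.disjointed (fun i => measurableSet_ball) i)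
  have hPd : Pairwise (Function.onFun Disjoint P) := fun i j hij =>
    (disjoint_disjointed b hij).mono inter_subset_right inter_subset_right
  have hPu : ⋃ i, P i = s := by
    rw [← inter_iUnion, iUnion_disjointed, hb, inter_univ]
  have hcont : ContinuousOn φ s := hφ.mono fun x hx => (hsub hx).1
  have hPi : ∀ i, P i ⊆ s := fun i => inter_subset_left
  have hIm : ∀ i, MeasurableSet (φ '' P i) := fun i =>
    (hPm i).image_of_continuousOn_injOn (hcont.mono (hPi i)) (hinj.mono (hPi i))
  have hId : Pairwise (Function.onFun Disjoint fun i => φ '' P i) := fun i j hij =>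
    disjoint_image_image fun x hx y hy hxy =>
      (disjoint_left.1 (hPd hij) hx) (hinj (hPi i hx) (hPi j hy) hxy ▸ hy)
  calc volume s = ∑' i, volume (P i) := by rw [← measure_iUnion hPd hPm, hPu]
    _ ≤ ∑' i, ENNReal.ofReal (c⁻¹ ^ n) * volume (φ '' P i) := by
        refine ENNReal.tsum_le_tsum fun i => volume_le_image (by positivity) fun x hx y hy => ?_
        have hx2 : dist x (TopologicalSpace.denseSeq (Euc n) i) < δ / 2 := disjointed_subset b i hx.2
        have hy2 : dist y (TopologicalSpace.denseSeq (Euc n) i) < δ / 2 := disjointed_subset b i hy.2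
        have := (hsub hx.1).2 y (hsub hy.1).1 (by
          have := dist_triangle_right y x (TopologicalSpace.denseSeq (Euc n) i)
          linarith)
        rw [inv_mul_eq_div, le_div_iff₀ hc, mul_comm]
        exact this
    _ = ENNReal.ofReal (c⁻¹ ^ n) * volume (⋃ i, φ '' P i) := by
        rw [ENNReal.tsum_mul_left, measure_iUnion hId hIm]
    _ ≤ _ := by
        gcongr
        exact iUnion_subset fun i => by
          rintro _ ⟨x, hx, rfl⟩
          exact hmaps (hPi i hx)

/-- A measure bound for preimages under a map that is infinitesimally expanding almost everywhere
and injective at a fixed scale. -/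
theorem volume_inter_preimage_le (hc : 0 < c) (hS : IsClosed S) (hφ : ContinuousOn φ S)
    {good : Set (Euc n)} (hgood : volume (S \ good) = 0)
    (hexp : ∀ x ∈ good, ∃ δ > 0, ∀ y ∈ S, dist y x < δ → c * dist x y ≤ dist (φ x) (φ y))
    {ρ : ℝ} (hinj : ∀ x ∈ good, ∀ y ∈ good, dist x y < ρ → φ x = φ y → x = y)
    {t : Finset (Euc n)} (ht : S ⊆ ⋃ z ∈ t, Metric.ball z (ρ / 2))
    {N : Set (Euc n)} (hN : MeasurableSet N) :
    volume (S ∩ φ ⁻¹' N) ≤ ENNReal.ofReal (t.card * c⁻¹ ^ n) * volume N := by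
  let S' := S \ toMeasurable volume (S \ good)
  have hS'm : MeasurableSet S' := hS.measurableSet.diff (measurableSet_toMeasurable _ _)
  have hS'g : S' ⊆ good := fun x hx => by
    by_contra hxg
    exact hx.2 (subset_toMeasurable volume _ ⟨hx.1, hxg⟩)
  have hball : ∀ z, volume (S' ∩ Metric.ball z (ρ / 2) ∩ φ ⁻¹' N) ≤
      ENNReal.ofReal (c⁻¹ ^ n) * volume N := by
    intro z
    let s : ℕ → Set (Euc n) := fun j =>
      (S' ∩ Metric.ball z (ρ / 2)) ∩ (S ∩ φ ⁻¹' N) ∩ expandingSet S φ c (1 / ((j : ℝ) + 1))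
    have hu : S' ∩ Metric.ball z (ρ / 2) ∩ φ ⁻¹' N ⊆ ⋃ j, s j := by
      rintro x ⟨hx, hxN⟩
      obtain ⟨δ, hδ, hδx⟩ := hexp x (hS'g hx.1)
      obtain ⟨j, hj⟩ := exists_nat_one_div_lt hδ
      exact mem_iUnion.2 ⟨j, ⟨hx, hx.1.1, hxN⟩, hx.1.1, fun y hy hyx => hδx y hy (hyx.trans hj)⟩
    have hmono : Monotone s := by
      intro i j hij x hx
      refine ⟨hx.1, hx.2.1, fun y hy hyx => hx.2.2 y hy (hyx.trans_le ?_)⟩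
      exact Nat.one_div_le_one_div hij
    refine (measure_mono hu).trans ?_
    rw [hmono.measure_iUnion]
    refine iSup_le fun j => ?_
    refine volume_le_of_expanding_of_injOn hc hφ (δ := 1 / ((j : ℝ) + 1)) (by positivity) ?_
      inter_subset_right ?_ fun x hx => hx.1.2.2
    · exact ((hS'm.inter measurableSet_ball).inter
        (measurableSet_inter_preimage hS.measurableSet hφ hN)).inter
        (isClosed_expandingSet hS hφ _).measurableSet
    · intro x hx y hy hxy
      refine hinj x (hS'g hx.1.1.1) y (hS'g hy.1.1.1) ?_ hxy
      have h1 : dist x z < ρ / 2 := hx.1.1.2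
      have h2 : dist y z < ρ / 2 := hy.1.1.2
      have := dist_triangle_right x y z
      linarith
  have hcov : S ∩ φ ⁻¹' N ⊆ toMeasurable volume (S \ good) ∪
      ⋃ z ∈ t, (S' ∩ Metric.ball z (ρ / 2) ∩ φ ⁻¹' N) := by
    rintro x ⟨hxS, hxN⟩
    by_cases hx : x ∈ toMeasurable volume (S \ good)
    · exact Or.inl hx
    · obtain ⟨z, hz, hxz⟩ := mem_iUnion₂.1 (ht hxS)
      exact Or.inr (mem_iUnion₂.2 ⟨z, hz, ⟨⟨hxS, hx⟩, hxz⟩, hxN⟩)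
  calc volume (S ∩ φ ⁻¹' N) ≤ volume (toMeasurable volume (S \ good)) +
        ∑ z ∈ t, volume (S' ∩ Metric.ball z (ρ / 2) ∩ φ ⁻¹' N) :=
        (measure_mono hcov).trans ((measure_union_le _ _).trans
          (add_le_add_right (measure_biUnion_finset_le _ _) _))
    _ ≤ 0 + ∑ z ∈ t, ENNReal.ofReal (c⁻¹ ^ n) * volume N := by
        rw [measure_toMeasurable, hgood]
        gcongr with z _
        exact hball z
    _ = _ := by
        rw [zero_add, Finset.sum_const, nsmul_eq_mul, ENNReal.ofReal_mul (by positivity),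
          ENNReal.ofReal_natCast, mul_assoc]

end Hausdorff

/-! ### A Poincaré inequality on convex sets -/

section Poincare

theorem sq_lintegral_le {α : Type*} [MeasurableSpace α] (μ : Measure α) {f : α → ℝ≥0∞}
    (hf : AEMeasurable f μ) : (∫⁻ x, f x ∂μ) ^ 2 ≤ μ univ * ∫⁻ x, f x ^ 2 ∂μ := by
  have h := ENNReal.lintegral_mul_le_Lp_mul_Lq μ (Real.HolderConjugate.two_two) hf
    (aemeasurable_const (b := (1 : ℝ≥0∞)))
  simp only [Pi.mul_apply, mul_one, ENNReal.one_rpow, lintegral_const, one_mul] at h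
  have h2 := pow_le_pow_left' h 2
  rw [mul_pow, ← ENNReal.rpow_natCast (_ ^ (_ : ℝ)) 2, ← ENNReal.rpow_mul,
    ← ENNReal.rpow_natCast (_ ^ (_ : ℝ)) 2, ← ENNReal.rpow_mul] at h2
  norm_num at h2
  rwa [mul_comm]

theorem sq_lintegral_mul_le {α : Type*} [MeasurableSpace α] (μ : Measure α) {k f : α → ℝ≥0∞}
    (hk : Measurable k) (hf : Measurable f) :
    (∫⁻ x, k x * f x ∂μ) ^ 2 ≤ (∫⁻ x, k x ∂μ) * ∫⁻ x, k x * f x ^ 2 ∂μ := by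
  have h := sq_lintegral_le (μ.withDensity k) hf.aemeasurable
  rw [lintegral_withDensity_eq_lintegral_mul _ hk hf,
    lintegral_withDensity_eq_lintegral_mul _ hk (hf.pow_const 2), withDensity_apply _ .univ,
    Measure.restrict_univ] at h
  exact h

variable {n : ℕ}

theorem lintegral_comp_homothety_le {E : Set (Euc n)} (hE : Convex ℝ E) (hEm : MeasurableSet E)
    {x : Euc n} (hx : x ∈ E) {s : ℝ} (hs : 1 / 2 ≤ s) (hs1 : s ≤ 1) (h : Euc n → ℝ≥0∞) :
    ∫⁻ z in E, h (x + s • (z - x)) ≤ 2 ^ n * ∫⁻ z in E, h z := by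
  have hs0 : 0 < s := by linarith
  have hemb : MeasurableEmbedding fun z : Euc n => s • z :=
    (Homeomorph.smulOfNeZero s hs0.ne').measurableEmbedding
  calc ∫⁻ z in E, h (x + s • (z - x))
      ≤ ∫⁻ z in E, E.indicator h (s • z + (x - s • x)) := by
        refine setLIntegral_mono' hEm fun z hz => ?_
        have h1 : x + s • (z - x) = s • z + (x - s • x) := by rw [smul_sub]; abel
        have h2 : x + s • (z - x) ∈ E := hE.add_smul_sub_mem hx hz ⟨hs0.le, hs1⟩
        rw [← h1, indicator_of_mem h2]
    _ ≤ ∫⁻ z, E.indicator h (s • z + (x - s • x)) := setLIntegral_le_lintegral _ _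
    _ = ∫⁻ z, E.indicator h (z + (x - s • x)) ∂(Measure.map (fun z => s • z) volume) := by
        rw [hemb.lintegral_map]
    _ = ENNReal.ofReal |(s ^ n)⁻¹| * ∫⁻ z in E, h z := by
        have := Measure.map_addHaar_smul (volume : Measure (Euc n)) hs0.ne'
        rw [finrank_euclideanSpace_fin] at this
        rw [this, lintegral_smul_measure, lintegral_add_right_eq_self, lintegral_indicator hEm,
          smul_eq_mul]
    _ ≤ 2 ^ n * ∫⁻ z in E, h z := by
        gcongr
        rw [abs_of_pos (by positivity), ← inv_pow]
        have : s⁻¹ ≤ 2 := by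
          rw [inv_le_comm₀ hs0 two_pos]
          linarith
        calc ENNReal.ofReal (s⁻¹ ^ n) ≤ ENNReal.ofReal (2 ^ n) := by gcongr
          _ = 2 ^ n := by rw [ENNReal.ofReal_pow two_pos.le]; simp

theorem enorm_sub_sq_le_lintegral {f : Euc n → ℝ} (hf : ContDiff ℝ 1 f) (x z : Euc n) :
    ‖f x - f z‖ₑ ^ 2 ≤
      ‖x - z‖ₑ ^ 2 * ∫⁻ t in Ioc (0 : ℝ) 1, ‖fderiv ℝ f (x + t • (z - x))‖ₑ ^ 2 := by
  have hc : Continuous (fderiv ℝ f) := hf.continuous_fderiv (by norm_num)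
  have hder : ∀ t : ℝ, HasDerivAt (fun t : ℝ => f (x + t • (z - x)))
      (fderiv ℝ f (x + t • (z - x)) (z - x)) t := by
    intro t
    have h1 : HasDerivAt (fun t : ℝ => x + t • (z - x)) (z - x) t := by
      simpa using ((hasDerivAt_id t).smul_const (z - x)).const_add x
    exact ((hf.differentiable (by norm_num)) _).hasFDerivAt.comp_hasDerivAt t h1
  have hcont : Continuous fun t : ℝ => fderiv ℝ f (x + t • (z - x)) (z - x) := by fun_prop
  have hint := intervalIntegral.integral_eq_sub_of_hasDerivAt (a := 0) (b := 1)
    (fun t _ => hder t) (hcont.intervalIntegrable _ _)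
  simp only [one_smul, add_sub_cancel, zero_smul, add_zero] at hint
  rw [intervalIntegral.integral_of_le zero_le_one] at hint
  have h1 : ‖f x - f z‖ₑ ≤
      ‖x - z‖ₑ * ∫⁻ t in Ioc (0 : ℝ) 1, ‖fderiv ℝ f (x + t • (z - x))‖ₑ := by
    rw [← enorm_neg, neg_sub, ← hint, ← enorm_neg (x - z), neg_sub]
    refine (enorm_integral_le_lintegral_enorm _).trans ?_
    rw [← lintegral_const_mul _ (by fun_prop)]
    refine lintegral_mono fun t => ?_
    rw [mul_comm]
    exact (fderiv ℝ f (x + t • (z - x))).le_opENorm _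
  refine (pow_le_pow_left' h1 2).trans ?_
  rw [mul_pow]
  gcongr
  refine (sq_lintegral_le _ ?_).trans ?_
  · exact Measurable.aemeasurable (by fun_prop)
  · simp

theorem lintegral_lintegral_lintegral_const_mul {α β τ : Type*} [MeasurableSpace α]
    [MeasurableSpace β] [MeasurableSpace τ] (μ : Measure α) (ν : Measure β) (κ : Measure τ)
    [SFinite μ] [SFinite ν] [SFinite κ] {F : α → β → τ → ℝ≥0∞}
    (hF : Measurable fun p : α × β × τ => F p.1 p.2.1 p.2.2) (c : ℝ≥0∞) :
    ∫⁻ x, ∫⁻ z, c * ∫⁻ t, F x z t ∂κ ∂ν ∂μ = c * ∫⁻ t, ∫⁻ x, ∫⁻ z, F x z t ∂ν ∂μ ∂κ := by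
  have h1 : Measurable fun p : (α × β) × τ => F p.1.1 p.1.2 p.2 :=
    hF.comp (by fun_prop : Measurable fun p : (α × β) × τ => (p.1.1, p.1.2, p.2))
  have h2 : Measurable fun p : (α × τ) × β => F p.1.1 p.2 p.1.2 :=
    hF.comp (by fun_prop : Measurable fun p : (α × τ) × β => (p.1.1, p.2, p.1.2))
  have h3 : Measurable fun p : α × β => ∫⁻ t, F p.1 p.2 t ∂κ := h1.lintegral_prod_right'
  have h4 : Measurable fun x : α => ∫⁻ z, ∫⁻ t, F x z t ∂κ ∂ν := h3.lintegral_prod_right'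
  have h5 : Measurable fun p : α × τ => ∫⁻ z, F p.1 z p.2 ∂ν := h2.lintegral_prod_right'
  rw [lintegral_lintegral_swap (f := fun t x => ∫⁻ z, F x z t ∂ν)
    (h5.comp measurable_swap).aemeasurable]
  have h6 : ∀ x, ∫⁻ z, c * ∫⁻ t, F x z t ∂κ ∂ν = c * ∫⁻ z, ∫⁻ t, F x z t ∂κ ∂ν := fun x =>
    lintegral_const_mul _ (h3.comp measurable_prodMk_left)
  simp only [h6]
  rw [lintegral_const_mul _ h4]
  congr 1
  refine lintegral_congr fun x => ?_
  rw [lintegral_lintegral_swap]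
  exact (hF.comp (by fun_prop : Measurable fun p : β × τ => (x, p.1, p.2))).aemeasurable

/-- Poincaré inequality in double integral form, for `C¹` functions on a convex set. -/
theorem lintegral_lintegral_enorm_sub_sq_le {f : Euc n → ℝ} (hf : ContDiff ℝ 1 f)
    {E : Set (Euc n)} (hE : Convex ℝ E) (hEm : MeasurableSet E) {δ : ℝ≥0∞}
    (hδ : ∀ x ∈ E, ∀ z ∈ E, ‖x - z‖ₑ ≤ δ) :
    ∫⁻ x in E, ∫⁻ z in E, ‖f x - f z‖ₑ ^ 2 ≤
      2 ^ n * δ ^ 2 * volume E * ∫⁻ x in E, ‖fderiv ℝ f x‖ₑ ^ 2 := by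
  have hc : Continuous (fderiv ℝ f) := hf.continuous_fderiv (by norm_num)
  set I := ∫⁻ x in E, ‖fderiv ℝ f x‖ₑ ^ 2
  let F : Euc n → Euc n → ℝ → ℝ≥0∞ := fun x z t => ‖fderiv ℝ f (x + t • (z - x))‖ₑ ^ 2
  have hF : Measurable fun p : Euc n × Euc n × ℝ => F p.1 p.2.1 p.2.2 := by
    have : Continuous fun p : Euc n × Euc n × ℝ => fderiv ℝ f (p.1 + p.2.2 • (p.2.1 - p.1)) := by
      fun_prop
    exact this.enorm.measurable.pow_const 2
  have hJ : ∀ t ∈ Ioc (0 : ℝ) 1, ∫⁻ x in E, ∫⁻ z in E, F x z t ≤ 2 ^ n * volume E * I := by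
    intro t ht
    rcases le_total (1 / 2) t with h | h
    · calc ∫⁻ x in E, ∫⁻ z in E, F x z t ≤ ∫⁻ x in E, 2 ^ n * I :=
            setLIntegral_mono' hEm fun x hx =>
              lintegral_comp_homothety_le hE hEm hx h ht.2 _
        _ = _ := by rw [setLIntegral_const]; ring
    · rw [lintegral_lintegral_swap]
      · calc ∫⁻ z in E, ∫⁻ x in E, F x z t ≤ ∫⁻ x in E, 2 ^ n * I := by
              refine setLIntegral_mono' hEm fun z hz => ?_
              have := lintegral_comp_homothety_le hE hEm hz (s := 1 - t) (by linarith)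
                (by linarith [ht.1]) fun y => ‖fderiv ℝ f y‖ₑ ^ 2
              refine le_trans (le_of_eq ?_) this
              refine lintegral_congr fun x => ?_
              have : x + t • (z - x) = z + (1 - t) • (x - z) := by
                rw [sub_smul, one_smul, smul_sub, smul_sub]
                abel
              simp only [F]
              rw [this]
          _ = _ := by rw [setLIntegral_const]; ring
      · exact (hF.comp (by fun_prop : Measurable fun p : Euc n × Euc n => (p.1, p.2, t))).aemeasurable
  calc ∫⁻ x in E, ∫⁻ z in E, ‖f x - f z‖ₑ ^ 2
      ≤ ∫⁻ x in E, ∫⁻ z in E, δ ^ 2 * ∫⁻ t in Ioc (0 : ℝ) 1, F x z t := by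
        refine setLIntegral_mono' hEm fun x hx => setLIntegral_mono' hEm fun z hz => ?_
        refine (enorm_sub_sq_le_lintegral hf x z).trans ?_
        gcongr
        exact hδ x hx z hz
    _ = δ ^ 2 * ∫⁻ t in Ioc (0 : ℝ) 1, ∫⁻ x in E, ∫⁻ z in E, F x z t :=
        lintegral_lintegral_lintegral_const_mul _ _ _ hF _
    _ ≤ δ ^ 2 * ∫⁻ t in Ioc (0 : ℝ) 1, 2 ^ n * volume E * I := by
        exact mul_le_mul_right (setLIntegral_mono' measurableSet_Ioc hJ) _
    _ = 2 ^ n * δ ^ 2 * volume E * I := by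
        rw [setLIntegral_const]
        simp
        ring

end Poincare

/-! ### Mollification -/

section Mollify

open scoped Convolution

variable {n : ℕ}

/-- Convolution with a normalized bump function. -/
def mollify (ρ : ContDiffBump (0 : Euc n)) (u : Euc n → ℝ) : Euc n → ℝ :=
  ρ.normed volume ⋆[ContinuousLinearMap.lsmul ℝ ℝ, volume] u

theorem mollify_apply (ρ : ContDiffBump (0 : Euc n)) (u : Euc n → ℝ) (x : Euc n) :
    mollify ρ u x = ∫ y, ρ.normed volume (x - y) * u y := by
  rw [mollify, convolution_lsmul_swap]
  simp

theorem contDiff_mollify (ρ : ContDiffBump (0 : Euc n)) {u : Euc n → ℝ}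
    (hu : LocallyIntegrable u) : ContDiff ℝ ∞ (mollify ρ u) :=
  ρ.hasCompactSupport_normed.contDiff_convolution_left _ ρ.contDiff_normed hu

theorem hasCompactSupport_comp_sub {f : Euc n → ℝ} (hf : HasCompactSupport f) (x : Euc n) :
    HasCompactSupport fun y => f (x - y) :=
  hf.comp_homeomorph (Homeomorph.subLeft x)

theorem tsupport_normed_comp_sub (ρ : ContDiffBump (0 : Euc n)) (x : Euc n) :
    tsupport (fun y => ρ.normed volume (x - y)) ⊆ Metric.closedBall x ρ.rOut := by
  refine closure_minimal (fun y hy => ?_) Metric.isClosed_closedBall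
  have h1 : x - y ∈ Function.support (ρ.normed volume) := hy
  rw [ρ.support_normed_eq, mem_ball_zero_iff] at h1
  rw [Metric.mem_closedBall, dist_comm, dist_eq_norm]
  exact h1.le

theorem fderiv_comp_sub {f : Euc n → ℝ} (hf : Differentiable ℝ f) (x y e : Euc n) :
    fderiv ℝ (fun y => f (x - y)) y e = -fderiv ℝ f (x - y) e := by
  have h1 : HasFDerivAt (fun y : Euc n => x - y) (-ContinuousLinearMap.id ℝ (Euc n)) y := by
    simpa using (hasFDerivAt_id y).const_sub x
  have h2 : HasFDerivAt (fun y => f (x - y))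
      ((fderiv ℝ f (x - y)).comp (-ContinuousLinearMap.id ℝ (Euc n))) y :=
    (hf (x - y)).hasFDerivAt.comp y h1
  rw [h2.fderiv]
  simp

theorem fderiv_mollify (ρ : ContDiffBump (0 : Euc n)) {u : Euc n → ℝ}
    (hu : LocallyIntegrable u) (x e : Euc n) :
    fderiv ℝ (mollify ρ u) x e =
      -∫ y, u y * fderiv ℝ (fun y => ρ.normed volume (x - y)) y e := by
  have hρ : ContDiff ℝ 1 (ρ.normed volume) := ρ.contDiff_normed
  have h := ρ.hasCompactSupport_normed.hasFDerivAt_convolution_right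
    (ContinuousLinearMap.lsmul ℝ ℝ) hu hρ x
  have hfun : (u ⋆[ContinuousLinearMap.lsmul ℝ ℝ, volume] ρ.normed volume) = mollify ρ u := by
    ext z
    rw [mollify_apply, convolution_lsmul]
    simp [mul_comm]
  rw [hfun] at h
  rw [h.fderiv, convolution_precompR_apply _ hu (ρ.hasCompactSupport_normed.fderiv ℝ)
    (hρ.continuous_fderiv (by norm_num)), convolution_lsmul, ← integral_neg]
  refine integral_congr_ae (ae_of_all _ fun y => ?_)
  simp only [smul_eq_mul]
  rw [fderiv_comp_sub (hρ.differentiable (by norm_num))]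
  ring

/-- `g` bounds the weak gradient of `u` on `Ω`, tested with functions supported in balls of
radius `ε`. -/
def IsWeakUpperGradient (Ω : Set (Euc n)) (u g : Euc n → ℝ) (ε : ℝ) : Prop :=
  ∀ (x : Euc n) (η : Euc n → ℝ), ContDiff ℝ ∞ η → HasCompactSupport η →
    tsupport η ⊆ Ω → tsupport η ⊆ Metric.closedBall x ε → ∀ e : Euc n,
      |∫ y, u y * fderiv ℝ η y e| ≤ ‖e‖ * ∫ y, g y * |η y|

theorem IsWeakUpperGradient.norm_fderiv_mollify_le {Ω : Set (Euc n)} {u g : Euc n → ℝ} {ε : ℝ}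
    (h : IsWeakUpperGradient Ω u g ε) (hu : LocallyIntegrable u) (hg : ∀ y, 0 ≤ g y)
    (ρ : ContDiffBump (0 : Euc n)) (hρ : ρ.rOut ≤ ε) {x : Euc n}
    (hx : Metric.closedBall x ρ.rOut ⊆ Ω) :
    ‖fderiv ℝ (mollify ρ u) x‖ ≤ mollify ρ g x := by
  have h0 : ∀ y, 0 ≤ ρ.normed volume (x - y) := fun y => ρ.nonneg_normed _
  refine ContinuousLinearMap.opNorm_le_bound _ ?_ fun e => ?_
  · rw [mollify_apply]
    exact integral_nonneg fun y => mul_nonneg (h0 y) (hg y)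
  · rw [fderiv_mollify ρ hu, norm_neg, Real.norm_eq_abs]
    refine (h x (fun y => ρ.normed volume (x - y)) (ρ.contDiff_normed.comp (by fun_prop))
      (hasCompactSupport_comp_sub ρ.hasCompactSupport_normed x)
      ((tsupport_normed_comp_sub ρ x).trans hx)
      ((tsupport_normed_comp_sub ρ x).trans (Metric.closedBall_subset_closedBall hρ)) e).trans
      (le_of_eq ?_)
    rw [mul_comm, mollify_apply]
    congr 1
    refine integral_congr_ae (ae_of_all _ fun y => ?_)
    simp only
    rw [abs_of_nonneg (h0 y), mul_comm]

theorem lintegral_normed_comp_sub (ρ : ContDiffBump (0 : Euc n)) (x : Euc n) :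
    ∫⁻ y, ENNReal.ofReal (ρ.normed volume (x - y)) = 1 := by
  rw [lintegral_sub_left_eq_self (fun y => ENNReal.ofReal (ρ.normed volume y)),
    ← ofReal_integral_eq_lintegral_ofReal ρ.integrable_normed (ae_of_all _ fun y => ρ.nonneg_normed y),
    ρ.integral_normed, ENNReal.ofReal_one]

theorem lintegral_normed_comp_sub_right (ρ : ContDiffBump (0 : Euc n)) (y : Euc n) :
    ∫⁻ x, ENNReal.ofReal (ρ.normed volume (x - y)) = 1 := by
  rw [lintegral_sub_right_eq_self (fun y => ENNReal.ofReal (ρ.normed volume y)),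
    ← ofReal_integral_eq_lintegral_ofReal ρ.integrable_normed (ae_of_all _ fun y => ρ.nonneg_normed y),
    ρ.integral_normed, ENNReal.ofReal_one]

theorem measurable_normed_comp {α : Type*} [MeasurableSpace α] (ρ : ContDiffBump (0 : Euc n))
    {f : α → Euc n} (hf : Measurable f) :
    Measurable fun a => ENNReal.ofReal (ρ.normed volume (f a)) :=
  ((ρ.contDiff_normed (n := 0)).continuous.measurable.comp hf).ennreal_ofReal

theorem enorm_mollify_sq_le_lintegral (ρ : ContDiffBump (0 : Euc n)) {g : Euc n → ℝ}
    (hg : Measurable g) (x : Euc n) : ‖mollify ρ g x‖ₑ ^ 2 ≤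
      ∫⁻ y, ENNReal.ofReal (ρ.normed volume (x - y)) * ‖g y‖ₑ ^ 2 := by
  have hk : Measurable fun y => ENNReal.ofReal (ρ.normed volume (x - y)) :=
    measurable_normed_comp ρ (measurable_const.sub measurable_id)
  have h1 : ‖mollify ρ g x‖ₑ ≤ ∫⁻ y, ENNReal.ofReal (ρ.normed volume (x - y)) * ‖g y‖ₑ := by
    rw [mollify_apply]
    refine (enorm_integral_le_lintegral_enorm _).trans (le_of_eq ?_)
    refine lintegral_congr fun y => ?_
    rw [enorm_mul, Real.enorm_eq_ofReal (ρ.nonneg_normed _)]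
  have h2 := sq_lintegral_mul_le volume hk hg.enorm
  rw [lintegral_normed_comp_sub, one_mul] at h2
  exact (pow_le_pow_left' h1 2).trans h2

theorem lintegral_enorm_mollify_sq_le (ρ : ContDiffBump (0 : Euc n)) {g : Euc n → ℝ}
    (hg : Measurable g) {A E : Set (Euc n)} (hE : MeasurableSet E)
    (hAE : ∀ x ∈ A, Metric.closedBall x ρ.rOut ⊆ E) (hA : MeasurableSet A) :
    ∫⁻ x in A, ‖mollify ρ g x‖ₑ ^ 2 ≤ ∫⁻ x in E, ‖g x‖ₑ ^ 2 := by
  have hk := measurable_normed_comp ρ (measurable_fst.sub (measurable_snd (α := Euc n)))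
  have hm : Measurable (E.indicator fun y => ‖g y‖ₑ ^ 2) := (hg.enorm.pow_const 2).indicator hE
  have hpt : ∀ x ∈ A, ‖mollify ρ g x‖ₑ ^ 2 ≤
      ∫⁻ y, ENNReal.ofReal (ρ.normed volume (x - y)) * E.indicator (fun y => ‖g y‖ₑ ^ 2) y := by
    intro x hx
    refine (enorm_mollify_sq_le_lintegral ρ hg x).trans (lintegral_mono fun y => ?_)
    by_cases hy : y ∈ E
    · simp only [indicator_of_mem hy, le_refl]
    · have : ρ.normed volume (x - y) = 0 := by
        by_contra hne
        exact hy (hAE x hx (tsupport_normed_comp_sub ρ x (subset_tsupport _ hne)))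
      simp only [this, ENNReal.ofReal_zero, zero_mul, le_refl]
  refine (setLIntegral_mono' hA hpt).trans ((setLIntegral_le_lintegral _ _).trans (le_of_eq ?_))
  rw [lintegral_lintegral_swap (hk.mul (hm.comp measurable_snd)).aemeasurable,
    ← lintegral_indicator hE]
  refine lintegral_congr fun y => ?_
  have h1 : Measurable fun x => ENNReal.ofReal (ρ.normed volume (x - y)) :=
    measurable_normed_comp ρ (measurable_id.sub measurable_const)
  rw [lintegral_mul_const _ h1, lintegral_normed_comp_sub_right, one_mul]

/-- A sequence of bump functions shrinking to the origin. -/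
def bumpSeq (n : ℕ) (i : ℕ) : ContDiffBump (0 : Euc n) where
  rIn := 1 / ((i : ℝ) + 1) / 2
  rOut := 1 / ((i : ℝ) + 1)
  rIn_pos := by positivity
  rIn_lt_rOut := half_lt_self (by positivity)

theorem tendsto_rOut_bumpSeq : Tendsto (fun i => (bumpSeq n i).rOut) atTop (𝓝 0) :=
  tendsto_one_div_add_atTop_nhds_zero_nat

theorem ae_tendsto_mollify {u : Euc n → ℝ} (hu : LocallyIntegrable u) :
    ∀ᵐ x, Tendsto (fun i => mollify (bumpSeq n i) u x) atTop (𝓝 (u x)) :=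
  ContDiffBump.ae_convolution_tendsto_right_of_locallyIntegrable (K := 2) tendsto_rOut_bumpSeq
    (Eventually.of_forall fun i => by simp only [bumpSeq]; linarith) hu

theorem integrable_mollify (ρ : ContDiffBump (0 : Euc n)) {u : Euc n → ℝ} (hu : Integrable u) :
    Integrable (mollify ρ u) :=
  ρ.integrable_normed.integrable_convolution _ hu

theorem tendsto_integral_abs_mollify_sub {u : Euc n → ℝ} (hu : Integrable u) :
    Tendsto (fun i => ∫ x, |mollify (bumpSeq n i) u x - u x|) atTop (𝓝 0) := by
  let h : ℕ → Euc n → ℝ := fun i => mollify (bumpSeq n i) fun y => |u y|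
  let f : ℕ → Euc n → ℝ := fun i x => |mollify (bumpSeq n i) u x - u x|
  have hint : ∀ i, Integrable (mollify (bumpSeq n i) u) := fun i =>
    integrable_mollify _ hu
  have hhint : ∀ i, Integrable (h i) := fun i =>
    integrable_mollify _ hu.abs
  have hfint : ∀ i, Integrable (f i) := fun i => ((hint i).sub hu).abs
  have hh : ∀ i, ∫ x, h i x = ∫ x, |u x| := by
    intro i
    have := integral_convolution (μ := (volume : Measure (Euc n))) (ContinuousLinearMap.lsmul ℝ ℝ)
      ((bumpSeq n i).integrable_normed (μ := volume)) hu.abs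
    rw [(bumpSeq n i).integral_normed] at this
    simp only [ContinuousLinearMap.lsmul_apply, one_smul] at this
    exact this
  have hle : ∀ i x, |mollify (bumpSeq n i) u x| ≤ h i x := by
    intro i x
    simp only [h]
    rw [mollify_apply, mollify_apply]
    refine (abs_integral_le_integral_abs).trans (le_of_eq ?_)
    refine integral_congr_ae (ae_of_all _ fun y => ?_)
    simp only
    rw [abs_mul, abs_of_nonneg ((bumpSeq n i).nonneg_normed _)]
  let F : ℕ → Euc n → ℝ := fun i x => h i x + |u x| - f i x
  have hF0 : ∀ i x, 0 ≤ F i x := fun i x => by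
    have h1 := hle i x
    have h2 := abs_sub (mollify (bumpSeq n i) u x) (u x)
    simp only [F, f]
    linarith
  have hFint : ∀ i, Integrable (F i) := fun i => ((hhint i).add hu.abs).sub (hfint i)
  set A := ∫ x, |u x|
  have hFsub : ∀ i, ∫ x, F i x = 2 * A - ∫ x, f i x := by
    intro i
    have h1 : Integrable fun x => h i x + |u x| := (hhint i).add hu.abs
    have h2 : ∫ x, (h i x + |u x|) = 2 * A := by
      rw [integral_add (hhint i) hu.abs, hh i, two_mul]
    rw [← h2]
    exact integral_sub h1 (hfint i)
  have hFval : ∀ i, ∫⁻ x, ENNReal.ofReal (F i x) = ENNReal.ofReal (2 * A - ∫ x, f i x) := by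
    intro i
    rw [← ofReal_integral_eq_lintegral_ofReal (hFint i) (ae_of_all _ (hF0 i)), hFsub]
  have hlim : ∀ᵐ x, liminf (fun i => ENNReal.ofReal (F i x)) atTop = ENNReal.ofReal (2 * |u x|) := by
    filter_upwards [ae_tendsto_mollify hu.locallyIntegrable,
      ae_tendsto_mollify hu.abs.locallyIntegrable] with x h1 h2
    refine Tendsto.liminf_eq (ENNReal.tendsto_ofReal ?_)
    have h3 : Tendsto (fun i => f i x) atTop (𝓝 0) := by
      simpa using (h1.sub_const (u x)).abs
    have := (h2.add_const |u x|).sub h3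
    rwa [sub_zero, ← two_mul] at this
  have hfatou : ENNReal.ofReal (2 * A) ≤
      liminf (fun i => ENNReal.ofReal (2 * A - ∫ x, f i x)) atTop := by
    have h1 : ∫⁻ x, liminf (fun i => ENNReal.ofReal (F i x)) atTop ≤
        liminf (fun i => ∫⁻ x, ENNReal.ofReal (F i x)) atTop := lintegral_liminf_le' fun i => (hFint i).aemeasurable.ennreal_ofReal
    rw [lintegral_congr_ae hlim, ← ofReal_integral_eq_lintegral_ofReal (hu.abs.const_mul 2)
      (ae_of_all _ fun x => by positivity), integral_const_mul] at h1
    simpa only [hFval] using h1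
  have hf0 : ∀ i, 0 ≤ ∫ x, f i x := fun i => integral_nonneg fun x => abs_nonneg _
  have hA0 : 0 ≤ A := integral_nonneg fun x => abs_nonneg _
  have hle2 : ∀ i, ∫ x, f i x ≤ 2 * A := fun i => by
    have h1 := hFsub i
    have h2 : 0 ≤ ∫ x, F i x := integral_nonneg (hF0 i)
    linarith
  refine tendsto_order.2 ⟨fun a ha => Eventually.of_forall fun i => ha.trans_le (hf0 i),
    fun a ha => ?_⟩
  rcases hA0.eq_or_lt with hA | hA
  · exact Eventually.of_forall fun i => (hle2 i).trans_lt (by rw [← hA]; simpa using ha)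
  · have h1 : ENNReal.ofReal (2 * A - a) < ENNReal.ofReal (2 * A) :=
      (ENNReal.ofReal_lt_ofReal_iff (by positivity)).2 (by linarith)
    filter_upwards [eventually_lt_of_lt_liminf (h1.trans_le hfatou)] with i hi
    have := lt_of_not_ge fun hge => not_le_of_gt hi (ENNReal.ofReal_le_ofReal hge)
    linarith

/-- The points of `E` whose distance from the complement is more than `r`. -/
def innerSet (E : Set (Euc n)) (r : ℝ) : Set (Euc n) := (Metric.cthickening r Eᶜ)ᶜ

theorem isOpen_innerSet (E : Set (Euc n)) (r : ℝ) : IsOpen (innerSet E r) :=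
  Metric.isClosed_cthickening.isOpen_compl

theorem closedBall_subset_of_mem_innerSet {E : Set (Euc n)} {r : ℝ} {x : Euc n}
    (hx : x ∈ innerSet E r) : Metric.closedBall x r ⊆ E := fun y hy => by
  by_contra hyE
  exact hx (Metric.mem_cthickening_of_dist_le x y r _ hyE (by rwa [dist_comm]))

theorem mem_innerSet_iff {E : Set (Euc n)} (hE : IsOpen E) {r : ℝ} (hr : 0 ≤ r) {x : Euc n} :
    x ∈ innerSet E r ↔ Metric.closedBall x r ⊆ E := by
  refine ⟨closedBall_subset_of_mem_innerSet, fun h hx => ?_⟩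
  rw [hE.isClosed_compl.cthickening_eq_biUnion_closedBall hr] at hx
  obtain ⟨y, hy, hxy⟩ := mem_iUnion₂.1 hx
  exact hy (h (by rwa [Metric.mem_closedBall, dist_comm]))

theorem convex_innerSet {E : Set (Euc n)} (hE : IsOpen E) (hc : Convex ℝ E) {r : ℝ} (hr : 0 ≤ r) :
    Convex ℝ (innerSet E r) := by
  intro p hp q hq a b ha hb hab
  rw [mem_innerSet_iff hE hr] at *
  intro y hy
  set w := y - (a • p + b • q)
  have hw : ‖w‖ ≤ r := by rwa [Metric.mem_closedBall, dist_eq_norm] at hy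
  have h1 : p + w ∈ E := hp (by simpa using hw)
  have h2 : q + w ∈ E := hq (by simpa using hw)
  have h3 : y = a • (p + w) + b • (q + w) := by
    have : a • (p + w) + b • (q + w) = a • p + b • q + (a + b) • w := by
      rw [smul_add, smul_add, add_smul]; abel
    rw [this, hab, one_smul]
    simp [w]
  rw [h3]
  exact hc h1 h2 ha hb hab

theorem eventually_mem_innerSet {E : Set (Euc n)} (hE : IsOpen E) {x : Euc n} (hx : x ∈ E) :
    ∀ᶠ i in atTop, x ∈ innerSet E (bumpSeq n i).rOut := by
  obtain ⟨r, hr, hrE⟩ := Metric.isOpen_iff.1 hE x hx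
  filter_upwards [tendsto_rOut_bumpSeq.eventually_lt_const hr] with i hi
  rw [mem_innerSet_iff hE (bumpSeq n i).rOut_pos.le]
  exact (Metric.closedBall_subset_ball hi).trans hrE

theorem lintegral_lintegral_le_of_liminf {α : Type*} [MeasurableSpace α] {μ : Measure α} [SFinite μ]
    {F : ℕ → α → α → ℝ≥0∞} {G : α → α → ℝ≥0∞} {B : ℝ≥0∞}
    (hF : ∀ i, Measurable fun p : α × α => F i p.1 p.2)
    (hlim : ∀ᵐ x ∂μ, ∀ᵐ z ∂μ, liminf (fun i => F i x z) atTop = G x z)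
    (hbound : ∀ᶠ i in atTop, ∫⁻ x, ∫⁻ z, F i x z ∂μ ∂μ ≤ B) :
    ∫⁻ x, ∫⁻ z, G x z ∂μ ∂μ ≤ B :=
  calc ∫⁻ x, ∫⁻ z, G x z ∂μ ∂μ
      = ∫⁻ x, ∫⁻ z, liminf (fun i => F i x z) atTop ∂μ ∂μ := by
        refine lintegral_congr_ae ?_
        filter_upwards [hlim] with x hx
        exact lintegral_congr_ae (hx.mono fun z hz => hz.symm)
    _ ≤ ∫⁻ x, liminf (fun i => ∫⁻ z, F i x z ∂μ) atTop ∂μ :=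
        lintegral_mono fun x => lintegral_liminf_le fun i => (hF i).comp measurable_prodMk_left
    _ ≤ liminf (fun i => ∫⁻ x, ∫⁻ z, F i x z ∂μ ∂μ) atTop :=
        lintegral_liminf_le fun i => (hF i).lintegral_prod_right'
    _ ≤ B := liminf_le_of_frequently_le' hbound.frequently

theorem IsWeakUpperGradient.lintegral_lintegral_le {Ω : Set (Euc n)} {u g : Euc n → ℝ} {ε : ℝ}
    (h : IsWeakUpperGradient Ω u g ε) (hε : 0 < ε) (hu : LocallyIntegrable u)
    (hgm : Measurable g) (hg : ∀ y, 0 ≤ g y) {E : Set (Euc n)} (hE : IsOpen E)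
    (hc : Convex ℝ E) (hEΩ : E ⊆ Ω) {δ : ℝ≥0∞} (hδ : ∀ x ∈ E, ∀ z ∈ E, ‖x - z‖ₑ ≤ δ) :
    ∫⁻ x in E, ∫⁻ z in E, ‖u x - u z‖ₑ ^ 2 ≤
      2 ^ n * δ ^ 2 * volume E * ∫⁻ x in E, ‖g x‖ₑ ^ 2 := by
  let v : ℕ → Euc n → ℝ := fun i => mollify (bumpSeq n i) u
  let A : ℕ → Set (Euc n) := fun i => innerSet E (bumpSeq n i).rOut
  have hAm : ∀ i, MeasurableSet (A i) := fun i => (isOpen_innerSet _ _).measurableSet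
  have hAE : ∀ i, A i ⊆ E := fun i x hx =>
    closedBall_subset_of_mem_innerSet hx (Metric.mem_closedBall_self (bumpSeq n i).rOut_pos.le)
  have hv : ∀ i, ContDiff ℝ 1 (v i) := fun i =>
    (contDiff_mollify (bumpSeq n i) hu).of_le (by norm_cast)
  have hvm : ∀ i, Measurable (v i) := fun i => (hv i).continuous.measurable
  have hbound : ∀ᶠ i in atTop, ∫⁻ x in A i, ∫⁻ z in A i, ‖v i x - v i z‖ₑ ^ 2 ≤
      2 ^ n * δ ^ 2 * volume E * ∫⁻ x in E, ‖g x‖ₑ ^ 2 := by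
    filter_upwards [tendsto_rOut_bumpSeq.eventually_lt_const hε] with i hi
    refine (lintegral_lintegral_enorm_sub_sq_le (hv i)
      (convex_innerSet hE hc (bumpSeq n i).rOut_pos.le) (hAm i)
      fun x hx z hz => hδ x (hAE i hx) z (hAE i hz)).trans ?_
    refine mul_le_mul' (mul_le_mul' le_rfl (measure_mono (hAE i))) ?_
    · refine le_trans (setLIntegral_mono' (hAm i) fun x hx => ?_)
        (lintegral_enorm_mollify_sq_le (bumpSeq n i) hgm hE.measurableSet
          (fun x hx => closedBall_subset_of_mem_innerSet hx) (hAm i))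
      have h1 := h.norm_fderiv_mollify_le hu hg (bumpSeq n i) hi.le
        ((closedBall_subset_of_mem_innerSet hx).trans hEΩ)
      gcongr
      exact enorm_le_iff_norm_le.2 (h1.trans (le_abs_self _))
  let F : ℕ → Euc n → Euc n → ℝ≥0∞ := fun i x z =>
    (A i).indicator (fun x => (A i).indicator (fun z => ‖v i x - v i z‖ₑ ^ 2) z) x
  have hF : ∀ i, Measurable fun p : Euc n × Euc n => F i p.1 p.2 := by
    intro i
    have h1 : Measurable fun p : Euc n × Euc n => ‖v i p.1 - v i p.2‖ₑ ^ 2 :=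
      (((hvm i).comp measurable_fst).sub ((hvm i).comp measurable_snd)).enorm.pow_const 2
    have h2 := (h1.indicator ((hAm i).prod MeasurableSet.univ)).indicator
      (MeasurableSet.univ.prod (hAm i))
    convert h2 using 1
    ext p
    by_cases hp1 : p.1 ∈ A i <;> by_cases hp2 : p.2 ∈ A i <;> simp [F, indicator, hp1, hp2]
  have hFint : ∀ i, ∫⁻ x in E, ∫⁻ z in E, F i x z = ∫⁻ x in A i, ∫⁻ z in A i, ‖v i x - v i z‖ₑ ^ 2 := by
    intro i
    have h1 : ∀ x, ∫⁻ z in E, F i x z =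
        (A i).indicator (fun x => ∫⁻ z in A i, ‖v i x - v i z‖ₑ ^ 2) x := by
      intro x
      by_cases hx : x ∈ A i
      · simp only [F, indicator_of_mem hx]
        rw [lintegral_indicator (hAm i), Measure.restrict_restrict (hAm i),
          inter_eq_self_of_subset_left (hAE i)]
      · simp [F, indicator_of_notMem hx]
    simp only [h1]
    rw [lintegral_indicator (hAm i), Measure.restrict_restrict (hAm i),
          inter_eq_self_of_subset_left (hAE i)]
  have hconv := ae_tendsto_mollify hu
  have hlim : ∀ᵐ x ∂(volume.restrict E), ∀ᵐ z ∂(volume.restrict E),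
      liminf (fun i => F i x z) atTop = ‖u x - u z‖ₑ ^ 2 := by
    filter_upwards [ae_restrict_of_ae hconv, ae_restrict_mem hE.measurableSet] with x hx hxE
    filter_upwards [ae_restrict_of_ae hconv, ae_restrict_mem hE.measurableSet] with z hz hzE
    refine Tendsto.liminf_eq ?_
    have h1 : Tendsto (fun i => ‖v i x - v i z‖ₑ ^ 2) atTop (𝓝 (‖u x - u z‖ₑ ^ 2)) :=
      (ENNReal.continuous_pow 2).continuousAt.tendsto.comp (hx.sub hz).enorm
    refine h1.congr' ?_
    filter_upwards [eventually_mem_innerSet hE hxE, eventually_mem_innerSet hE hzE] with i h1 h2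
    simp only [F]
    rw [indicator_of_mem h1, indicator_of_mem h2]
  refine lintegral_lintegral_le_of_liminf hF hlim ?_
  simp only [hFint]
  exact hbound

end Mollify

/-! ### Composition with a map close to the identity -/

section Averaging

variable {n : ℕ}

theorem ennreal_add_sq_le (a b : ℝ≥0∞) : (a + b) ^ 2 ≤ 2 * a ^ 2 + 2 * b ^ 2 := by
  have := ENNReal.rpow_add_le_mul_rpow_add_rpow a b (p := 2) (by norm_num)
  norm_num at this
  rwa [← mul_add]

theorem enorm_sub_sq_le (a b c : ℝ) :
    ‖a - c‖ₑ ^ 2 ≤ 2 * ‖a - b‖ₑ ^ 2 + 2 * ‖b - c‖ₑ ^ 2 := by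
  refine le_trans (pow_le_pow_left' ?_ 2) (ennreal_add_sq_le _ _)
  have : a - c = (a - b) + (b - c) := by ring
  rw [this]
  exact enorm_add_le _ _

theorem setLIntegral_comp_le {T E : Set (Euc n)} {φ : Euc n → Euc n} (hφ : Measurable φ)
    (hE : MeasurableSet E) (hmaps : MapsTo φ T E) {M : ℝ≥0∞}
    (harea : ∀ N, MeasurableSet N → volume (T ∩ φ ⁻¹' N) ≤ M * volume N)
    {h : Euc n → ℝ≥0∞} (hh : Measurable h) :
    ∫⁻ x in T, h (φ x) ≤ M * ∫⁻ z in E, h z := by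
  rw [← lintegral_map hh hφ, ← smul_eq_mul, ← lintegral_smul_measure]
  refine lintegral_mono' (Measure.le_iff.2 fun N hN => ?_) le_rfl
  rw [Measure.map_apply hφ hN, Measure.restrict_apply (hφ hN), Measure.smul_apply,
    Measure.restrict_apply hN, smul_eq_mul]
  refine le_trans (measure_mono ?_) (harea _ (hN.inter hE))
  exact fun x hx => ⟨hx.2, hx.1, hmaps hx.2⟩

theorem IsWeakUpperGradient.lintegral_comp_le_of_subset {Ω : Set (Euc n)} {u g : Euc n → ℝ} {ε : ℝ}
    (h : IsWeakUpperGradient Ω u g ε) (hε : 0 < ε) (hu : LocallyIntegrable u) (hum : Measurable u)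
    (hgm : Measurable g) (hg : ∀ y, 0 ≤ g y) {E T : Set (Euc n)} (hE : IsOpen E)
    (hc : Convex ℝ E) (hEΩ : E ⊆ Ω) {δ : ℝ≥0∞} (hδ : ∀ x ∈ E, ∀ z ∈ E, ‖x - z‖ₑ ≤ δ)
    (hEfin : volume E ≠ ⊤) {φ : Euc n → Euc n} (hφ : Measurable φ) (hTE : T ⊆ E) (hmaps : MapsTo φ T E) {M : ℝ≥0∞}
    (harea : ∀ N, MeasurableSet N → volume (T ∩ φ ⁻¹' N) ≤ M * volume N) :
    ∫⁻ x in T, ‖u x - u (φ x)‖ₑ ^ 2 ≤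
      2 * (1 + M) * (2 ^ n * δ ^ 2 * ∫⁻ x in E, ‖g x‖ₑ ^ 2) := by
  rcases eq_or_ne (volume E) 0 with h0 | h0
  · rw [setLIntegral_measure_zero _ _ (measure_mono_null hTE h0)]
    exact zero_le
  have hP := h.lintegral_lintegral_le hε hu hgm hg hE hc hEΩ hδ
  set J := ∫⁻ x in E, ∫⁻ z in E, ‖u x - u z‖ₑ ^ 2
  have hm : Measurable fun p : Euc n × Euc n => ‖u p.1 - u p.2‖ₑ ^ 2 :=
    ((hum.comp measurable_fst).sub (hum.comp measurable_snd)).enorm.pow_const 2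
  have hm1 : ∀ x, Measurable fun z => ‖u x - u z‖ₑ ^ 2 := fun x =>
    (measurable_const.sub hum).enorm.pow_const 2
  have hm2 : Measurable fun p : Euc n × Euc n => ‖u p.2 - u (φ p.1)‖ₑ ^ 2 :=
    ((hum.comp measurable_snd).sub (hum.comp (hφ.comp measurable_fst))).enorm.pow_const 2
  have h1 : ∫⁻ x in T, ∫⁻ z in E, ‖u x - u z‖ₑ ^ 2 ≤ J := lintegral_mono_set hTE
  have h2 : ∫⁻ x in T, ∫⁻ z in E, ‖u z - u (φ x)‖ₑ ^ 2 ≤ M * J := by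
    rw [lintegral_lintegral_swap hm2.aemeasurable]
    calc ∫⁻ z in E, ∫⁻ x in T, ‖u z - u (φ x)‖ₑ ^ 2
        ≤ ∫⁻ z in E, M * ∫⁻ x in E, ‖u z - u x‖ₑ ^ 2 :=
          lintegral_mono fun z => setLIntegral_comp_le hφ hE.measurableSet hmaps harea (hm1 z)
      _ = M * J := lintegral_const_mul _ hm.lintegral_prod_right'
  have hmain : volume E * ∫⁻ x in T, ‖u x - u (φ x)‖ₑ ^ 2 ≤ 2 * (1 + M) * J := by
    have hmf : Measurable fun x => ‖u x - u (φ x)‖ₑ ^ 2 :=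
      (hum.sub (hum.comp hφ)).enorm.pow_const 2
    calc volume E * ∫⁻ x in T, ‖u x - u (φ x)‖ₑ ^ 2
        = ∫⁻ x in T, ∫⁻ _z in E, ‖u x - u (φ x)‖ₑ ^ 2 := by
          rw [← lintegral_const_mul _ hmf]
          refine lintegral_congr fun x => ?_
          rw [setLIntegral_const, mul_comm]
      _ ≤ ∫⁻ x in T, ∫⁻ z in E, (2 * ‖u x - u z‖ₑ ^ 2 + 2 * ‖u z - u (φ x)‖ₑ ^ 2) :=
          lintegral_mono fun x => lintegral_mono fun z => enorm_sub_sq_le _ _ _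
      _ = ∫⁻ x in T, (2 * (∫⁻ z in E, ‖u x - u z‖ₑ ^ 2) +
            2 * ∫⁻ z in E, ‖u z - u (φ x)‖ₑ ^ 2) := by
          refine lintegral_congr fun x => ?_
          rw [lintegral_add_left ((hm1 x).const_mul 2), lintegral_const_mul _ (hm1 x),
            lintegral_const_mul _ (show Measurable fun z => ‖u z - u (φ x)‖ₑ ^ 2 from
              hm2.comp measurable_prodMk_left)]
      _ = 2 * (∫⁻ x in T, ∫⁻ z in E, ‖u x - u z‖ₑ ^ 2) +
            2 * ∫⁻ x in T, ∫⁻ z in E, ‖u z - u (φ x)‖ₑ ^ 2 := by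
          rw [lintegral_add_left (hm.lintegral_prod_right'.const_mul 2),
            lintegral_const_mul _ hm.lintegral_prod_right',
            lintegral_const_mul _ hm2.lintegral_prod_right']
      _ ≤ 2 * J + 2 * (M * J) := by gcongr
      _ = 2 * (1 + M) * J := by ring
  refine (ENNReal.mul_le_mul_iff_right h0 hEfin).1 (hmain.trans ?_)
  calc 2 * (1 + M) * J ≤ 2 * (1 + M) * (2 ^ n * δ ^ 2 * volume E * ∫⁻ x in E, ‖g x‖ₑ ^ 2) := by
        gcongr
    _ = _ := by ring

theorem lintegral_setLIntegral_ball {f : Euc n → ℝ≥0∞} (hf : Measurable f) (S : Set (Euc n))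
    (r : ℝ) :
    ∫⁻ a, ∫⁻ x in S ∩ Metric.ball a r, f x =
      volume (Metric.ball (0 : Euc n) r) * ∫⁻ x in S, f x := by
  have h1 : ∀ a, ∫⁻ x in S ∩ Metric.ball a r, f x =
      ∫⁻ x in S, (Metric.ball a r).indicator f x := by
    intro a
    rw [lintegral_indicator measurableSet_ball, Measure.restrict_restrict measurableSet_ball,
      inter_comm]
  have hD : MeasurableSet {p : Euc n × Euc n | dist p.2 p.1 < r} :=
    (isOpen_lt (continuous_snd.dist continuous_fst) continuous_const).measurableSet
  have hm : Measurable fun p : Euc n × Euc n => (Metric.ball p.1 r).indicator f p.2 := by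
    have := (hf.comp (measurable_snd (α := Euc n))).indicator hD
    exact this
  simp only [h1]
  rw [lintegral_lintegral_swap hm.aemeasurable, ← lintegral_const_mul _ hf]
  refine lintegral_congr fun x => ?_
  have h2 : ∀ a, (Metric.ball a r).indicator f x =
      (Metric.ball x r).indicator (fun _ => f x) a := by
    intro a
    by_cases h : dist x a < r
    · rw [indicator_of_mem (show x ∈ Metric.ball a r from h),
        indicator_of_mem (show a ∈ Metric.ball x r by rwa [Metric.mem_ball, dist_comm])]
    · rw [indicator_of_notMem (show x ∉ Metric.ball a r from h),
        indicator_of_notMem (show a ∉ Metric.ball x r by rwa [Metric.mem_ball, dist_comm])]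
  simp only [h2]
  rw [lintegral_indicator measurableSet_ball, setLIntegral_const, mul_comm,
    Measure.addHaar_ball_center]

/-- The `L²` distance between `u` and its composition with a map moving points by less than `r`. -/
theorem IsWeakUpperGradient.lintegral_sub_comp_le {Ω : Set (Euc n)} {u g : Euc n → ℝ} {ε : ℝ}
    (h : IsWeakUpperGradient Ω u g ε) (hε : 0 < ε) (hu : LocallyIntegrable u) (hum : Measurable u)
    (hgm : Measurable g) (hg : ∀ y, 0 ≤ g y) (hΩ : IsOpen Ω) (hc : Convex ℝ Ω) {T : Set (Euc n)}
    (hTΩ : T ⊆ Ω) {φ : Euc n → Euc n} (hφ : Measurable φ)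
    (hmaps : MapsTo φ T Ω) {M : ℝ≥0∞}
    (harea : ∀ N, MeasurableSet N → volume (T ∩ φ ⁻¹' N) ≤ M * volume N) {r : ℝ} (hr : 0 < r)
    (hclose : ∀ x ∈ T, dist (φ x) x < r) :
    ∫⁻ x in T, ‖u x - u (φ x)‖ₑ ^ 2 ≤
      2 ^ (2 * n + 5) * (1 + M) * ENNReal.ofReal r ^ 2 * ∫⁻ x in Ω, ‖g x‖ₑ ^ 2 := by
  have hmf : Measurable fun x => ‖u x - u (φ x)‖ₑ ^ 2 := (hum.sub (hum.comp hφ)).enorm.pow_const 2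
  have hmg : Measurable fun x => ‖g x‖ₑ ^ 2 := hgm.enorm.pow_const 2
  have hloc : ∀ a, ∫⁻ x in T ∩ Metric.ball a r, ‖u x - u (φ x)‖ₑ ^ 2 ≤
      2 * (1 + M) * (2 ^ n * ENNReal.ofReal (4 * r) ^ 2 *
        ∫⁻ x in Ω ∩ Metric.ball a (2 * r), ‖g x‖ₑ ^ 2) := by
    intro a
    refine h.lintegral_comp_le_of_subset hε hu hum hgm hg (hΩ.inter Metric.isOpen_ball)
      (hc.inter (convex_ball a _)) inter_subset_left ?_ ?_ hφ ?_ ?_ ?_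
    · intro x hx z hz
      rw [← edist_eq_enorm_sub, edist_dist]
      refine ENNReal.ofReal_le_ofReal ?_
      have h1 := dist_triangle_right x z a
      have h2 : dist x a < 2 * r := hx.2
      have h3 : dist z a < 2 * r := hz.2
      linarith
    · exact ((measure_mono inter_subset_right).trans_lt
        (measure_ball_lt_top (x := a) (r := 2 * r))).ne
    · exact fun x hx => ⟨hTΩ hx.1, Metric.ball_subset_ball (by linarith) hx.2⟩
    · intro x hx
      refine ⟨hmaps hx.1, ?_⟩
      have h1 := dist_triangle (φ x) x a
      have h2 := hclose x hx.1
      have h3 : dist x a < r := hx.2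
      rw [Metric.mem_ball]
      linarith
    · exact fun N hN => (measure_mono (by gcongr; exact inter_subset_left)).trans (harea N hN)
  have hint := lintegral_mono (μ := (volume : Measure (Euc n))) hloc
  rw [lintegral_setLIntegral_ball hmf] at hint
  have hD : Measurable fun a => ∫⁻ x in Ω ∩ Metric.ball a (2 * r), ‖g x‖ₑ ^ 2 := by
    have h1 : ∀ a, ∫⁻ x in Ω ∩ Metric.ball a (2 * r), ‖g x‖ₑ ^ 2 =
        ∫⁻ x, (Ω ∩ Metric.ball a (2 * r)).indicator (fun x => ‖g x‖ₑ ^ 2) x := fun a =>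
      (lintegral_indicator (hΩ.measurableSet.inter measurableSet_ball) _).symm
    simp only [h1]
    refine Measurable.lintegral_prod_right' (f := fun p : Euc n × Euc n =>
      (Ω ∩ Metric.ball p.1 (2 * r)).indicator (fun x => ‖g x‖ₑ ^ 2) p.2) ?_
    have hDm : MeasurableSet {p : Euc n × Euc n | p.2 ∈ Ω ∧ dist p.2 p.1 < 2 * r} :=
      (hΩ.preimage continuous_snd).measurableSet.inter
        (isOpen_lt (continuous_snd.dist continuous_fst) continuous_const).measurableSet
    have := (hmg.comp (measurable_snd (α := Euc n))).indicator hDm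
    exact this
  rw [lintegral_const_mul _ (hD.const_mul _), lintegral_const_mul _ hD,
    lintegral_setLIntegral_ball hmg] at hint
  have hB : volume (Metric.ball (0 : Euc n) (2 * r)) = 2 ^ n * volume (Metric.ball (0 : Euc n) r) := by
    rw [Measure.addHaar_ball_mul_of_pos _ _ two_pos, finrank_euclideanSpace_fin,
      ENNReal.ofReal_pow two_pos.le]
    simp
  have hB0 : volume (Metric.ball (0 : Euc n) r) ≠ 0 := (Metric.measure_ball_pos _ _ hr).ne'
  refine (ENNReal.mul_le_mul_iff_right hB0 measure_ball_lt_top.ne).1 (hint.trans (le_of_eq ?_))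
  have h4 : ENNReal.ofReal (4 * r) = 4 * ENNReal.ofReal r := by
    rw [ENNReal.ofReal_mul (by norm_num)]
    simp
  rw [hB, h4, pow_add, pow_mul']
  ring

end Averaging

/-! ### Local parametrizations -/

section Charts

variable {n : ℕ} {γ : Set (Euc (n + 1))}

theorem exists_linear_chart {v : Euc (n + 1)} (hv : v ≠ 0) :
    ∃ (π : Euc (n + 1) →L[ℝ] Euc n) (e : Euc (n + 1) ≃L[ℝ] ℝ × Euc n),
      ∀ x, e x = (inner ℝ v x, π x) := by
  have hfact : Fact (Module.finrank ℝ (Euc (n + 1)) = n + 1) := ⟨finrank_euclideanSpace_fin⟩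
  let b := OrthonormalBasis.fromOrthogonalSpanSingleton (𝕜 := ℝ) n hv
  let π : Euc (n + 1) →L[ℝ] Euc n :=
    (b.repr.toContinuousLinearEquiv : (ℝ ∙ v)ᗮ →L[ℝ] Euc n).comp ((ℝ ∙ v)ᗮ.orthogonalProjectionOnto)
  let A : Euc (n + 1) →L[ℝ] ℝ × Euc n := (innerSL ℝ v).prod π
  have hinj : Function.Injective (A : Euc (n + 1) →ₗ[ℝ] ℝ × Euc n) := by
    rw [← LinearMap.ker_eq_bot, LinearMap.ker_eq_bot']
    intro x hx
    have h1 : inner ℝ v x = 0 := congrArg Prod.fst hx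
    have h2 : b.repr ((ℝ ∙ v)ᗮ.orthogonalProjectionOnto x) = 0 := congrArg Prod.snd hx
    rw [map_eq_zero_iff _ b.repr.injective, Submodule.orthogonalProjectionOnto_eq_zero_iff,
      Submodule.orthogonal_orthogonal] at h2
    obtain ⟨t, rfl⟩ := Submodule.mem_span_singleton.1 h2
    rw [inner_smul_right, real_inner_self_eq_norm_sq, mul_eq_zero] at h1
    rcases h1 with h1 | h1
    · simp [h1]
    · exact absurd (by simpa using h1) hv
  have hrank : Module.finrank ℝ (Euc (n + 1)) = Module.finrank ℝ (ℝ × Euc n) := by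
    simp [add_comm]
  refine ⟨π, (LinearEquiv.ofInjectiveOfFinrankEq _ hinj hrank).toContinuousLinearEquiv, fun x => rfl⟩

/-- `F` is a Lipschitz local parametrization of `γ` over a ball, with the linear map `π` as left
inverse. -/
structure IsLinearChart (γ : Set (Euc (n + 1))) (π : Euc (n + 1) →L[ℝ] Euc n)
    (F : Euc n → Euc (n + 1)) (u₀ : Euc n) (R : ℝ) (Λ : NNReal) : Prop where
  isLocalParametrization : IsLocalParametrization γ (Metric.ball u₀ R) F
  lipschitzOnWith : LipschitzOnWith Λ F (Metric.ball u₀ R)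
  leftInverse : ∀ u ∈ Metric.ball u₀ R, π (F u) = u

/-- A `C²` hypersurface is locally parametrized over a ball, with a linear map as chart. -/
theorem IsC2Hypersurface.exists_chart (hγ : IsC2Hypersurface γ) {y₀ : Euc (n + 1)} (hy₀ : y₀ ∈ γ) :
    ∃ (π : Euc (n + 1) →L[ℝ] Euc n) (F : Euc n → Euc (n + 1)) (R : ℝ) (Λ : NNReal), 0 < R ∧
      IsLinearChart γ π F (π y₀) R Λ ∧ ∀ᶠ y in 𝓝 y₀, y ∈ γ → F (π y) = y := by
  obtain ⟨φ, hφ⟩ := hγ y₀ hy₀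
  obtain ⟨π, e, he⟩ := exists_linear_chart hφ.gradient_ne_zero
  let Ψ : Euc (n + 1) → ℝ × Euc n := fun x => (φ x, π x)
  have hΨ : ContDiffAt ℝ 2 Ψ y₀ := hφ.contDiffAt.prodMk π.contDiff.contDiffAt
  have hΨ' : HasFDerivAt Ψ (e : Euc (n + 1) →L[ℝ] ℝ × Euc n) y₀ := by
    have h1 : HasFDerivAt Ψ ((fderiv ℝ φ y₀).prod π) y₀ :=
      (hφ.contDiffAt.differentiableAt (by norm_num)).hasFDerivAt.prodMk (π.hasFDerivAt (x := y₀))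
    have h2 : (e : Euc (n + 1) →L[ℝ] ℝ × Euc n) = (fderiv ℝ φ y₀).prod π := by
      refine ContinuousLinearMap.ext fun x => ?_
      simp [he]
    rwa [h2]
  let G := hΨ.localInverse hΨ' (by norm_num)
  have hφ0 : φ y₀ = 0 := hφ.mem_iff.self_of_nhds.1 hy₀
  have hΨ0 : Ψ y₀ = (0, π y₀) := by simp only [Ψ, hφ0]
  have hG : ContDiffAt ℝ 2 G (0, π y₀) := by
    rw [← hΨ0]
    exact hΨ.to_localInverse hΨ' (by norm_num)
  have hstrict : HasStrictFDerivAt Ψ (e : Euc (n + 1) →L[ℝ] ℝ × Euc n) y₀ :=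
    hΨ.hasStrictFDerivAt' hΨ' (by norm_num)
  have hright : ∀ᶠ z in 𝓝 ((0 : ℝ), π y₀), Ψ (G z) = z := by
    rw [← hΨ0]
    exact hstrict.eventually_right_inverse
  have hleft : ∀ᶠ y in 𝓝 y₀, G (Ψ y) = y := hstrict.eventually_left_inverse
  have hG0 : G (0, π y₀) = y₀ := by
    rw [← hΨ0]
    exact hleft.self_of_nhds
  let F : Euc n → Euc (n + 1) := fun u => G (0, u)
  have hpair : Tendsto (fun u : Euc n => ((0 : ℝ), u)) (𝓝 (π y₀)) (𝓝 ((0 : ℝ), π y₀)) :=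
    (Continuous.prodMk continuous_const continuous_id).tendsto _
  have hF : ContDiffAt ℝ 2 F (π y₀) :=
    hG.comp (π y₀) (contDiffAt_const.prodMk contDiffAt_id)
  have hFr : ∀ᶠ u in 𝓝 (π y₀), φ (F u) = 0 ∧ π (F u) = u := by
    filter_upwards [hpair.eventually hright] with u hu
    exact ⟨congrArg Prod.fst hu, congrArg Prod.snd hu⟩
  have hFγ : ∀ᶠ u in 𝓝 (π y₀), F u ∈ γ := by
    have hF0 : F (π y₀) = y₀ := hG0
    have h1 : ∀ᶠ u in 𝓝 (π y₀), F u ∈ γ ↔ φ (F u) = 0 :=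
      hF.continuousAt.eventually (by rw [hF0]; exact hφ.mem_iff)
    filter_upwards [h1, hFr] with u h1 h2 using h1.2 h2.1
  obtain ⟨Λ, t, ht, hΛ⟩ := (hF.of_le (by norm_num : (1 : WithTop ℕ∞) ≤ 2)).exists_lipschitzOnWith
  obtain ⟨R, hR, hball⟩ := Metric.eventually_nhds_iff_ball.1
    (((hF.eventually (by simp)).and hFr).and (hFγ.and (eventually_mem_set.2 ht)))
  refine ⟨π, F, R, Λ, hR, ⟨⟨Metric.isOpen_ball, fun u hu => (hball u hu).1.1.contDiffWithinAt,
    fun u hu => ?_, fun u hu v hv huv => ?_, fun u hu => (hball u hu).2.1⟩,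
    hΛ.mono fun u hu => (hball u hu).2.2, fun u hu => (hball u hu).1.2.2⟩, ?_⟩
  · have h1 : HasFDerivAt (fun u => π (F u)) (π.comp (fderiv ℝ F u)) u :=
      π.hasFDerivAt.comp u ((hball u hu).1.1.differentiableAt (by norm_num)).hasFDerivAt
    have h2 : (fun u => π (F u)) =ᶠ[𝓝 u] id := by
      filter_upwards [Metric.isOpen_ball.mem_nhds hu] with v hv using (hball v hv).1.2.2
    have h3 := (h1.congr_of_eventuallyEq h2.symm).unique (hasFDerivAt_id u)
    refine Function.LeftInverse.injective (g := π) fun v => ?_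
    exact congrArg (fun B : Euc n →L[ℝ] Euc n => B v) h3
  · rw [← (hball u hu).1.2.2, ← (hball v hv).1.2.2, huv]
  · filter_upwards [hleft, hφ.mem_iff] with y h1 h2 hy
    have h3 : Ψ y = (0, π y) := by simp only [Ψ, h2.1 hy]
    rwa [h3] at h1

end Charts

/-! ### Weak gradients under bi-Lipschitz parametrizations -/

section WeakGradient

variable {n : ℕ}

theorem map_restrict_le_smul {N : ℕ} {s : Set (Euc n)} {E : Set (Euc N)} (hs : MeasurableSet s)
    {f : Euc n → Euc N} (hf : ContinuousOn f s) (hmaps : MapsTo f s E) {K : ℝ} (hK : 0 ≤ K)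
    (hfK : ∀ x ∈ s, ∀ y ∈ s, dist x y ≤ K * dist (f x) (f y)) :
    (volume.restrict s).map f ≤
      ENNReal.ofReal (K ^ n) • (Measure.euclideanHausdorffMeasure n).restrict E := by
  refine Measure.le_iff.2 fun A hA => ?_
  rw [Measure.map_apply_of_aemeasurable (hf.aemeasurable hs) hA, Measure.restrict_apply' hs,
    Measure.smul_apply, Measure.restrict_apply hA, smul_eq_mul,
    ← EuclideanSpace.euclideanHausdorffMeasure_eq_volume]
  refine (euclideanHausdorffMeasure_le_image (f := f) hK fun x hx y hy => hfK x hx.2 y hy.2).trans ?_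
  gcongr
  rintro _ ⟨x, hx, rfl⟩
  exact ⟨hx.1, hmaps hx.2⟩

theorem MemLp.comp_of_map_le {α β E : Type*} [MeasurableSpace α] [MeasurableSpace β]
    [NormedAddCommGroup E] {μ : Measure α} {ν : Measure β} {f : α → β} (hf : AEMeasurable f μ)
    {c : ℝ≥0∞} (hc : c ≠ ⊤) (hle : μ.map f ≤ c • ν) {p : ℝ≥0∞} {w : β → E} (hw : MemLp w p ν) :
    MemLp (fun x => w (f x)) p μ := by
  have h1 : MemLp w p (μ.map f) := (hw.smul_measure hc).mono_measure hle
  exact (memLp_map_measure_iff h1.1 hf).1 h1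

theorem integrable_comp_of_map_le {α β : Type*} [MeasurableSpace α] [MeasurableSpace β]
    {μ : Measure α} {ν : Measure β} {f : α → β} (hf : AEMeasurable f μ) {c : ℝ} (hc : 0 ≤ c)
    (hle : μ.map f ≤ ENNReal.ofReal c • ν) {q : β → ℝ} (hq : Integrable q ν) :
    Integrable (fun x => q (f x)) μ ∧ ∫ x, |q (f x)| ∂μ ≤ c * ∫ y, |q y| ∂ν := by
  have h1 : Integrable q (ENNReal.ofReal c • ν) := hq.smul_measure ENNReal.ofReal_ne_top
  have h2 : Integrable q (μ.map f) := h1.mono_measure hle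
  refine ⟨h2.comp_aemeasurable hf, ?_⟩
  rw [← integral_map hf h2.abs.aestronglyMeasurable (f := fun y => |q y|)]
  refine (integral_mono_measure hle (ae_of_all _ fun y => abs_nonneg _) h1.abs).trans (le_of_eq ?_)
  rw [integral_smul_measure, ENNReal.toReal_ofReal hc, smul_eq_mul]

variable {γ : Set (Euc (n + 1))} {w : Euc (n + 1) → ℝ} {G : Euc (n + 1) → Euc (n + 1)}
  {π : Euc (n + 1) →L[ℝ] Euc n} {F : Euc n → Euc (n + 1)} {u₀ : Euc n} {R : ℝ} {Λ : NNReal}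

/-- The pull-back of a function to a chart domain, extended by zero. -/
def chartFun (F : Euc n → Euc (n + 1)) (u₀ : Euc n) (R : ℝ) (w : Euc (n + 1) → ℝ) : Euc n → ℝ :=
  (Metric.ball u₀ R).indicator fun u => w (F u)

/-- The pull-back of a vector field to a chart domain, extended by zero. -/
def chartGrad (F : Euc n → Euc (n + 1)) (u₀ : Euc n) (R : ℝ) (G : Euc (n + 1) → Euc (n + 1))
    (j : Fin n) : Euc n → ℝ :=
  (Metric.ball u₀ R).indicator fun u => inner ℝ (G (F u)) (fderiv ℝ F u (EuclideanSpace.single j 1))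

theorem IsLinearChart.map_le (h : IsLinearChart γ π F u₀ R Λ) :
    (volume.restrict (Metric.ball u₀ R)).map F ≤ ENNReal.ofReal (‖π‖ ^ n) • surfaceMeasure γ := by
  refine map_restrict_le_smul measurableSet_ball h.lipschitzOnWith.continuousOn
    h.isLocalParametrization.mapsTo (norm_nonneg _) fun x hx y hy => ?_
  conv_lhs => rw [← h.leftInverse x hx, ← h.leftInverse y hy]
  rw [dist_eq_norm, dist_eq_norm, ← map_sub]
  exact π.le_opNorm _

theorem IsLinearChart.aemeasurable (h : IsLinearChart γ π F u₀ R Λ) :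
    AEMeasurable F (volume.restrict (Metric.ball u₀ R)) :=
  h.lipschitzOnWith.continuousOn.aemeasurable measurableSet_ball

instance (u₀ : Euc n) (R : ℝ) : IsFiniteMeasure (volume.restrict (Metric.ball u₀ R)) :=
  ⟨by rw [Measure.restrict_apply_univ]; exact measure_ball_lt_top⟩

theorem IsLinearChart.integrable_chartFun (h : IsLinearChart γ π F u₀ R Λ) (hw : MemH1 γ w G) :
    Integrable (chartFun F u₀ R w) := by
  rw [chartFun, integrable_indicator_iff measurableSet_ball]
  exact (MemLp.comp_of_map_le h.aemeasurable ENNReal.ofReal_ne_top h.map_le hw.memLp).integrable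
    (by norm_num)

theorem IsLinearChart.differentiableAt (h : IsLinearChart γ π F u₀ R Λ) {u : Euc n}
    (hu : u ∈ Metric.ball u₀ R) : DifferentiableAt ℝ F u :=
  (h.isLocalParametrization.contDiffOn.contDiffAt (Metric.isOpen_ball.mem_nhds hu)).differentiableAt
    (by norm_num)

theorem IsLinearChart.integrable_chartGrad (h : IsLinearChart γ π F u₀ R Λ) (hw : MemH1 γ w G)
    (j : Fin n) : Integrable (chartGrad F u₀ R G j) := by
  rw [chartGrad, integrable_indicator_iff measurableSet_ball]
  have h1 : Integrable (fun u => G (F u)) (volume.restrict (Metric.ball u₀ R)) :=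
    (MemLp.comp_of_map_le h.aemeasurable ENNReal.ofReal_ne_top h.map_le
      hw.memLp_gradient).integrable (by norm_num)
  have h2 : ContinuousOn (fun u => fderiv ℝ F u (EuclideanSpace.single j 1)) (Metric.ball u₀ R) :=
    (h.isLocalParametrization.contDiffOn.continuousOn_fderiv_of_isOpen Metric.isOpen_ball
      (by norm_num)).clm_apply continuousOn_const
  refine (h1.norm.mul_const Λ).mono'
    (h1.aestronglyMeasurable.inner (h2.aestronglyMeasurable measurableSet_ball)) ?_
  filter_upwards [ae_restrict_mem measurableSet_ball] with u hu
  refine (norm_inner_le_norm _ _).trans ?_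
  gcongr
  have h3 := norm_fderiv_le_of_lipschitzOn ℝ (Metric.isOpen_ball.mem_nhds hu) h.lipschitzOnWith
  refine ((fderiv ℝ F u).le_opNorm _).trans ?_
  simpa using h3

theorem IsLinearChart.fderiv_mollify_chartFun (h : IsLinearChart γ π F u₀ R Λ) (hw : MemH1 γ w G)
    (ρ : ContDiffBump (0 : Euc n)) {u : Euc n} (hu : Metric.closedBall u ρ.rOut ⊆ Metric.ball u₀ R)
    (j : Fin n) :
    fderiv ℝ (mollify ρ (chartFun F u₀ R w)) u (EuclideanSpace.single j 1) =
      mollify ρ (chartGrad F u₀ R G j) u := by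
  have h1 := hw.weakGradient.weak_deriv _ F h.isLocalParametrization
    (fun y => ρ.normed volume (u - y)) (ρ.contDiff_normed.comp (by fun_prop))
    (hasCompactSupport_comp_sub ρ.hasCompactSupport_normed u)
    ((tsupport_normed_comp_sub ρ u).trans hu) j
  rw [fderiv_mollify ρ (h.integrable_chartFun hw).locallyIntegrable, mollify_apply]
  have h2 (f g : Euc n → ℝ) : ∫ y, (Metric.ball u₀ R).indicator f y * g y =
      ∫ y in Metric.ball u₀ R, f y * g y := by
    rw [← integral_indicator measurableSet_ball]
    refine integral_congr_ae (ae_of_all _ fun y => ?_)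
    exact (indicator_mul_left (Metric.ball u₀ R) f g).symm
  rw [chartFun, chartGrad, h2, h1, neg_neg, ← h2]
  simp only [mul_comm]

theorem abs_fderiv_sub_le_sum {q : Euc n → ℝ} {u : Euc n} {g : Euc (n + 1)} (a : Euc n) :
    |fderiv ℝ q u a - inner ℝ g (fderiv ℝ F u a)| ≤
      (∑ j, |fderiv ℝ q u (EuclideanSpace.single j 1) -
        inner ℝ g (fderiv ℝ F u (EuclideanSpace.single j 1))|) * ‖a‖ := by
  have ha : a = ∑ j, a j • EuclideanSpace.single j (1 : ℝ) := by
    ext i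
    simp [Finset.sum_apply, Pi.single_apply]
  have h1 : fderiv ℝ q u a - inner ℝ g (fderiv ℝ F u a) =
      ∑ j, a j * (fderiv ℝ q u (EuclideanSpace.single j 1) -
        inner ℝ g (fderiv ℝ F u (EuclideanSpace.single j 1))) := by
    conv_lhs => rw [ha]
    simp only [map_sum, map_smul, inner_sum, inner_smul_right, smul_eq_mul, mul_sub,
      Finset.sum_sub_distrib]
  rw [h1, Finset.sum_mul]
  refine (Finset.abs_sum_le_sum_abs _ _).trans (Finset.sum_le_sum fun j _ => ?_)
  rw [abs_mul, mul_comm]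
  gcongr
  exact PiLp.norm_apply_le a j

theorem abs_lineDeriv_comp_chart_le {V : Set (Euc n)} (hV : IsOpen V)
    {χ : Euc n → Euc (n + 1)} {A : ℝ} (hA : 0 ≤ A)
    (hχ : ∀ x ∈ V, ∀ y ∈ V, dist (χ x) (χ y) ≤ A * dist x y)
    (hFχ : ∀ x ∈ V, F (π (χ x)) = χ x) {x : Euc n} (hx : x ∈ V)
    (hF : DifferentiableAt ℝ F (π (χ x))) {q : Euc n → ℝ} (hq : DifferentiableAt ℝ q (π (χ x)))
    {f : Euc n → ℝ} (hf : EqOn f (fun x => q (π (χ x))) V) {e : Euc n}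
    (hd : LineDifferentiableAt ℝ f x e) (g : Euc (n + 1)) {b : ℝ}
    (hb : ∀ a, |fderiv ℝ q (π (χ x)) a - inner ℝ g (fderiv ℝ F (π (χ x)) a)| ≤ b * ‖a‖) :
    |lineDeriv ℝ f x e| ≤ ‖e‖ * (A * ‖g‖ + ‖π‖ * A * b) := by
  have hb0 : 0 ≤ b * ‖e‖ := (abs_nonneg _).trans (hb e)
  set κ := ‖π‖ * A * ‖e‖ with hκ
  have hκ0 : 0 ≤ κ := by positivity
  have hbκ : 0 ≤ b * κ := by
    have : b * κ = (‖π‖ * A) * (b * ‖e‖) := by rw [hκ]; ring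
    rw [this]
    positivity
  refine le_of_forall_pos_le_add fun ε hε => ?_
  set ε₁ := ε / (κ * (1 + ‖g‖) + 1) with hε₁
  have hε₁0 : 0 < ε₁ := by positivity
  have hε₁le : ε₁ * (κ * (1 + ‖g‖)) ≤ ε := by
    rw [hε₁, div_mul_eq_mul_div, div_le_iff₀ (by positivity)]
    nlinarith
  have htend : Tendsto (fun t : ℝ => x + t • e) (𝓝[>] 0) (𝓝 x) := by
    have : Continuous fun t : ℝ => x + t • e := by fun_prop
    simpa using (this.tendsto 0).mono_left nhdsWithin_le_nhds
  have hθ : Tendsto (fun y => π (χ y)) (𝓝 x) (𝓝 (π (χ x))) := by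
    have hχc : ContinuousAt χ x := by
      refine Metric.continuousAt_iff.2 fun δ hδ => ?_
      obtain ⟨r, hr, hrV⟩ := Metric.isOpen_iff.1 hV x hx
      refine ⟨min r (δ / (A + 1)), by positivity, fun y hy => ?_⟩
      have h1 := hχ y (hrV (hy.trans_le (min_le_left _ _))) x hx
      have h2 : dist y x < δ / (A + 1) := hy.trans_le (min_le_right _ _)
      rw [lt_div_iff₀ (by positivity)] at h2
      nlinarith [dist_nonneg (x := y) (y := x)]
    exact (π.continuous.tendsto _).comp hχc
  have hlim := hd.hasLineDerivAt.tendsto_slope_zero_right.norm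
  rw [Real.norm_eq_abs] at hlim
  refine le_of_tendsto hlim ?_
  have e1 := (hθ.comp htend).eventually (hq.hasFDerivAt.isLittleO.def hε₁0)
  have e2 := (hθ.comp htend).eventually (hF.hasFDerivAt.isLittleO.def hε₁0)
  filter_upwards [e1, e2, htend.eventually (hV.mem_nhds hx), self_mem_nhdsWithin] with t h1 h2 h3 ht
  have ht0 : (0 : ℝ) < t := ht
  simp only [Function.comp_apply] at h1 h2
  set y := x + t • e
  set a := π (χ y) - π (χ x)
  have hdist : ‖χ y - χ x‖ ≤ A * (t * ‖e‖) := by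
    have := hχ y h3 x hx
    rwa [dist_eq_norm, dist_eq_norm, show y - x = t • e by simp [y], norm_smul, Real.norm_eq_abs,
      abs_of_pos ht0] at this
  have ha : ‖a‖ ≤ κ * t := by
    calc ‖a‖ = ‖π (χ y - χ x)‖ := by rw [map_sub]
      _ ≤ ‖π‖ * ‖χ y - χ x‖ := π.le_opNorm _
      _ ≤ ‖π‖ * (A * (t * ‖e‖)) := by gcongr
      _ = κ * t := by rw [hκ]; ring
  rw [hFχ y h3, hFχ x hx] at h2
  have hDF : ‖fderiv ℝ F (π (χ x)) a‖ ≤ A * (t * ‖e‖) + ε₁ * (κ * t) := by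
    have := norm_sub_norm_le (fderiv ℝ F (π (χ x)) a) (χ y - χ x)
    rw [norm_sub_rev (fderiv ℝ F (π (χ x)) a) (χ y - χ x)] at this
    have h4 : ε₁ * ‖a‖ ≤ ε₁ * (κ * t) := by gcongr
    linarith
  have hin : |inner ℝ g (fderiv ℝ F (π (χ x)) a)| ≤ ‖g‖ * (A * (t * ‖e‖) + ε₁ * (κ * t)) :=
    (abs_real_inner_le_norm _ _).trans (by gcongr)
  have hba : b * ‖a‖ ≤ b * κ * t := by
    rcases le_or_gt 0 b with h0 | h0
    · rw [mul_assoc]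
      gcongr
    · have h5 : b * ‖a‖ ≤ 0 := mul_nonpos_of_nonpos_of_nonneg h0.le (norm_nonneg _)
      exact h5.trans (by positivity)
  have hq2 : |q (π (χ y)) - q (π (χ x))| ≤
      ε₁ * (κ * t) + (b * κ * t + ‖g‖ * (A * (t * ‖e‖) + ε₁ * (κ * t))) := by
    have h4 : ε₁ * ‖a‖ ≤ ε₁ * (κ * t) := by gcongr
    rw [Real.norm_eq_abs] at h1
    have h5 := hb a
    rw [abs_le] at *
    constructor <;> linarith [h1.1, h1.2, h5.1, h5.2, hin.1, hin.2]
  rw [norm_smul, norm_inv, Real.norm_eq_abs, Real.norm_eq_abs, abs_of_pos ht0, hf h3, hf hx,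
    inv_mul_le_iff₀ ht0]
  refine hq2.trans ?_
  have : ε₁ * (κ * t) + (b * κ * t + ‖g‖ * (A * (t * ‖e‖) + ε₁ * (κ * t))) =
      t * (‖e‖ * (A * ‖g‖ + ‖π‖ * A * b) + ε₁ * (κ * (1 + ‖g‖))) := by rw [hκ]; ring
  rw [this]
  gcongr

end WeakGradient

section WeakGradient

variable {n : ℕ} {γ : Set (Euc (n + 1))} {w : Euc (n + 1) → ℝ} {G : Euc (n + 1) → Euc (n + 1)}
  {π : Euc (n + 1) →L[ℝ] Euc n} {F : Euc n → Euc (n + 1)} {u₀ : Euc n} {R : ℝ} {Λ : NNReal}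

theorem abs_setIntegral_comp_chart_mul_fderiv_le {V : Set (Euc n)} (hV : IsOpen V)
    {χ : Euc n → Euc (n + 1)} {A : ℝ} (hA : 0 ≤ A)
    (hχ : ∀ x ∈ V, ∀ y ∈ V, dist (χ x) (χ y) ≤ A * dist x y)
    (hFχ : ∀ x ∈ V, F (π (χ x)) = χ x) (hF : ∀ x ∈ V, DifferentiableAt ℝ F (π (χ x)))
    {q : Euc n → ℝ} (hq : ContDiff ℝ ∞ q) (hqc : HasCompactSupport q)
    (hG : IntegrableOn (fun x => ‖G (χ x)‖) V) {b : Euc n → ℝ}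
    (hbV : IntegrableOn (fun x => b (π (χ x))) V)
    (hb : ∀ x ∈ V, ∀ a, |fderiv ℝ q (π (χ x)) a - inner ℝ (G (χ x)) (fderiv ℝ F (π (χ x)) a)| ≤
      b (π (χ x)) * ‖a‖)
    {η : Euc n → ℝ} (hη : ContDiff ℝ ∞ η) (hηc : HasCompactSupport η) (hηV : tsupport η ⊆ V)
    (e : Euc n) :
    |∫ x in V, q (π (χ x)) * fderiv ℝ η x e| ≤
      ‖e‖ * ∫ x in V, (A * ‖G (χ x)‖ + ‖π‖ * A * b (π (χ x))) * |η x| := by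
  obtain ⟨K, hK⟩ := hq.lipschitzWith_of_hasCompactSupport hqc (by simp)
  have hlip : LipschitzOnWith (K * (‖π‖₊ * ⟨A, hA⟩)) (fun x => q (π (χ x))) V :=
    hK.comp_lipschitzOnWith (π.lipschitz.comp_lipschitzOnWith
      (LipschitzOnWith.of_dist_le_mul fun x hx y hy => hχ x hx y hy))
  obtain ⟨f, hf, hfV⟩ := hlip.extend_real
  obtain ⟨C, hC⟩ := hη.lipschitzWith_of_hasCompactSupport hηc (by simp)
  have hη0 (x : Euc n) (hx : x ∉ V) : η x = 0 := image_eq_zero_of_notMem_tsupport fun h => hx (hηV h)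
  have hη1 (x : Euc n) (hx : x ∉ V) : fderiv ℝ η x = 0 :=
    image_eq_zero_of_notMem_tsupport (f := fderiv ℝ η)
      fun h => hx (hηV (tsupport_fderiv_subset ℝ h))
  have h1 := hf.integral_lineDeriv_mul_eq (μ := volume) hC hηc e
  have h2 : ∫ x, lineDeriv ℝ η x (-e) * f x = -∫ x in V, q (π (χ x)) * fderiv ℝ η x e := by
    rw [← integral_neg, ← setIntegral_eq_integral_of_forall_compl_eq_zero (s := V)]
    · refine setIntegral_congr_fun hV.measurableSet fun x hx => ?_
      rw [(hη.differentiable (by simp) x).lineDeriv_eq_fderiv, ← hfV hx, map_neg]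
      ring
    · intro x hx
      rw [(hη.differentiable (by simp) x).lineDeriv_eq_fderiv, hη1 x hx]
      simp
  rw [h2, ← setIntegral_eq_integral_of_forall_compl_eq_zero (s := V)
    fun x hx => by rw [hη0 x hx, mul_zero]] at h1
  rw [← abs_neg, ← h1, ← integral_const_mul, ← Real.norm_eq_abs]
  obtain ⟨K₀, hK₀⟩ := hηc.exists_bound_of_continuous hη.continuous
  refine norm_integral_le_of_norm_le ?_ ?_
  · refine Integrable.const_mul ?_ _
    refine Integrable.mul_bdd (c := K₀) ((hG.const_mul A).add (hbV.const_mul _))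
      hη.continuous.abs.aestronglyMeasurable (ae_of_all _ fun x => ?_)
    simpa using hK₀ x
  · filter_upwards [ae_restrict_mem hV.measurableSet, ae_restrict_of_ae (hf.ae_lineDifferentiableAt e)]
      with x hx hd
    rw [norm_mul, ← mul_assoc, Real.norm_eq_abs, Real.norm_eq_abs]
    gcongr
    exact abs_lineDeriv_comp_chart_le hV hA hχ hFχ hx (hF x hx) (hq.differentiable (by simp) _)
      hfV.symm hd _ (hb x hx)

theorem hasCompactSupport_chartFun : HasCompactSupport (chartFun F u₀ R w) := by
  refine HasCompactSupport.intro (isCompact_closedBall u₀ R) fun x hx => ?_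
  exact indicator_of_notMem (fun h => hx (Metric.ball_subset_closedBall h)) _

theorem hasCompactSupport_mollify (ρ : ContDiffBump (0 : Euc n)) {u : Euc n → ℝ}
    (hu : HasCompactSupport u) : HasCompactSupport (mollify ρ u) :=
  ρ.hasCompactSupport_normed.convolution _ hu

set_option maxHeartbeats 1000000 in
theorem IsLinearChart.abs_setIntegral_mul_fderiv_le (h : IsLinearChart γ π F u₀ R Λ)
    (hR : 0 < R) (hw : MemH1 γ w G) {V : Set (Euc n)} (hV : IsOpen V) (hVfin : volume V ≠ ⊤)
    {χ : Euc n → Euc (n + 1)} {A B : ℝ} (hA : 0 ≤ A) (hB : 0 ≤ B)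
    (hχ : ∀ x ∈ V, ∀ y ∈ V, dist (χ x) (χ y) ≤ A * dist x y)
    (hχ' : ∀ x ∈ V, ∀ y ∈ V, dist x y ≤ B * dist (χ x) (χ y))
    (hball : ∀ x ∈ V, π (χ x) ∈ Metric.ball u₀ (R / 2)) (hFχ : ∀ x ∈ V, F (π (χ x)) = χ x)
    {η : Euc n → ℝ} (hη : ContDiff ℝ ∞ η) (hηc : HasCompactSupport η) (hηV : tsupport η ⊆ V)
    (e : Euc n) :
    |∫ x in V, w (χ x) * fderiv ℝ η x e| ≤ ‖e‖ * ∫ x in V, A * ‖G (χ x)‖ * |η x| := by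
  have hballR (x : Euc n) (hx : x ∈ V) : π (χ x) ∈ Metric.ball u₀ R :=
    Metric.ball_subset_ball (by linarith) (hball x hx)
  have hχc : ContinuousOn χ V :=
    (LipschitzOnWith.of_dist_le_mul (K := ⟨A, hA⟩) fun x hx y hy => hχ x hx y hy).continuousOn
  have hχγ : MapsTo χ V γ := fun x hx => by
    rw [← hFχ x hx]
    exact h.isLocalParametrization.mapsTo (hballR x hx)
  have : IsFiniteMeasure (volume.restrict V) :=
    ⟨by rw [Measure.restrict_apply_univ]; exact hVfin.lt_top⟩
  have hG : IntegrableOn (fun x => ‖G (χ x)‖) V :=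
    ((MemLp.comp_of_map_le (hχc.aemeasurable hV.measurableSet) ENNReal.ofReal_ne_top
      (map_restrict_le_smul hV.measurableSet hχc hχγ hB hχ') hw.memLp_gradient).integrable
        (by norm_num)).norm
  have hθc : ContinuousOn (fun x => π (χ x)) V := π.continuous.comp_continuousOn hχc
  have hθm : AEMeasurable (fun x => π (χ x)) (volume.restrict V) := hθc.aemeasurable hV.measurableSet
  set c : ℝ := (B * Λ) ^ n
  have hc : 0 ≤ c := by positivity
  have hθ : (volume.restrict V).map (fun x => π (χ x)) ≤ ENNReal.ofReal c • volume := by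
    have h1 := map_restrict_le_smul (N := n) (E := univ) (K := B * Λ) hV.measurableSet hθc
      (mapsTo_univ _ _) (by positivity) fun x hx y hy => by
        refine (hχ' x hx y hy).trans ?_
        rw [mul_assoc]
        gcongr
        have h2 := h.lipschitzOnWith.dist_le_mul _ (hballR x hx) _ (hballR y hy)
        rwa [hFχ x hx, hFχ y hy] at h2
    rwa [Measure.restrict_univ, EuclideanSpace.euclideanHausdorffMeasure_eq_volume] at h1
  have hcomp {q : Euc n → ℝ} (hq : Integrable q) := integrable_comp_of_map_le hθm hc hθ hq
  have hW := h.integrable_chartFun hw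
  have hWj := h.integrable_chartGrad hw
  set W := chartFun F u₀ R w
  set b : ℕ → Euc n → ℝ := fun i u =>
    ∑ j, |mollify (bumpSeq n i) (chartGrad F u₀ R G j) u - chartGrad F u₀ R G j u| with hb
  have hbj (i : ℕ) (j : Fin n) : Integrable fun u =>
      |mollify (bumpSeq n i) (chartGrad F u₀ R G j) u - chartGrad F u₀ R G j u| :=
    ((integrable_mollify _ (hWj j)).sub (hWj j)).abs
  have hbi (i : ℕ) : Integrable (b i) := integrable_finsetSum _ fun j _ => hbj i j
  have hb0 (i : ℕ) (u : Euc n) : 0 ≤ b i u := Finset.sum_nonneg fun j _ => abs_nonneg _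
  have hblim : Tendsto (fun i => ∫ u, |b i u|) atTop (𝓝 0) := by
    have h1 (i : ℕ) : ∫ u, |b i u| = ∑ j, ∫ u,
        |mollify (bumpSeq n i) (chartGrad F u₀ R G j) u - chartGrad F u₀ R G j u| := by
      simp only [abs_of_nonneg (hb0 i _)]
      exact integral_finsetSum _ fun j _ => hbj i j
    simp only [h1]
    simpa using tendsto_finsetSum Finset.univ fun j _ => tendsto_integral_abs_mollify_sub (hWj j)
  obtain ⟨K₀, hK₀⟩ := hηc.exists_bound_of_continuous hη.continuous
  have hdη : Continuous fun x => fderiv ℝ η x e := (hη.continuous_fderiv (by simp)).clm_apply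
    continuous_const
  obtain ⟨K₁, hK₁⟩ := (hηc.fderiv_apply ℝ e).exists_bound_of_continuous hdη
  have hK₀0 : 0 ≤ K₀ := (norm_nonneg _).trans (hK₀ 0)
  have hK₁0 : 0 ≤ K₁ := (norm_nonneg _).trans (hK₁ 0)
  have hGη : IntegrableOn (fun x => A * ‖G (χ x)‖ * |η x|) V :=
    Integrable.mul_bdd (c := K₀) (hG.const_mul A) hη.continuous.abs.aestronglyMeasurable
      (ae_of_all _ fun x => by simpa using hK₀ x)
  have key : ∀ᶠ i in atTop, |∫ x in V, w (χ x) * fderiv ℝ η x e| ≤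
      ‖e‖ * ((∫ x in V, A * ‖G (χ x)‖ * |η x|) + ‖π‖ * A * (K₀ * (c * ∫ u, |b i u|))) +
        K₁ * (c * ∫ u, |mollify (bumpSeq n i) W u - W u|) := by
    filter_upwards [(tendsto_rOut_bumpSeq (n := n)).eventually_lt_const (half_pos hR)] with i hi
    set q := mollify (bumpSeq n i) W with hq
    have hqi : Integrable q := integrable_mollify _ hW
    have h1 := abs_setIntegral_comp_chart_mul_fderiv_le hV hA hχ hFχ
      (fun x hx => h.differentiableAt (hballR x hx))
      (contDiff_mollify (bumpSeq n i) hW.locallyIntegrable)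
      (hasCompactSupport_mollify _ hasCompactSupport_chartFun) hG (hcomp (hbi i)).1 (fun x hx a => by
        refine (abs_fderiv_sub_le_sum a).trans (le_of_eq ?_)
        congr 1
        refine Finset.sum_congr rfl fun j _ => ?_
        rw [h.fderiv_mollify_chartFun hw _ _ j, chartGrad, indicator_of_mem (hballR x hx), hFχ x hx]
        refine fun y hy => ?_
        have h2 := hball x hx
        rw [Metric.mem_ball] at h2 ⊢
        rw [Metric.mem_closedBall] at hy
        linarith [dist_triangle y (π (χ x)) u₀]) hη hηc hηV e
    have hbη : IntegrableOn (fun x => ‖π‖ * A * b i (π (χ x)) * |η x|) V :=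
      Integrable.mul_bdd (c := K₀) ((hcomp (hbi i)).1.const_mul _)
        hη.continuous.abs.aestronglyMeasurable (ae_of_all _ fun x => by simpa using hK₀ x)
    have h2 : ∫ x in V, (A * ‖G (χ x)‖ + ‖π‖ * A * b i (π (χ x))) * |η x| ≤
        (∫ x in V, A * ‖G (χ x)‖ * |η x|) + ‖π‖ * A * (K₀ * (c * ∫ u, |b i u|)) := by
      simp only [add_mul]
      rw [integral_add hGη hbη]
      gcongr
      calc ∫ x in V, ‖π‖ * A * b i (π (χ x)) * |η x|
          ≤ ∫ x in V, ‖π‖ * A * (K₀ * |b i (π (χ x))|) := by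
            refine integral_mono hbη (((hcomp (hbi i)).1.abs.const_mul _).const_mul _) fun x => ?_
            simp only
            rw [mul_assoc, mul_comm K₀, abs_of_nonneg (hb0 i _)]
            gcongr
            exact hK₀ x
        _ = ‖π‖ * A * (K₀ * ∫ x in V, |b i (π (χ x))|) := by
            rw [integral_const_mul, integral_const_mul]
        _ ≤ _ := by
            gcongr
            exact (hcomp (hbi i)).2
    have h3 : ∫ x in V, w (χ x) * fderiv ℝ η x e = (∫ x in V, q (π (χ x)) * fderiv ℝ η x e) -
        ∫ x in V, (q (π (χ x)) - W (π (χ x))) * fderiv ℝ η x e := by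
      rw [← integral_sub]
      · refine setIntegral_congr_fun hV.measurableSet fun x hx => ?_
        rw [show W (π (χ x)) = w (χ x) by
          rw [show W = chartFun F u₀ R w from rfl, chartFun, indicator_of_mem (hballR x hx), hFχ x hx]]
        ring
      · exact Integrable.mul_bdd (c := K₁) (hcomp hqi).1 hdη.aestronglyMeasurable
          (ae_of_all _ hK₁)
      · exact Integrable.mul_bdd (c := K₁) (hcomp (hqi.sub hW)).1 hdη.aestronglyMeasurable
          (ae_of_all _ hK₁)
    have h4 : |∫ x in V, (q (π (χ x)) - W (π (χ x))) * fderiv ℝ η x e| ≤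
        K₁ * (c * ∫ u, |q u - W u|) := by
      rw [← Real.norm_eq_abs]
      have h5 := hcomp (hqi.sub hW)
      refine (norm_integral_le_of_norm_le (h5.1.abs.const_mul K₁)
        (ae_of_all _ fun x => ?_)).trans ?_
      · rw [norm_mul, mul_comm]
        exact mul_le_mul_of_nonneg_right (hK₁ x) (norm_nonneg _)
      · rw [integral_const_mul]
        gcongr
        exact h5.2
    rw [h3]
    refine (abs_sub _ _).trans ?_
    gcongr
    exact h1.trans (by gcongr)
  refine ge_of_tendsto ?_ key
  have h5 : Tendsto (fun i => ‖e‖ * ((∫ x in V, A * ‖G (χ x)‖ * |η x|) +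
      ‖π‖ * A * (K₀ * (c * ∫ u, |b i u|))) + K₁ * (c * ∫ u, |mollify (bumpSeq n i) W u - W u|)) atTop
      (𝓝 (‖e‖ * ((∫ x in V, A * ‖G (χ x)‖ * |η x|) + ‖π‖ * A * (K₀ * (c * 0))) + K₁ * (c * 0))) :=
    ((((hblim.const_mul c).const_mul K₀).const_mul (‖π‖ * A)).const_add _ |>.const_mul _).add
      (((tendsto_integral_abs_mollify_sub hW).const_mul c).const_mul K₁)
  simpa using h5

end WeakGradient

section WeakGradient

variable {n : ℕ} {γ : Set (Euc (n + 1))} {w : Euc (n + 1) → ℝ} {G : Euc (n + 1) → Euc (n + 1)}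

theorem MemH1.exists_isWeakUpperGradient_comp (hγ : IsCompact γ) (hγ' : IsC2Hypersurface γ)
    (hw : MemH1 γ w G) {Ω : Set (Euc n)} (hΩ : IsOpen Ω) {χ : Euc n → Euc (n + 1)} {A B : ℝ}
    (hA : 0 ≤ A) (hB : 0 ≤ B) (hχγ : MapsTo χ Ω γ)
    (hχ : ∀ x ∈ Ω, ∀ y ∈ Ω, dist (χ x) (χ y) ≤ A * dist x y)
    (hχ' : ∀ x ∈ Ω, ∀ y ∈ Ω, dist x y ≤ B * dist (χ x) (χ y)) :
    ∃ ε > 0, ∀ u g : Euc n → ℝ, (∀ᵐ x ∂volume.restrict Ω, u x = w (χ x)) →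
      (∀ᵐ x ∂volume.restrict Ω, g x = A * ‖G (χ x)‖) → IsWeakUpperGradient Ω u g ε := by
  choose π F R Λ hR hchart hinv using fun y : γ => hγ'.exists_chart y.2
  have hev (y : γ) : ∀ᶠ z in 𝓝 y.1, (z ∈ γ → F y (π y z) = z) ∧
      π y z ∈ Metric.ball (π y y) (R y / 2) :=
    (hinv y).and ((π y).continuous.continuousAt.eventually
      (Metric.ball_mem_nhds _ (half_pos (hR y))))
  obtain ⟨δ, hδ, hcov⟩ := lebesgue_number_lemma_of_metric hγ
    (c := fun y : γ => interior {z | (z ∈ γ → F y (π y z) = z) ∧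
      π y z ∈ Metric.ball (π y y) (R y / 2)}) (fun _ => isOpen_interior)
    fun y hy => mem_iUnion.2 ⟨⟨y, hy⟩, mem_interior_iff_mem_nhds.2 (hev ⟨y, hy⟩)⟩
  have hA1 : 0 < A + 1 := by linarith
  set ε := δ / (4 * (A + 1)) with hε
  have hε0 : 0 < ε := by positivity
  refine ⟨ε, hε0, fun u g hu hg x η hη hηc hηΩ hηx e => ?_⟩
  set V := Ω ∩ Metric.ball x (2 * ε) with hVdef
  have hV : IsOpen V := hΩ.inter Metric.isOpen_ball
  have hVΩ : V ⊆ Ω := inter_subset_left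
  have hηV : tsupport η ⊆ V :=
    subset_inter hηΩ (hηx.trans (Metric.closedBall_subset_ball (by linarith)))
  have hη0 (y : Euc n) (hy : y ∉ V) : η y = 0 := image_eq_zero_of_notMem_tsupport fun h => hy (hηV h)
  have hη1 (y : Euc n) (hy : y ∉ V) : fderiv ℝ η y = 0 :=
    image_eq_zero_of_notMem_tsupport (f := fderiv ℝ η)
      fun h => hy (hηV (tsupport_fderiv_subset ℝ h))
  have h1 : ∫ y, u y * fderiv ℝ η y e = ∫ y in V, w (χ y) * fderiv ℝ η y e := by
    rw [← setIntegral_eq_integral_of_forall_compl_eq_zero (s := V)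
      fun y hy => by rw [hη1 y hy]; simp]
    refine setIntegral_congr_ae hV.measurableSet ?_
    filter_upwards [(ae_restrict_iff' hΩ.measurableSet).1 hu] with y hy hyV
    rw [hy (hVΩ hyV)]
  have h2 : ∫ y, g y * |η y| = ∫ y in V, A * ‖G (χ y)‖ * |η y| := by
    rw [← setIntegral_eq_integral_of_forall_compl_eq_zero (s := V)
      fun y hy => by rw [hη0 y hy]; simp]
    refine setIntegral_congr_ae hV.measurableSet ?_
    filter_upwards [(ae_restrict_iff' hΩ.measurableSet).1 hg] with y hy hyV
    rw [hy (hVΩ hyV)]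
  rw [h1, h2]
  rcases V.eq_empty_or_nonempty with h0 | ⟨x₁, hx₁⟩
  · simp [h0]
  · obtain ⟨y, hy⟩ := hcov (χ x₁) (hχγ (hVΩ hx₁))
    have hmem (z : Euc n) (hz : z ∈ V) := interior_subset (hy (show χ z ∈ Metric.ball (χ x₁) δ by
      rw [Metric.mem_ball]
      have h1 : dist z x₁ ≤ 4 * ε := by
        have h2 : dist z x < 2 * ε := hz.2
        have h3 : dist x₁ x < 2 * ε := hx₁.2
        linarith [dist_triangle_right z x₁ x]
      have h2 : (A + 1) * (4 * ε) = δ := by rw [hε]; field_simp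
      calc dist (χ z) (χ x₁) ≤ A * dist z x₁ := hχ z (hVΩ hz) x₁ (hVΩ hx₁)
        _ ≤ A * (4 * ε) := by gcongr
        _ < δ := by linarith))
    exact (hchart y).abs_setIntegral_mul_fderiv_le (hR y) hw hV
      ((measure_mono inter_subset_right).trans_lt measure_ball_lt_top).ne hA hB
      (fun a ha b hb => hχ a (hVΩ ha) b (hVΩ hb)) (fun a ha b hb => hχ' a (hVΩ ha) b (hVΩ hb))
      (fun z hz => (hmem z hz).2) (fun z hz => (hmem z hz).1 (hχγ (hVΩ hz))) hη hηc hηV e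

end WeakGradient

/-! ### Perturbation of the argument of a Sobolev function on a hypersurface -/

section Perturbation

variable {n : ℕ} {γ : Set (Euc (n + 1))} {w : Euc (n + 1) → ℝ} {G : Euc (n + 1) → Euc (n + 1)}

theorem eLpNorm_two_sq {α E : Type*} [MeasurableSpace α] [NormedAddCommGroup E] (μ : Measure α)
    (f : α → E) : eLpNorm f 2 μ ^ 2 = ∫⁻ x, ‖f x‖ₑ ^ 2 ∂μ := by
  rw [eLpNorm_eq_lintegral_rpow_enorm_toReal (by norm_num) (by norm_num), ← ENNReal.rpow_natCast,
    ← ENNReal.rpow_mul]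
  norm_num

theorem eLpNorm_two_sq_comp_le {α β E : Type*} [MeasurableSpace α] [MeasurableSpace β]
    [NormedAddCommGroup E] {μ : Measure α} {ν : Measure β} {f : α → β} (hf : AEMeasurable f μ)
    {c : ℝ≥0∞} (hle : μ.map f ≤ c • ν) {q : β → E}
    (hq : AEStronglyMeasurable q (μ.map f)) :
    eLpNorm (fun x => q (f x)) 2 μ ^ 2 ≤ c * eLpNorm q 2 ν ^ 2 := by
  rw [eLpNorm_two_sq, eLpNorm_two_sq, ← smul_eq_mul c, ← lintegral_smul_measure,
    ← lintegral_map' (f := fun y => ‖q y‖ₑ ^ 2) (hq.enorm.pow_const 2) hf]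
  exact lintegral_mono' hle le_rfl

theorem MemH1.memLp_sub_comp_of_param (hγ : IsCompact γ) (hγ' : IsC2Hypersurface γ)
    (hw : MemH1 γ w G) {T Q : Set (Euc n)} (hT : IsCompact T) (hQ : IsCompact Q) (hc : Convex ℝ Q)
    (hTQ : T ⊆ Q) {χ : Euc n → Euc (n + 1)} {A B : ℝ} (hA : 0 ≤ A) (hB : 0 ≤ B)
    (hχγ : MapsTo χ Q γ) (hχ : ∀ x ∈ Q, ∀ y ∈ Q, dist (χ x) (χ y) ≤ A * dist x y)
    (hχ' : ∀ x ∈ Q, ∀ y ∈ Q, dist x y ≤ B * dist (χ x) (χ y))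
    {φ : Euc n → Euc n} (hφ : ContinuousOn φ T) (hφQ : MapsTo φ T Q) {M : ℝ≥0∞} (hM : M ≠ ⊤)
    (harea : ∀ N, MeasurableSet N → volume (T ∩ φ ⁻¹' N) ≤ M * volume N) {r : ℝ} (hr : 0 ≤ r)
    (hclose : ∀ x ∈ T, dist (φ x) x ≤ r) :
    MemLp (fun x => w (χ x) - w (χ (φ x))) 2 (volume.restrict T) ∧
      eLpNorm (fun x => w (χ x) - w (χ (φ x))) 2 (volume.restrict T) ^ 2 ≤
        2 ^ (2 * n + 5) * (1 + M) * ENNReal.ofReal (2 * r) ^ 2 *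
          (ENNReal.ofReal A ^ 2 * eLpNorm (fun x => G (χ x)) 2 (volume.restrict Q) ^ 2) := by
  have hχc : ContinuousOn χ Q :=
    (LipschitzOnWith.of_dist_le_mul (K := ⟨A, hA⟩) fun x hx y hy => hχ x hx y hy).continuousOn
  have hχm := hχc.aemeasurable (μ := volume) hQ.measurableSet
  have hmap := map_restrict_le_smul hQ.measurableSet hχc hχγ hB hχ'
  have hwχ : MemLp (fun x => w (χ x)) 2 (volume.restrict Q) :=
    MemLp.comp_of_map_le hχm ENNReal.ofReal_ne_top hmap hw.memLp
  have hGχ : MemLp (fun x => G (χ x)) 2 (volume.restrict Q) :=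
    MemLp.comp_of_map_le hχm ENNReal.ofReal_ne_top hmap hw.memLp_gradient
  have hφm := hφ.aemeasurable (μ := volume) hT.measurableSet
  have hφmap : (volume.restrict T).map φ ≤ M • volume.restrict Q := by
    refine Measure.le_iff.2 fun N hN => ?_
    rw [Measure.map_apply_of_aemeasurable hφm hN, Measure.restrict_apply' hT.measurableSet,
      Measure.smul_apply, Measure.restrict_apply hN, smul_eq_mul]
    refine le_trans (measure_mono ?_) (harea _ (hN.inter hQ.measurableSet))
    exact fun x hx => ⟨hx.2, hx.1, hφQ hx.2⟩
  have hmem : MemLp (fun x => w (χ x) - w (χ (φ x))) 2 (volume.restrict T) :=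
    (hwχ.mono_measure (Measure.restrict_mono hTQ le_rfl)).sub
      (MemLp.comp_of_map_le hφm hM hφmap hwχ)
  refine ⟨hmem, ?_⟩
  rcases hr.eq_or_lt with rfl | hr
  · rw [eLpNorm_congr_ae (g := fun _ => (0 : ℝ))]
    · simp
    · filter_upwards [ae_restrict_mem hT.measurableSet] with x hx
      rw [dist_le_zero.1 (hclose x hx), sub_self]
  set Ω := interior Q with hΩdef
  have hΩQ : Ω ⊆ Q := interior_subset
  have hΩ : IsOpen Ω := isOpen_interior
  have hfr : volume (Q \ Ω) = 0 := measure_mono_null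
    (sdiff_subset_sdiff_left subset_closure) (hc.addHaar_frontier volume)
  obtain ⟨ε, hε, hup⟩ := hw.exists_isWeakUpperGradient_comp hγ hγ' hΩ hA hB
    (hχγ.mono hΩQ Subset.rfl) (fun x hx y hy => hχ x (hΩQ hx) y (hΩQ hy))
    fun x hx y hy => hχ' x (hΩQ hx) y (hΩQ hy)
  have hwΩ := hwχ.mono_measure (Measure.restrict_mono hΩQ le_rfl)
  have hGΩ := hGχ.mono_measure (Measure.restrict_mono hΩQ le_rfl)
  obtain ⟨u₀, hu₀, hu₀w⟩ := hwΩ.1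
  obtain ⟨g₀, hg₀, hg₀G⟩ := hGΩ.1
  set u := Ω.indicator u₀ with hu
  set g := Ω.indicator fun x => A * ‖g₀ x‖ with hg
  have hum : Measurable u := hu₀.measurable.indicator hΩ.measurableSet
  have hgm : Measurable g := (hg₀.norm.measurable.const_mul A).indicator hΩ.measurableSet
  have huw : ∀ᵐ x ∂volume.restrict Ω, u x = w (χ x) := by
    filter_upwards [hu₀w, ae_restrict_mem hΩ.measurableSet] with x hx hxΩ
    rw [hu, indicator_of_mem hxΩ, hx]
  have hgG : ∀ᵐ x ∂volume.restrict Ω, g x = A * ‖G (χ x)‖ := by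
    filter_upwards [hg₀G, ae_restrict_mem hΩ.measurableSet] with x hx hxΩ
    rw [hg, indicator_of_mem hxΩ, hx]
  have hfin : IsFiniteMeasure (volume.restrict Ω) :=
    ⟨by rw [Measure.restrict_apply_univ]; exact (measure_mono hΩQ).trans_lt hQ.measure_lt_top⟩
  have hui : LocallyIntegrable u := by
    refine Integrable.locallyIntegrable ?_
    rw [hu, integrable_indicator_iff hΩ.measurableSet]
    exact (hwΩ.integrable (by norm_num)).congr hu₀w
  set T' := (T ∩ Ω) ∩ (T ∩ φ ⁻¹' Ω) with hT'def
  have hT'T : T' ⊆ T := fun x hx => hx.1.1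
  have hT' : MeasurableSet T' := (hT.measurableSet.inter hΩ.measurableSet).inter
    (measurableSet_inter_preimage hT.measurableSet hφ hΩ.measurableSet)
  have hnull (N : Set (Euc n)) (hN : volume N = 0) : volume (T ∩ φ ⁻¹' N) = 0 := by
    have h1 := harea _ (measurableSet_toMeasurable volume N)
    rw [measure_toMeasurable, hN, mul_zero] at h1
    exact measure_mono_null (inter_subset_inter_right T
      (preimage_mono (subset_toMeasurable volume N))) (le_antisymm h1 bot_le)
  have hTT' : T =ᵐ[volume] T' := by
    refine (ae_le_set.2 ?_).antisymm hT'T.eventuallyLE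
    refine measure_mono_null (fun x hx => ?_) (measure_union_null hfr (hnull _ hfr))
    by_cases h1 : x ∈ Ω
    · exact Or.inr ⟨hx.1, hφQ hx.1, fun h2 => hx.2 ⟨⟨hx.1, h1⟩, hx.1, h2⟩⟩
    · exact Or.inl ⟨hTQ hx.1, h1⟩
  classical
  set φ' : Euc n → Euc n := T'.piecewise φ id with hφ'
  have hφ'm : Measurable φ' :=
    ContinuousOn.measurable_piecewise (hφ.mono hT'T) continuous_id.continuousOn hT'
  have hφ'φ : EqOn φ' φ T' := fun x hx => piecewise_eq_of_mem _ _ _ hx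
  have hmain := (hup u g huw hgG).lintegral_sub_comp_le hε hui hum hgm
    (fun y => indicator_nonneg (fun x _ => by positivity) y) hΩ hc.interior
    (T := T') (fun x hx => hx.1.2) hφ'm (fun x hx => by rw [hφ'φ hx]; exact hx.2.2) (M := M)
    (fun N hN => by
      refine le_trans (measure_mono fun x hx => ?_) (harea N hN)
      exact ⟨hT'T hx.1, by rw [mem_preimage, ← hφ'φ hx.1]; exact hx.2⟩)
    (r := 2 * r) (by positivity)
    (fun x hx => by rw [hφ'φ hx]; linarith [hclose x (hT'T hx)])
  have hbad : volume {y | y ∈ Ω ∧ u y ≠ w (χ y)} = 0 := by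
    have := (ae_restrict_iff' hΩ.measurableSet).1 huw
    rw [ae_iff] at this
    simpa using this
  calc eLpNorm (fun x => w (χ x) - w (χ (φ x))) 2 (volume.restrict T) ^ 2
      = ∫⁻ x in T', ‖u x - u (φ' x)‖ₑ ^ 2 := by
        rw [eLpNorm_two_sq, Measure.restrict_congr_set hTT']
        refine lintegral_congr_ae ((ae_restrict_iff' hT').2 ?_)
        filter_upwards [measure_eq_zero_iff_ae_notMem.1 hbad,
          measure_eq_zero_iff_ae_notMem.1 (hnull _ hbad)] with x h1 h2 hx
        have h3 : u x = w (χ x) := by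
          by_contra h3
          exact h1 ⟨hx.1.2, h3⟩
        have h4 : u (φ x) = w (χ (φ x)) := by
          by_contra h4
          exact h2 ⟨hT'T hx, hx.2.2, h4⟩
        rw [hφ'φ hx, h3, h4]
    _ ≤ _ := hmain
    _ ≤ _ := by
        gcongr
        rw [← Real.enorm_of_nonneg hA, eLpNorm_two_sq, ← lintegral_const_mul' _ _ (by finiteness)]
        refine (lintegral_congr_ae ?_).trans_le (lintegral_mono_set hΩQ)
        filter_upwards [hgG] with x hx
        rw [hx, enorm_mul, mul_pow, enorm_norm]

theorem MemH1.memLp_sub_comp (hγ : IsCompact γ) (hγ' : IsC2Hypersurface γ)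
    (hw : MemH1 γ w G) {T Q : Set (Euc n)} (hT : IsCompact T) (hQ : IsCompact Q) (hc : Convex ℝ Q)
    (hTQ : T ⊆ Q) {χ : Euc n → Euc (n + 1)} {A B : ℝ} (hA : 0 ≤ A) (hB : 0 ≤ B)
    (hχγ : MapsTo χ Q γ) (hχ : ∀ x ∈ Q, ∀ y ∈ Q, dist (χ x) (χ y) ≤ A * dist x y)
    (hχ' : ∀ x ∈ Q, ∀ y ∈ Q, dist x y ≤ B * dist (χ x) (χ y))
    {φ : Euc n → Euc n} (hφ : ContinuousOn φ T) (hφQ : MapsTo φ T Q) {M : ℝ≥0∞} (hM : M ≠ ⊤)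
    (harea : ∀ N, MeasurableSet N → volume (T ∩ φ ⁻¹' N) ≤ M * volume N) {r : ℝ} (hr : 0 ≤ r)
    (hclose : ∀ x ∈ T, dist (φ x) x ≤ r) {ψ : Euc (n + 1) → Euc (n + 1)}
    (hψ : ∀ x ∈ T, ψ (χ x) = χ (φ x)) :
    MemLp (fun y => w y - w (ψ y)) 2 ((surfaceMeasure γ).restrict (χ '' T)) ∧
      eLpNorm (fun y => w y - w (ψ y)) 2 ((surfaceMeasure γ).restrict (χ '' T)) ^ 2 ≤
        ENNReal.ofReal (A ^ n) * (2 ^ (2 * n + 5) * (1 + M) * ENNReal.ofReal (2 * r) ^ 2 *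
          (ENNReal.ofReal A ^ 2 * (ENNReal.ofReal (B ^ n) *
            eLpNorm G 2 ((surfaceMeasure γ).restrict (χ '' Q)) ^ 2))) := by
  obtain ⟨h1, h2⟩ := hw.memLp_sub_comp_of_param hγ hγ' hT hQ hc hTQ hA hB hχγ hχ hχ' hφ hφQ hM
    harea hr hclose
  have hχc : ContinuousOn χ Q :=
    (LipschitzOnWith.of_dist_le_mul (K := ⟨A, hA⟩) fun x hx y hy => hχ x hx y hy).continuousOn
  have hσ {s : Set (Euc n)} (hs : s ⊆ Q) (hs' : IsCompact s) :
      (surfaceMeasure γ).restrict (χ '' s) =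
        (Measure.euclideanHausdorffMeasure n).restrict (χ '' s) := by
    rw [surfaceMeasure, Measure.restrict_restrict
      (hs'.image_of_continuousOn (hχc.mono hs)).measurableSet,
      inter_eq_self_of_subset_left ((hχγ.mono hs Subset.rfl).image_subset)]
  have hinj : InjOn χ T := fun x hx y hy hxy => by
    have h3 := hχ' x (hTQ hx) y (hTQ hy)
    rw [hxy, dist_self, mul_zero] at h3
    exact dist_le_zero.1 h3
  have hinv : ∀ x ∈ T, Function.invFunOn χ T (χ x) = x := fun x hx => hinj.leftInvOn_invFunOn hx
  set κ := Function.invFunOn χ T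
  have hTm : MeasurableSet (χ '' T) := (hT.image_of_continuousOn (hχc.mono hTQ)).measurableSet
  have hκ : LipschitzOnWith ⟨B, hB⟩ κ (χ '' T) := by
    refine LipschitzOnWith.of_dist_le_mul ?_
    rintro _ ⟨x, hx, rfl⟩ _ ⟨y, hy, rfl⟩
    rw [hinv x hx, hinv y hy]
    exact hχ' x (hTQ hx) y (hTQ hy)
  have hκm := hκ.continuousOn.aemeasurable (μ := Measure.euclideanHausdorffMeasure n) hTm
  have hκmap : ((Measure.euclideanHausdorffMeasure n).restrict (χ '' T)).map κ ≤
      ENNReal.ofReal (A ^ n) • volume.restrict T := by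
    refine Measure.le_iff.2 fun N hN => ?_
    rw [Measure.map_apply_of_aemeasurable hκm hN, Measure.restrict_apply' hTm,
      Measure.smul_apply, Measure.restrict_apply hN, smul_eq_mul,
      ← EuclideanSpace.euclideanHausdorffMeasure_eq_volume]
    refine le_trans (measure_mono ?_) (euclideanHausdorffMeasure_image_le (f := χ) hA
      fun x hx y hy => hχ x (hTQ hx.2) y (hTQ hy.2))
    rintro _ ⟨hyN, x, hx, rfl⟩
    rw [mem_preimage, hinv x hx] at hyN
    exact ⟨x, ⟨hyN, hx⟩, rfl⟩
  have heq : (fun y => w y - w (ψ y))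
      =ᵐ[(Measure.euclideanHausdorffMeasure n).restrict (χ '' T)]
        fun y => w (χ (κ y)) - w (χ (φ (κ y))) := by
    filter_upwards [ae_restrict_mem hTm]
    rintro _ ⟨x, hx, rfl⟩
    rw [hinv x hx, hψ x hx]
  rw [hσ hTQ hT, hσ Subset.rfl hQ, eLpNorm_congr_ae heq, memLp_congr_ae heq]
  refine ⟨MemLp.comp_of_map_le hκm ENNReal.ofReal_ne_top hκmap h1, ?_⟩
  refine (eLpNorm_two_sq_comp_le hκm hκmap
    (((h1.smul_measure ENNReal.ofReal_ne_top).mono_measure hκmap).1)).trans ?_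
  gcongr
  refine h2.trans ?_
  gcongr
  have hmap := map_restrict_le_smul hQ.measurableSet hχc (mapsTo_image χ Q) hB hχ'
  refine eLpNorm_two_sq_comp_le (hχc.aemeasurable hQ.measurableSet) hmap ?_
  refine AEStronglyMeasurable.mono_ac ?_ hw.memLp_gradient.1
  refine (Measure.absolutelyContinuous_of_le_smul hmap).trans ?_
  exact (Measure.restrict_mono hχγ.image_subset le_rfl).absolutelyContinuous

end Perturbation

/-! ### Elements of a parametric surface -/

namespace ParametricSurface

variable {n m k : ℕ} {patch : Fin m → RefPatch n} {S : ParametricSurface patch}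
  {cbar c L C₁ C₂ : ℝ}

variable (S) in
theorem isCompact_refPatch (T : S.Elem) : IsCompact (S.refPatch T) :=
  (patch (S.patchIndex T)).finitePure.finite.isCompact_biUnion fun s _ =>
    s.finite_toSet.isCompact_convexHull (𝕜 := ℝ)

variable (S) in
theorem refSimplex_subset_refPatch (T : S.Elem) : refSimplex n ⊆ S.refPatch T :=
  (patch (S.patchIndex T)).complex.convexHull_subset_space
    (patch (S.patchIndex T)).refVertices_mem.1

variable (S) in
theorem macroPatch_subset_space (T : S.Elem) : macroPatch S.mesh T ⊆ S.mesh.space :=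
  iUnion₂_subset fun _ hT' => S.mesh.convexHull_subset_space hT'.1.1

variable (S) in
theorem mapsTo_Xbar (T : S.Elem) : MapsTo (S.Xbar T) (S.refPatch T) S.mesh.space :=
  (S.bijOn_Xbar T).mapsTo.mono_right (S.macroPatch_subset_space T)

variable (S) in
theorem injOn_χ (T : S.Elem) : InjOn (S.χ T) (S.refPatch T) :=
  S.bijOn_P.injOn.comp (S.bijOn_Xbar T).injOn (S.mapsTo_Xbar T)

variable (S) in
theorem mapsTo_χ (T : S.Elem) : MapsTo (S.χ T) (S.refPatch T) S.γ :=
  S.bijOn_P.mapsTo.comp (S.mapsTo_Xbar T)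

variable (S) in
theorem image_χ_refPatch (T : S.Elem) : S.χ T '' S.refPatch T = S.curvedPatch T := by
  rw [χ, image_comp, curvedPatch, ← (S.bijOn_Xbar T).image_eq, refPatch]

variable (S) in
theorem image_χ_refSimplex (T : S.Elem) : S.χ T '' refSimplex n = S.curvedElem T := by
  rw [χ, image_comp, S.image_refSimplex, curvedElem, flatElem]

variable (S) in
theorem injOn_Xbar (T : S.Elem) : InjOn (S.Xbar T) (refSimplex n) :=
  (S.bijOn_Xbar T).injOn.mono (S.refSimplex_subset_refPatch T)

variable (S) in
theorem diam_flatElem_pos (hn : 1 ≤ n) (T : S.Elem) : 0 < Metric.diam (S.flatElem T) := by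
  have h0 := zero_mem_refSimplex n
  have h1 := single_mem_refSimplex (⟨0, hn⟩ : Fin n)
  have hne : (0 : Euc n) ≠ EuclideanSpace.single ⟨0, hn⟩ (1 : ℝ) := fun h => by
    have h2 := congrArg norm h
    simp at h2
  rw [flatElem, ← S.image_refSimplex]
  have hb : Bornology.IsBounded (S.Xbar T '' refSimplex n) := by
    rw [S.image_refSimplex]
    exact (T.1.finite_toSet.isCompact_convexHull (𝕜 := ℝ)).isBounded
  exact (dist_pos.2 ((S.injOn_Xbar T).ne h0 h1 hne)).trans_le
    (Metric.dist_le_diam_of_mem hb (mem_image_of_mem _ h0) (mem_image_of_mem _ h1))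

variable (S) in
theorem h_nonneg (T : S.Elem) : 0 ≤ S.h T := Real.rpow_nonneg ENNReal.toReal_nonneg _

theorem StandingAssumptions.dist_χ_le (hS : S.StandingAssumptions k cbar c L C₁ C₂) (T : S.Elem) :
    ∀ x ∈ S.refPatch T, ∀ y ∈ S.refPatch T, dist (S.χ T x) (S.χ T y) ≤ L * S.h T * dist x y :=
  fun x hx y hy => by
    rw [dist_eq_norm, dist_eq_norm]
    exact (hS.biLipschitz T x hx y hy).2

theorem StandingAssumptions.h_pos (hS : S.StandingAssumptions k cbar c L C₁ C₂) (hn : 1 ≤ n)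
    (T : S.Elem) : 0 < S.h T := by
  refine (S.h_nonneg T).lt_of_ne fun h => ?_
  have h0 := S.refSimplex_subset_refPatch T (zero_mem_refSimplex n)
  have h1 := S.refSimplex_subset_refPatch T (single_mem_refSimplex (⟨0, hn⟩ : Fin n))
  have h2 := hS.dist_χ_le T _ h0 _ h1
  rw [← h, mul_zero, zero_mul] at h2
  have h3 := congrArg norm (S.injOn_χ T h0 h1 (dist_le_zero.1 h2))
  simp at h3

theorem StandingAssumptions.dist_le_dist_χ (hS : S.StandingAssumptions k cbar c L C₁ C₂)
    (hn : 1 ≤ n) (hL : 1 ≤ L) (T : S.Elem) : ∀ x ∈ S.refPatch T, ∀ y ∈ S.refPatch T,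
      dist x y ≤ L / S.h T * dist (S.χ T x) (S.χ T y) := fun x hx y hy => by
  have hh := hS.h_pos hn T
  have h1 := (hS.biLipschitz T x hx y hy).1
  rw [dist_eq_norm, dist_eq_norm]
  calc ‖x - y‖ = L / S.h T * (S.h T * L⁻¹ * ‖x - y‖) := by field_simp
    _ ≤ _ := by gcongr

theorem StandingAssumptions.dist_Xbar_le (hS : S.StandingAssumptions k cbar c L C₁ C₂)
    (T : S.Elem) : ∀ x ∈ refSimplex n, ∀ y ∈ refSimplex n,
      dist (S.Xbar T x) (S.Xbar T y) ≤ cbar * Metric.diam (S.flatElem T) * dist x y := by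
  obtain ⟨A, hA⟩ := S.affine_Xbar T _ (patch (S.patchIndex T)).refVertices_mem
  obtain ⟨z, hz⟩ := nonempty_interior_refSimplex n
  intro x hx y hy
  have h1 : HasFDerivAt (S.Xbar T) (LinearMap.toContinuousLinearMap A.linear) z := by
    have h2 : HasFDerivAt A (LinearMap.toContinuousLinearMap A.linear) z := by
      have h3 : (A : Euc n → Euc (n + 1)) =
          fun x => LinearMap.toContinuousLinearMap A.linear x + A 0 := by
        ext1 x
        simp [A.decomp']
      rw [h3]
      exact (LinearMap.toContinuousLinearMap A.linear).hasFDerivAt.add_const _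
    refine h2.congr_of_eventuallyEq ?_
    filter_upwards [mem_interior_iff_mem_nhds.1 hz] with x hx using hA hx
  have h4 := (hS.shapeRegular_flat T z hz (x - y)).2
  rw [h1.fderiv] at h4
  rw [hA hx, hA hy, dist_eq_norm, dist_eq_norm, ← vsub_eq_sub (A x), ← A.linearMap_vsub]
  exact h4

theorem StandingAssumptions.h_le (hS : S.StandingAssumptions k cbar c L C₁ C₂) (hn : 1 ≤ n)
    (hcbar : 0 < cbar) (T : S.Elem) :
    S.h T ≤ (volume (refSimplex n)).toReal ^ (1 / n : ℝ) * cbar * Metric.diam (S.flatElem T) := by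
  set d := Metric.diam (S.flatElem T) with hd
  have hd0 : 0 ≤ d := Metric.diam_nonneg
  have hfin : volume (refSimplex n) ≠ ⊤ := (isCompact_refSimplex n).measure_lt_top.ne
  have h1 := euclideanHausdorffMeasure_image_le (n := n) (f := S.Xbar T) (s := refSimplex n)
    (K := cbar * d) (by positivity) (hS.dist_Xbar_le T)
  rw [EuclideanSpace.euclideanHausdorffMeasure_eq_volume, S.image_refSimplex] at h1
  have h2 := ENNReal.toReal_mono (by finiteness) h1
  rw [ENNReal.toReal_mul, ENNReal.toReal_ofReal (by positivity)] at h2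
  have hn0 : (n : ℕ) ≠ 0 := by omega
  calc S.h T ≤ ((cbar * d) ^ n * (volume (refSimplex n)).toReal) ^ (1 / n : ℝ) :=
        Real.rpow_le_rpow ENNReal.toReal_nonneg h2 (by positivity)
    _ = _ := by
        rw [Real.mul_rpow (by positivity) (by positivity), one_div,
          Real.pow_rpow_inv_natCast (by positivity) hn0]
        ring

/-! ### The closest point projection in reference coordinates -/

variable (S) in
/-- The map `P_d ∘ P⁻¹` in the coordinates of the reference patch. -/
def refMap (k : ℕ) (T : S.Elem) (x : Euc n) : Euc n :=
  Function.invFunOn (S.χ T) (S.refPatch T) (closestPoint S.γ (S.X k T x))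

variable (S) in
theorem X_mem_Γ (T : S.Elem) {x : Euc n} (hx : x ∈ refSimplex n) : S.X k T x ∈ S.Γ k :=
  mem_iUnion.2 ⟨T, x, hx, rfl⟩

theorem StandingAssumptions.isClosestPoint (hS : S.StandingAssumptions k cbar c L C₁ C₂)
    (T : S.Elem) {x : Euc n} (hx : x ∈ refSimplex n) :
    IsClosestPoint S.γ (S.X k T x) (closestPoint S.γ (S.X k T x)) :=
  isClosestPoint_closestPoint (hS.unique_closest _ (S.X_mem_Γ T hx))

variable (S) in
theorem ψ_χ (T : S.Elem) {x : Euc n} (hx : x ∈ refSimplex n) :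
    S.ψ k T (S.χ T x) = closestPoint S.γ (S.X k T x) := by
  rw [ψ, invLift, ((S.injOn_χ T).mono (S.refSimplex_subset_refPatch T)).leftInvOn_invFunOn hx]

theorem StandingAssumptions.exists_χ_eq (hS : S.StandingAssumptions k cbar c L C₁ C₂)
    (T : S.Elem) {x : Euc n} (hx : x ∈ refSimplex n) :
    ∃ y ∈ S.refPatch T, S.χ T y = closestPoint S.γ (S.X k T x) := by
  have h := hS.mismatch T (x := S.χ T x) (by
    rw [← S.image_χ_refSimplex]
    exact mem_image_of_mem _ hx)
  rwa [S.ψ_χ T hx, ← S.image_χ_refPatch] at h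

theorem StandingAssumptions.mapsTo_refMap (hS : S.StandingAssumptions k cbar c L C₁ C₂)
    (T : S.Elem) : MapsTo (S.refMap k T) (refSimplex n) (S.refPatch T) :=
  fun _ hx => Function.invFunOn_mem (hS.exists_χ_eq T hx)

theorem StandingAssumptions.χ_refMap (hS : S.StandingAssumptions k cbar c L C₁ C₂)
    (T : S.Elem) {x : Euc n} (hx : x ∈ refSimplex n) :
    S.χ T (S.refMap k T x) = closestPoint S.γ (S.X k T x) :=
  Function.invFunOn_eq (hS.exists_χ_eq T hx)

theorem StandingAssumptions.continuousOn_closestPoint_X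
    (hS : S.StandingAssumptions k cbar c L C₁ C₂) (T : S.Elem) :
    ContinuousOn (fun x => closestPoint S.γ (S.X k T x)) (refSimplex n) :=
  (continuousOn_closestPoint S.isCompact hS.unique_closest).comp
    (continuous_lagrangeInterp _).continuousOn fun _ hx => S.X_mem_Γ T hx

theorem StandingAssumptions.dist_refMap_le_dist (hS : S.StandingAssumptions k cbar c L C₁ C₂)
    (hn : 1 ≤ n) (hL : 1 ≤ L) (T : S.Elem) {x y : Euc n} (hx : x ∈ refSimplex n)
    (hy : y ∈ refSimplex n) : dist (S.refMap k T x) (S.refMap k T y) ≤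
      L / S.h T * dist (closestPoint S.γ (S.X k T x)) (closestPoint S.γ (S.X k T y)) := by
  rw [← hS.χ_refMap T hx, ← hS.χ_refMap T hy]
  exact hS.dist_le_dist_χ hn hL T _ (hS.mapsTo_refMap T hx) _ (hS.mapsTo_refMap T hy)

theorem StandingAssumptions.continuousOn_refMap (hS : S.StandingAssumptions k cbar c L C₁ C₂)
    (hn : 1 ≤ n) (hL : 1 ≤ L) (T : S.Elem) : ContinuousOn (S.refMap k T) (refSimplex n) := by
  intro x hx
  have h1 := (hS.continuousOn_closestPoint_X T x hx).dist
    (continuousWithinAt_const (b := closestPoint S.γ (S.X k T x)))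
  have h2 := Tendsto.const_mul (L / S.h T) h1
  rw [dist_self, mul_zero] at h2
  refine tendsto_iff_dist_tendsto_zero.2 (squeeze_zero' (Eventually.of_forall fun _ => dist_nonneg)
    ?_ h2)
  filter_upwards [self_mem_nhdsWithin] with y hy using hS.dist_refMap_le_dist hn hL T hy hx

theorem StandingAssumptions.norm_χ_sub_X_le (hS : S.StandingAssumptions k cbar c L C₁ C₂)
    (T : S.Elem) {x : Euc n} (hx : x ∈ refSimplex n) : ‖S.χ T x - S.X k T x‖ ≤ S.β k T := by
  have hχ : ContinuousOn (S.χ T) (refSimplex n) :=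
    (LipschitzOnWith.of_dist_le_mul (K := (L * S.h T).toNNReal) fun x hx y hy =>
      (hS.dist_χ_le T x (S.refSimplex_subset_refPatch T hx) y
        (S.refSimplex_subset_refPatch T hy)).trans (by
          gcongr
          exact Real.le_coe_toNNReal _)).continuousOn
  exact le_csSup ((isCompact_refSimplex n).bddAbove_image
    (hχ.sub (continuous_lagrangeInterp _).continuousOn).norm) (mem_image_of_mem _ hx)

theorem StandingAssumptions.β_nonneg (hS : S.StandingAssumptions k cbar c L C₁ C₂)
    (T : S.Elem) : 0 ≤ S.β k T :=
  (norm_nonneg _).trans (hS.norm_χ_sub_X_le T (zero_mem_refSimplex n))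

theorem StandingAssumptions.dist_refMap_le (hS : S.StandingAssumptions k cbar c L C₁ C₂)
    (hn : 1 ≤ n) (hL : 1 ≤ L) (T : S.Elem) {x : Euc n} (hx : x ∈ refSimplex n) :
    dist (S.refMap k T x) x ≤ L / S.h T * (2 * S.β k T) := by
  have hh := hS.h_pos hn T
  have hx' := S.refSimplex_subset_refPatch T hx
  refine (hS.dist_le_dist_χ hn hL T _ (hS.mapsTo_refMap T hx) _ hx').trans ?_
  gcongr
  have h1 := (hS.isClosestPoint T hx).2 _ (S.mapsTo_χ T hx')
  have h2 := hS.norm_χ_sub_X_le T hx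
  rw [← dist_eq_norm, dist_comm] at h2
  rw [hS.χ_refMap T hx]
  have h3 := dist_triangle_left (closestPoint S.γ (S.X k T x)) (S.χ T x) (S.X k T x)
  linarith

end ParametricSurface

namespace ParametricSurface

variable {n m k : ℕ} {patch : Fin m → RefPatch n} {S : ParametricSurface patch}
  {cbar c L C₁ C₂ : ℝ}

/-- The interior points of the reference simplex at which the area element of `P_d ∘ X_T` is bounded
from below by that of `X_T`. -/
def nondegenerateSet (S : ParametricSurface patch) (k : ℕ) (C₁ : ℝ) (T : S.Elem) : Set (Euc n) :=
  {x ∈ interior (refSimplex n) |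
    C₁ ≤ areaElement (closestPoint S.γ ∘ S.X k T) x / areaElement (S.X k T) x}

theorem StandingAssumptions.volume_diff_nondegenerateSet
    (hS : S.StandingAssumptions k cbar c L C₁ C₂) (T : S.Elem) :
    volume (refSimplex n \ S.nondegenerateSet k C₁ T) = 0 := by
  have h1 := (ae_restrict_iff' (isCompact_refSimplex n).measurableSet).1 (hS.nondegenerate T)
  rw [ae_iff] at h1
  refine measure_mono_null (fun x hx => ?_)
    (measure_union_null h1 ((convex_refSimplex n).addHaar_frontier volume))
  by_cases hxi : x ∈ interior (refSimplex n)
  · exact Or.inl fun h => hx.2 ⟨hxi, (h hx.1).2.1⟩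
  · exact Or.inr ⟨subset_closure hx.1, hxi⟩

theorem StandingAssumptions.eventually_isClosestPoint
    (hS : S.StandingAssumptions k cbar c L C₁ C₂) (T : S.Elem) {x : Euc n}
    (hx : x ∈ interior (refSimplex n)) :
    ∀ᶠ y in 𝓝 x, IsClosestPoint S.γ (S.X k T y) ((closestPoint S.γ ∘ S.X k T) y) := by
  filter_upwards [mem_interior_iff_mem_nhds.1 hx] with y hy using hS.isClosestPoint T hy

theorem StandingAssumptions.le_areaElement (hS : S.StandingAssumptions k cbar c L C₁ C₂)
    (hc : 0 < c) (hC₁ : 0 < C₁) (hn : 1 ≤ n) (T : S.Elem) {x : Euc n}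
    (hx : x ∈ S.nondegenerateSet k C₁ T) :
    C₁ * (c⁻¹ * Metric.diam (S.flatElem T)) ^ n ≤
      areaElement (closestPoint S.γ ∘ S.X k T) x := by
  have hd := S.diam_flatElem_pos hn T
  have h1 : (c⁻¹ * Metric.diam (S.flatElem T)) ^ n ≤ areaElement (S.X k T) x := by
    rw [areaElement_eq]
    exact pow_le_sqrt_det_gram _ (by positivity) fun v =>
      (hS.shapeRegular T x (interior_subset hx.1) v).1
  have h2 : 0 < areaElement (S.X k T) x := lt_of_lt_of_le (by positivity) h1
  calc _ ≤ C₁ * areaElement (S.X k T) x := by gcongr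
    _ ≤ _ := (le_div_iff₀ h2).1 hx.2

theorem areaElement_eq_zero_of_not_differentiableAt {N : ℕ} (hn : 1 ≤ n) {F : Euc n → Euc N}
    {x : Euc n} (h : ¬DifferentiableAt ℝ F x) : areaElement F x = 0 := by
  have : Nonempty (Fin n) := ⟨⟨0, hn⟩⟩
  rw [areaElement, fderiv_zero_of_not_differentiableAt h]
  simp only [zero_apply, inner_zero_left]
  rw [show (Matrix.of fun _ _ : Fin n => (0 : ℝ)) = 0 from rfl, Matrix.det_zero,
    Real.sqrt_zero]

theorem StandingAssumptions.differentiableAt (hS : S.StandingAssumptions k cbar c L C₁ C₂)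
    (hc : 0 < c) (hC₁ : 0 < C₁) (hn : 1 ≤ n) (T : S.Elem) {x : Euc n}
    (hx : x ∈ S.nondegenerateSet k C₁ T) :
    DifferentiableAt ℝ (closestPoint S.γ ∘ S.X k T) x := by
  have hd := S.diam_flatElem_pos hn T
  by_contra h
  have h1 := hS.le_areaElement hc hC₁ hn T hx
  rw [areaElement_eq_zero_of_not_differentiableAt hn h] at h1
  have : 0 < C₁ * (c⁻¹ * Metric.diam (S.flatElem T)) ^ n := by positivity
  linarith

theorem StandingAssumptions.norm_fderiv_le (hS : S.StandingAssumptions k cbar c L C₁ C₂)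
    (hc : 0 < c) (hC₁ : 0 < C₁) (hn : 1 ≤ n) (T : S.Elem) {x : Euc n}
    (hx : x ∈ S.nondegenerateSet k C₁ T) {φ : Euc (n + 1) → ℝ}
    (hφ : IsLocalDefiningFunction S.γ (closestPoint S.γ (S.X k T x)) φ) (v : Euc n) (a : ℝ) :
    ‖fderiv ℝ (closestPoint S.γ ∘ S.X k T) x v‖ ≤
      2 * ‖fderiv ℝ (S.X k T) x v - a • gradient φ (closestPoint S.γ (S.X k T x))‖ :=
  norm_fderiv_closest_le (hasFDerivAt_lagrangeInterp _ x).differentiableAt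
    (hS.differentiableAt hc hC₁ hn T hx) (hS.eventually_isClosestPoint T hx.1) hφ
    (hS.near _ (S.X_mem_Γ T (interior_subset hx.1))) v a

theorem StandingAssumptions.le_norm_fderiv (hS : S.StandingAssumptions k cbar c L C₁ C₂)
    (hc : 0 < c) (hC₁ : 0 < C₁) (hn : 1 ≤ n) (T : S.Elem) {x : Euc n}
    (hx : x ∈ S.nondegenerateSet k C₁ T) (v : Euc n) :
    C₁ * c⁻¹ ^ n / (2 * c) ^ (n - 1) * Metric.diam (S.flatElem T) * ‖v‖ ≤
      ‖fderiv ℝ (closestPoint S.γ ∘ S.X k T) x v‖ := by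
  have hd := S.diam_flatElem_pos hn T
  set d := Metric.diam (S.flatElem T)
  have hxT := interior_subset hx.1
  obtain ⟨φ, hφ⟩ := S.isC2Hypersurface _ (hS.isClosestPoint T hxT).1
  have hle := hS.le_areaElement hc hC₁ hn T hx
  rw [areaElement_eq] at hle
  have h1 := le_norm_apply_of_le_sqrt_det_gram (fderiv ℝ (closestPoint S.γ ∘ S.X k T) x)
    (a := C₁ * (c⁻¹ * d) ^ n) (M := 2 * c * d) (by positivity) (by positivity) (fun v => by
      have h2 := hS.norm_fderiv_le hc hC₁ hn T hx hφ v 0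
      rw [zero_smul, sub_zero] at h2
      have h3 := (hS.shapeRegular T x hxT v).2
      linarith) hle v
  refine le_trans (le_of_eq ?_) h1
  obtain ⟨j, rfl⟩ := Nat.exists_eq_add_of_le' hn
  simp only [Nat.add_sub_cancel, mul_pow, inv_pow, pow_succ]
  field_simp

theorem StandingAssumptions.eq_of_closestPoint_eq (hS : S.StandingAssumptions k cbar c L C₁ C₂)
    (hc : 0 < c) (hC₁ : 0 < C₁) (hn : 1 ≤ n) (T : S.Elem) {C A : ℝ}
    (hC : ∀ x ∈ refSimplex n, ∀ y ∈ refSimplex n,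
      ‖S.X k T y - S.X k T x - fderiv ℝ (S.X k T) x (y - x)‖ ≤ C * A * ‖y - x‖ ^ 2)
    {x y : Euc n} (hx : x ∈ S.nondegenerateSet k C₁ T) (hy : y ∈ refSimplex n)
    (hxy : 2 * (C * A) * dist x y <
      C₁ * c⁻¹ ^ n / (2 * c) ^ (n - 1) * Metric.diam (S.flatElem T))
    (h : closestPoint S.γ (S.X k T x) = closestPoint S.γ (S.X k T y)) : x = y := by
  have hxT := interior_subset hx.1
  obtain ⟨φ, hφ⟩ := S.isC2Hypersurface _ (hS.isClosestPoint T hxT).1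
  obtain ⟨s, hs⟩ := (hS.isClosestPoint T hxT).exists_sub_eq_smul_gradient hφ
  have hy' := hS.isClosestPoint T hy
  rw [← h] at hy'
  obtain ⟨t, ht⟩ := hy'.exists_sub_eq_smul_gradient hφ
  have h1 := hS.norm_fderiv_le hc hC₁ hn T hx hφ (y - x) (t - s)
  have h2 : (t - s) • gradient φ (closestPoint S.γ (S.X k T x)) = S.X k T y - S.X k T x := by
    rw [sub_smul, ← hs, ← ht]
    abel
  rw [h2, norm_sub_rev] at h1
  have h3 := hC x hxT y hy
  have h4 := hS.le_norm_fderiv hc hC₁ hn T hx (y - x)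
  by_contra hne
  have h5 : 0 < ‖y - x‖ := norm_pos_iff.2 (sub_ne_zero.2 fun h => hne h.symm)
  rw [dist_comm, dist_eq_norm] at hxy
  have h6 := mul_lt_mul_of_pos_right hxy h5
  nlinarith

theorem StandingAssumptions.exists_dist_refMap_ge (hS : S.StandingAssumptions k cbar c L C₁ C₂)
    (hc : 0 < c) (hC₁ : 0 < C₁) (hn : 1 ≤ n) (hL : 1 ≤ L) (T : S.Elem) {Ch : ℝ} (hCh : 0 < Ch)
    (hh : S.h T ≤ Ch * Metric.diam (S.flatElem T)) {x : Euc n}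
    (hx : x ∈ S.nondegenerateSet k C₁ T) :
    ∃ δ > 0, ∀ y ∈ refSimplex n, dist y x < δ →
      C₁ * c⁻¹ ^ n / (2 * c) ^ (n - 1) / (2 * (L * Ch)) * dist x y ≤
        dist (S.refMap k T x) (S.refMap k T y) := by
  have hd := S.diam_flatElem_pos hn T
  set d := Metric.diam (S.flatElem T)
  set θ := C₁ * c⁻¹ ^ n / (2 * c) ^ (n - 1)
  have hθ : 0 < θ := by positivity
  have hxT := interior_subset hx.1
  have hD := (hS.differentiableAt hc hC₁ hn T hx).hasFDerivAt
  obtain ⟨δ, hδ, hball⟩ := Metric.eventually_nhds_iff.1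
    (hD.isLittleO.def (show 0 < θ * d / 2 by positivity))
  refine ⟨δ, hδ, fun y hy hyx => ?_⟩
  have h1 := hball hyx
  have h2 := hS.le_norm_fderiv hc hC₁ hn T hx (y - x)
  have h3 := norm_sub_norm_le (fderiv ℝ (closestPoint S.γ ∘ S.X k T) x (y - x))
    ((closestPoint S.γ ∘ S.X k T) y - (closestPoint S.γ ∘ S.X k T) x)
  rw [norm_sub_rev (fderiv ℝ (closestPoint S.γ ∘ S.X k T) x (y - x))] at h3
  have h4 := hS.dist_χ_le T _ (hS.mapsTo_refMap T hy) _ (hS.mapsTo_refMap T hxT)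
  rw [hS.χ_refMap T hy, hS.χ_refMap T hxT, dist_eq_norm] at h4
  simp only [Function.comp_apply] at h1 h3
  have h5 : L * S.h T * dist (S.refMap k T y) (S.refMap k T x) ≤
      L * (Ch * d) * dist (S.refMap k T y) (S.refMap k T x) := by gcongr
  rw [dist_comm x, dist_comm (S.refMap k T x), dist_eq_norm y, div_mul_eq_mul_div,
    div_le_iff₀ (by positivity)]
  refine le_of_mul_le_mul_right ?_ hd
  linarith

theorem exists_volume_inter_preimage_refMap_le (k : ℕ) (hn : 1 ≤ n) (hk : 1 ≤ k)
    (hcbar : 0 < cbar) (hc : 0 < c) (hL : 1 ≤ L) (hC₁ : 0 < C₁) (C₂ : ℝ)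
    (patch : Fin m → RefPatch n) : ∃ M : ℝ, 0 ≤ M ∧ ∀ S : ParametricSurface patch,
      S.StandingAssumptions k cbar c L C₁ C₂ → ∀ (T : S.Elem) (N : Set (Euc n)), MeasurableSet N →
        volume (refSimplex n ∩ S.refMap k T ⁻¹' N) ≤ ENNReal.ofReal M * volume N := by
  obtain ⟨C, hC0, hC⟩ := exists_lagrangeInterp_remainder n k hk
  set Ch := (volume (refSimplex n)).toReal ^ (1 / n : ℝ) * cbar with hChdef
  have hvol : 0 < (volume (refSimplex n)).toReal := ENNReal.toReal_pos
    (Measure.measure_pos_of_nonempty_interior _ (nonempty_interior_refSimplex n)).ne'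
    (isCompact_refSimplex n).measure_lt_top.ne
  have hCh : 0 < Ch := by positivity
  set θ := C₁ * c⁻¹ ^ n / (2 * c) ^ (n - 1) with hθdef
  have hθ : 0 < θ := by positivity
  set E := Metric.diam (refSimplex n) with hE
  have hE0 : 0 ≤ E := Metric.diam_nonneg
  have hL0 : 0 < L := by linarith
  set ρ := θ / (2 * (C * (L * Ch * E)) + 1) with hρdef
  have hρ : 0 < ρ := by positivity
  obtain ⟨t, -, htfin, ht⟩ := (isCompact_refSimplex n).finite_cover_balls (half_pos hρ)
  refine ⟨htfin.toFinset.card * (θ / (2 * (L * Ch)))⁻¹ ^ n, by positivity, fun S hS T N hN => ?_⟩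
  have hd := S.diam_flatElem_pos hn T
  have hh := hS.h_le hn hcbar T
  set d := Metric.diam (S.flatElem T) with hddef
  refine volume_inter_preimage_le (by positivity) (isCompact_refSimplex n).isClosed
    (hS.continuousOn_refMap hn hL T) (hS.volume_diff_nondegenerateSet T)
    (fun x hx => hS.exists_dist_refMap_ge hc hC₁ hn hL T hCh hh hx) (ρ := ρ)
    (fun x hx y hy hxy heq => ?_) (by simpa using ht) hN
  have hyT := interior_subset hy.1
  refine hS.eq_of_closestPoint_eq hc hC₁ hn T (C := C) (A := L * (Ch * d) * E)
    (hC _ _ _ fun a ha b hb => ?_) hx hyT ?_ ?_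
  · rw [← dist_eq_norm]
    refine (hS.dist_χ_le T a (S.refSimplex_subset_refPatch T ha) b
      (S.refSimplex_subset_refPatch T hb)).trans ?_
    gcongr
    exact Metric.dist_le_diam_of_mem (isCompact_refSimplex n).isBounded ha hb
  · rw [hρdef, lt_div_iff₀ (by positivity)] at hxy
    have h1 : 2 * (C * (L * (Ch * d) * E)) * dist x y ≤
        d * (dist x y * (2 * (C * (L * Ch * E)) + 1)) := by
      have : 0 ≤ d * dist x y := by positivity
      linarith
    have h2 := mul_lt_mul_of_pos_left hxy hd
    linarith
  · rw [← hS.χ_refMap T (interior_subset hx.1), heq, hS.χ_refMap T hyT]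

end ParametricSurface

end SurfaceFEM

end

theorem mainTheorem3 (n k : ℕ) (hn : 1 ≤ n) (hk : 1 ≤ k)
    (cbar c L C₁ C₂ : ℝ) (hcbar : 0 < cbar) (hc : 0 < c) (hL : 1 ≤ L) (hC₁ : 0 < C₁)
    (m : ℕ) (patch : Fin m → SurfaceFEM.RefPatch n) :
    ∃ D : ℝ, 0 < D ∧
      ∀ S : SurfaceFEM.ParametricSurface patch, S.StandingAssumptions k cbar c L C₁ C₂ →
        ∀ (w : SurfaceFEM.Euc (n + 1) → ℝ) (G : SurfaceFEM.Euc (n + 1) → SurfaceFEM.Euc (n + 1)),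
          SurfaceFEM.MemH1 S.γ w G → ∀ T : S.Elem,
            MemLp (fun y => w y - w (S.ψ k T y)) 2
                ((SurfaceFEM.surfaceMeasure S.γ).restrict (S.curvedElem T)) ∧
              eLpNorm (fun y => w y - w (S.ψ k T y)) 2
                  ((SurfaceFEM.surfaceMeasure S.γ).restrict (S.curvedElem T)) ≤
                ENNReal.ofReal (D * S.β k T) *
                  SurfaceFEM.h1Norm S.γ (S.curvedPatch T) w G := by
  obtain ⟨M, hM, harea⟩ := SurfaceFEM.ParametricSurface.exists_volume_inter_preimage_refMap_le k hn hk
    hcbar hc hL hC₁ C₂ patch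
  have hL0 : 0 < L := by linarith
  refine ⟨√(L ^ (2 * n) * 2 ^ (2 * n + 5) * (1 + M) * (16 * L ^ 4)), by positivity,
    fun S hS w G hw T => ?_⟩
  have hh := hS.h_pos hn T
  have hβ := hS.β_nonneg T
  obtain ⟨h1, h2⟩ := hw.memLp_sub_comp S.isCompact S.isC2Hypersurface
    (SurfaceFEM.isCompact_refSimplex n) (S.isCompact_refPatch T)
    (patch (S.patchIndex T)).convex_space (S.refSimplex_subset_refPatch T)
    (show 0 ≤ L * S.h T by positivity) (show 0 ≤ L / S.h T by positivity) (S.mapsTo_χ T)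
    (hS.dist_χ_le T) (hS.dist_le_dist_χ hn hL T) (hS.continuousOn_refMap hn hL T)
    (hS.mapsTo_refMap T) ENNReal.ofReal_ne_top (harea S hS T)
    (show 0 ≤ L / S.h T * (2 * S.β k T) by positivity)
    (fun x hx => hS.dist_refMap_le hn hL T hx) (ψ := S.ψ k T)
    (fun x hx => by rw [S.ψ_χ T hx, hS.χ_refMap T hx])
  rw [S.image_χ_refSimplex, S.image_χ_refPatch] at h2
  rw [S.image_χ_refSimplex] at h1
  refine ⟨h1, ?_⟩
  have h3 : SurfaceFEM.h1Norm S.γ (S.curvedPatch T) w G ^ 2 =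
      eLpNorm w 2 ((SurfaceFEM.surfaceMeasure S.γ).restrict (S.curvedPatch T)) ^ 2 +
        eLpNorm G 2 ((SurfaceFEM.surfaceMeasure S.γ).restrict (S.curvedPatch T)) ^ 2 := by
    rw [SurfaceFEM.h1Norm, ← ENNReal.rpow_natCast, ← ENNReal.rpow_mul]
    norm_num
  rw [← ENNReal.pow_le_pow_left_iff two_ne_zero, mul_pow, h3]
  refine h2.trans ?_
  have h4 : ENNReal.ofReal ((L * S.h T) ^ n) * (2 ^ (2 * n + 5) * (1 + ENNReal.ofReal M) *
      ENNReal.ofReal (2 * (L / S.h T * (2 * S.β k T))) ^ 2 * (ENNReal.ofReal (L * S.h T) ^ 2 *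
        (ENNReal.ofReal ((L / S.h T) ^ n) *
          eLpNorm G 2 ((SurfaceFEM.surfaceMeasure S.γ).restrict (S.curvedPatch T)) ^ 2))) =
      ENNReal.ofReal (√(L ^ (2 * n) * 2 ^ (2 * n + 5) * (1 + M) * (16 * L ^ 4)) * S.β k T) ^ 2 *
        eLpNorm G 2 ((SurfaceFEM.surfaceMeasure S.γ).restrict (S.curvedPatch T)) ^ 2 := by
    simp only [← mul_assoc]
    congr 1
    rw [show (2 : ℝ≥0∞) ^ (2 * n + 5) = ENNReal.ofReal (2 ^ (2 * n + 5)) by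
        rw [ENNReal.ofReal_pow (by norm_num)]; simp,
      show 1 + ENNReal.ofReal M = ENNReal.ofReal (1 + M) by
        rw [ENNReal.ofReal_add zero_le_one hM, ENNReal.ofReal_one],
      ← ENNReal.ofReal_pow (by positivity), ← ENNReal.ofReal_pow (by positivity),
      ← ENNReal.ofReal_pow (by positivity), ← ENNReal.ofReal_mul (by positivity),
      ← ENNReal.ofReal_mul (by positivity), ← ENNReal.ofReal_mul (by positivity),
      ← ENNReal.ofReal_mul (by positivity), ← ENNReal.ofReal_mul (by positivity)]
    congr 1
    rw [mul_pow (√_), Real.sq_sqrt (by positivity), div_pow, mul_pow L]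
    field_simp
    ring
  rw [h4]
  gcongr
  exact le_add_self
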